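/- There are universal constants $C_{\rm HLS},C_{\rm GN}>0$ such that the Hardy–Littlewood–Sobolev inequality $$\iint_{\mathbf R^3\times\mathbf R^3}\frac{|f(x)||g(y)|}{|x-y|}\,dx\,dy\le C_{\rm HLS}\|f\|_{L^{6/5}}\|g\|_{L^{6/5}}\qquad(f,g\in L^{6/5}(\mathbf R^3))$$ and the Gagliardo–Nirenberg inequality $\|f\|_{L^6}\le C_{\rm GN}\|\nabla f\|_{L^2}$ $(f\in H^1(\mathbf R^3))$ hold, and such that the following is true. Let $V:\mathbf R^3\to\mathbf R$ be continuously differentiable on $\mathbf R^3\setminus\{0\}$ with $V\in L^\infty$ and $x\cdot\nabla V\in L^\infty$. Let $E\in\mathbf R$ and let $u_E\in H^1(\mathbf R^3)$ be a real-valued (not necessarily radial) bound state, i.e. a distributional solution of $$-\Delta u_E+Vu_E-(|x|^{-1}*|u_E|^2)u_E=-Eu_E .$$ On $L^2(\mathbf R^3;\mathbf C)^2$ with domain $H^2(\mathbf R^3;\mathbf C)^2$ consider the linearized operator $$JL\begin{pmatrix}u\\v\end{pmatrix}=\begin{pmatrix}L_-v\\-L_+u\end{pmatrix},\qquad L_-=-\Delta+E+V-(|x|^{-1}*|u_E|^2),\qquad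 L_+=L_--2\bigl(|x|^{-1}*(u_E\,\bullet)\bigr)u_E .$$ Then $u_E\in L^3$, the eigenvalues of $JL$ belong to its spectrum $\sigma(JL)$, and every $\lambda=\sigma+i\tau$ in the spectrum of $JL$ (in particular every eigenvalue) satisfies $$|\sigma|\le C_{\rm HLS}\|u_E\|_{L^3}^2\le C_{\rm HLS}C_{\rm GN}\|\nabla u_E\|_{L^2}\|u_E\|_{L^2}.$$ Moreover $$\int|\nabla u_E|^2\,dx=\frac E3\int|u_E|^2\,dx+\frac13\int V|u_E|^2\,dx+\frac23\int (x\cdot\nabla V)|u_E|^2\,dx,$$ and $$\sup_{\lambda\in\sigma(JL)}|\mathrm{Re}\,\lambda|\le C_{\rm HLS}C_{\rm GN}\|u_E\|_{L^2}^2\sqrt{\tfrac13E+\tfrac13\|V\|_{L^\infty}+\tfrac23\|x\cdot\nabla V\|_{L^\infty}} .$$ (If the quantity under the root is negative, the root is read as $0$; this occurs only for $u_E=0$.) Finally, in the zero-mass limit the real parts vanish: for every such $V$ and every $\varepsilon>0$ there is $\delta>0$ such that for every $E$ and every bound state $u_E$ with $\|u_E\|_{L^2}<\delta$, all $\lambda\in\sigma(JL)$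 satisfy $|\mathrm{Re}\,\lambda|<\varepsilon$. -/

import Mathlib

open MeasureTheory TemperedDistribution
open scoped ENNReal SchwartzMap LineDeriv Laplacian

noncomputable section

namespace SchrodingerPoisson

/-- Three-dimensional Euclidean space. -/
abbrev Space : Type := EuclideanSpace ℝ (Fin 3)

/-- The complex Hilbert space `L²(ℝ³; ℂ)`. -/
abbrev L2 : Type := Lp ℂ 2 (volume : Measure Space)

/-- The convolution `(|x|⁻¹ * f)(x) = ∫ f(y) / |x - y| dy`. -/
def coulombConv (f : Space → ℂ) (x : Space) : ℂ :=
  ∫ y, f y / (‖x - y‖ : ℂ)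

/-- The function `x ↦ x · ∇V(x)`. -/
def xDotGrad (V : Space → ℝ) (x : Space) : ℝ :=
  inner ℝ x (gradient V x)

/-- The essential supremum norm `‖f‖_{L^∞}` (used only for functions in `L^∞`). -/
def supNorm (f : Space → ℝ) : ℝ := (eLpNorm f ∞ volume).toReal

/-- The class of external potentials: real-valued, continuously differentiable away from the
origin, with `V` and `x · ∇V` in `L^∞`. -/
structure IsPotential (V : Space → ℝ) : Prop where
  contDiffOn : ContDiffOn ℝ 1 V {0}ᶜ
  memLp_top : MemLp V ∞ volume
  xDotGrad_memLp_top : MemLp (xDotGrad V) ∞ volume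

/-- `h` is the (distributional) Laplacian of `w`, where `w, h ∈ L²`. -/
def HasLaplacian (w h : L2) : Prop :=
  Δ (w : 𝓢'(Space, ℂ)) = (h : 𝓢'(Space, ℂ))

/-- `G = (G₀, G₁, G₂)` is the (distributional) gradient of `u`, where `u, Gᵢ ∈ L²`.
For a given `u ∈ L²` there is such a `G` exactly when `u ∈ H¹`, and `G` is then unique. -/
def HasGrad (u : L2) (G : Fin 3 → L2) : Prop :=
  ∀ i, ∂_{EuclideanSpace.single i (1 : ℝ)} (u : 𝓢'(Space, ℂ)) = (G i : 𝓢'(Space, ℂ))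

/-- `∫ |∇u|² dx`, for `G = ∇u`. -/
def gradSq (G : Fin 3 → L2) : ℝ := ∫ x, ∑ i, ‖G i x‖ ^ 2

/-- `‖∇u‖_{L²}`, for `G = ∇u`. -/
def gradNorm (G : Fin 3 → L2) : ℝ := √(gradSq G)

/-- `‖u‖_{L³}`. -/
def L3norm (u : L2) : ℝ := (eLpNorm u 3 volume).toReal

/-- A bound state: a real-valued `u ∈ H¹(ℝ³)` that solves
`-Δu + V u - (|x|⁻¹ * |u|²) u = -E u` in the sense of distributions. -/
structure IsBoundState (V : Space → ℝ) (E : ℝ) (u : L2) : Prop where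
  real : ∀ᵐ x, (u x).im = 0
  memH1 : MemSobolev 1 2 (u : 𝓢'(Space, ℂ))
  equation : ∃ h : L2, HasLaplacian u h ∧
    ∀ᵐ x, -h x + V x * u x - coulombConv (fun y => (‖u y‖ : ℂ) ^ 2) x * u x = -E * u x

/-- `f = L₋ w`: `w` lies in the domain `H²(ℝ³; ℂ)` and
`f = -Δw + E w + V w - (|x|⁻¹ * |u|²) w`. -/
def IsLminus (V : Space → ℝ) (E : ℝ) (u w f : L2) : Prop :=
  MemSobolev 2 2 (w : 𝓢'(Space, ℂ)) ∧ ∃ h : L2, HasLaplacian w h ∧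
    ∀ᵐ x, f x = -h x + E * w x + V x * w x
      - coulombConv (fun y => (‖u y‖ : ℂ) ^ 2) x * w x

/-- `f = L₊ w`: `w` lies in the domain `H²(ℝ³; ℂ)` and
`f = -Δw + E w + V w - (|x|⁻¹ * |u|²) w - 2 (|x|⁻¹ * (u w)) u`. -/
def IsLplus (V : Space → ℝ) (E : ℝ) (u w f : L2) : Prop :=
  MemSobolev 2 2 (w : 𝓢'(Space, ℂ)) ∧ ∃ h : L2, HasLaplacian w h ∧
    ∀ᵐ x, f x = -h x + E * w x + V x * w x
      - coulombConv (fun y => (‖u y‖ : ℂ) ^ 2) x * w x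
      - 2 * coulombConv (fun y => u y * w y) x * u x

/-- The graph of the unbounded operator `JL` on `L² × L²` with domain `H² × H²`:
`JL (a, b) = (L₋ b, -L₊ a)`. -/
def IsJL (V : Space → ℝ) (E : ℝ) (u : L2) (p q : L2 × L2) : Prop :=
  IsLminus V E u p.2 q.1 ∧ IsLplus V E u p.1 (-q.2)

/-- The eigenvalues of `JL`. -/
def eigenvaluesJL (V : Space → ℝ) (E : ℝ) (u : L2) : Set ℂ :=
  {z | ∃ p : L2 × L2, p ≠ 0 ∧ IsJL V E u p (z • p)}

/-- The spectrum of `JL`: the complement of the set of those `z` for which `JL - z` has an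
everywhere defined bounded two-sided inverse `R`. -/
def spectrumJL (V : Space → ℝ) (E : ℝ) (u : L2) : Set ℂ :=
  {z | ¬ ∃ R : (L2 × L2) →L[ℂ] (L2 × L2),
    ∀ p q : L2 × L2, R q = p ↔ IsJL V E u p (q + z • p)}

/-- `C` is a constant in the Hardy-Littlewood-Sobolev inequality
`∬ |f(x)| |g(y)| / |x - y| dx dy ≤ C ‖f‖_{L^{6/5}} ‖g‖_{L^{6/5}}` on `ℝ³`. -/
def IsHLSConstant (C : ℝ) : Prop :=
  ∀ f g : Space → ℂ, MemLp f (6 / 5) volume → MemLp g (6 / 5) volume →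
    ∫⁻ x, ∫⁻ y, ‖f x‖ₑ * ‖g y‖ₑ / ‖x - y‖ₑ
      ≤ ENNReal.ofReal C * eLpNorm f (6 / 5) volume * eLpNorm g (6 / 5) volume

/-- `C` is a constant in the Gagliardo-Nirenberg(-Sobolev) inequality
`‖f‖_{L⁶} ≤ C ‖∇f‖_{L²}` on `H¹(ℝ³)`. -/
def IsGNConstant (C : ℝ) : Prop :=
  ∀ (f : L2) (G : Fin 3 → L2), MemSobolev 1 2 (f : 𝓢'(Space, ℂ)) → HasGrad f G →
    eLpNorm f 6 volume ≤ ENNReal.ofReal (C * gradNorm G)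

end SchrodingerPoisson

end

noncomputable section

namespace SchrodingerPoisson

open Set Metric Filter Topology
open scoped NNReal FourierTransform

/-! ### The Hardy-Littlewood-Sobolev inequality -/

/-! Growth rates. Write `W` for the exchange operator w ↦ (|x|⁻¹ * (u w)) u, so that L₊ = L₋ - 2W.
Since L₋ is symmetric, its contributions to Re⟨a, L₋b⟩ - Re⟨b, L₊a⟩ cancel and only 2 Re⟨b, Wa⟩
remains, which is at most ‖W‖(‖a‖² + ‖b‖²). Hence JL - z is bounded below once |Re z| > ‖W‖. The
same computation for the adjoint shows that the range is everything, so z is in the resolvent set.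
To avoid unbounded operators, the domain is parametrised as the range of R₀ = (1 - (2π)⁻²Δ)⁻¹, and
(JL - z)(R₀ ⊕ R₀) is the bounded operator `blockOp`.

Size of W. Its kernel is u(x)u(y)/|x - y|, so the square of its Hilbert-Schmidt norm is ∬
|u(x)|²|u(y)|²/|x - y|². By the Hardy-Littlewood-Sobolev inequality with exponent 2 this is at most
a constant times ‖u‖₃⁴. Thus ‖W‖ ≤ C‖u‖₃², and Hölder together with Gagliardo-Nirenberg gives ‖u‖₃²
≤ ‖u‖₂‖u‖₆ ≤ C‖∇u‖₂‖u‖₂. The final constant is chosen to dominate the Hardy-Littlewood-Sobolev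
constants for both kernels |x - y|⁻¹ and |x - y|⁻².

Virial identities. Let D = ∫ (|x|⁻¹ * |u|²)|u|². Testing the equation with u and with x·∇u gives two
relations between ‖∇u‖², E‖u‖², ∫V|u|², ∫(x·∇V)|u|² and D (`IsBoundState.energy_identity`,
`IsBoundState.dilation_identity`). Eliminating D yields the stated formula. Eliminating E and V
instead yields ‖∇u‖² = D/4 + ½∫(x·∇V)|u|². The multiplier x·∇u is reached through compactly
supported C¹ fields that vanish near the origin and have uniformly bounded derivatives (`dilField`);
the Coulomb kernel is regularised meanwhile.

Zero-mass limit. The second elimination contains no E. As D ≤ ‖W‖‖u‖² ≤ C‖∇u‖‖u‖³, it forces ‖∇u‖ ≤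
C'‖u‖ when ‖u‖ ≤ 1, uniformly in E, and the growth rates are then O(‖u‖²). -/

theorem lintegral_eq_smul_comp_smul (f : Space → ℝ≥0∞) {R : ℝ} (hR : 0 < R) :
    ∫⁻ x, f x = ENNReal.ofReal R ^ (3 : ℝ) * ∫⁻ x, f (R • x) := by
  have h : ∫⁻ x, f (R • x) = ∫⁻ x, f x ∂(Measure.map (R • ·) (volume : Measure Space)) :=
    (lintegral_map_equiv f (Homeomorph.smulOfNeZero R hR.ne').toMeasurableEquiv).symm
  rw [h, Measure.map_addHaar_smul _ hR.ne', lintegral_smul_measure, smul_eq_mul, ← mul_assoc]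
  have : ENNReal.ofReal R ^ (3 : ℝ) * ENNReal.ofReal |(R ^ Module.finrank ℝ Space)⁻¹| = 1 := by
    rw [ENNReal.ofReal_rpow_of_pos hR, ← ENNReal.ofReal_mul (by positivity), abs_of_pos (by positivity)]
    simp only [finrank_euclideanSpace, Fintype.card_fin]
    rw [show R ^ (3 : ℝ) = R ^ (3 : ℕ) by norm_cast, mul_inv_cancel₀ (by positivity)]
    simp
  rw [this, one_mul]

theorem enorm_smul_rpow {R : ℝ} (hR : 0 < R) (s : ℝ) (x : Space) :
    ‖R • x‖ₑ ^ s = ENNReal.ofReal R ^ s * ‖x‖ₑ ^ s := by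
  rw [enorm_smul, Real.enorm_of_nonneg hR.le]
  exact ENNReal.mul_rpow_of_ne_top ENNReal.ofReal_ne_top enorm_ne_top s

theorem setLIntegral_enorm_rpow_scale (s : ℝ) {R : ℝ} (hR : 0 < R) {S T : Set Space}
    (hS : MeasurableSet S) (hT : MeasurableSet T) (hST : ∀ x, R • x ∈ S ↔ x ∈ T) :
    ∫⁻ x in S, ‖x‖ₑ ^ s = ENNReal.ofReal R ^ (3 + s) * ∫⁻ x in T, ‖x‖ₑ ^ s := by
  rw [← lintegral_indicator hS, ← lintegral_indicator hT, lintegral_eq_smul_comp_smul _ hR]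
  have : ∀ x : Space, S.indicator (fun x => ‖x‖ₑ ^ s) (R • x)
      = ENNReal.ofReal R ^ s * T.indicator (fun x => ‖x‖ₑ ^ s) x := by
    intro x
    by_cases h : x ∈ T
    · rw [indicator_of_mem h, indicator_of_mem ((hST x).2 h), enorm_smul_rpow hR]
    · rw [indicator_of_notMem h, indicator_of_notMem (mt (hST x).1 h), mul_zero]
  simp_rw [this]
  rw [lintegral_const_mul' _ _ (ENNReal.rpow_ne_top_of_ne_zero (by simpa) (by simp)), ← mul_assoc,
    ENNReal.rpow_add _ _ (by simpa) (by simp)]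

theorem lintegral_ball_enorm_rpow (s : ℝ) {R : ℝ} (hR : 0 < R) :
    ∫⁻ x in ball (0 : Space) R, ‖x‖ₑ ^ s
      = ENNReal.ofReal R ^ (3 + s) * ∫⁻ x in ball (0 : Space) 1, ‖x‖ₑ ^ s :=
  setLIntegral_enorm_rpow_scale s hR measurableSet_ball measurableSet_ball
    (by simp [norm_smul, abs_of_pos hR, hR])

theorem lintegral_compl_ball_enorm_rpow (s : ℝ) {R : ℝ} (hR : 0 < R) :
    ∫⁻ x in (ball (0 : Space) R)ᶜ, ‖x‖ₑ ^ s
      = ENNReal.ofReal R ^ (3 + s) * ∫⁻ x in (ball (0 : Space) 1)ᶜ, ‖x‖ₑ ^ s :=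
  setLIntegral_enorm_rpow_scale s hR measurableSet_ball.compl measurableSet_ball.compl
    (by simp [norm_smul, abs_of_pos hR, hR])

theorem enorm_rpow_eq_ofReal {x : Space} (hx : x ≠ 0) (s : ℝ) :
    ‖x‖ₑ ^ s = ENNReal.ofReal (‖x‖ ^ s) := by
  rw [← ofReal_norm, ENNReal.ofReal_rpow_of_pos (by positivity)]

theorem ae_ne_zero : ∀ᵐ x : Space, x ≠ 0 := by
  simp [ae_iff]

theorem lintegral_unitBall_enorm_rpow_ne_top {s : ℝ} (hs : -3 < s) :
    ∫⁻ x in ball (0 : Space) 1, ‖x‖ₑ ^ s ≠ ∞ := by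
  have h : IntegrableOn (fun x : Space => ‖x‖ ^ s) (ball 0 1) := by
    rw [integrableOn_fun_norm_addHaar volume (f := fun r => r ^ s)]
    have : IntegrableOn (fun y : ℝ => y ^ (2 + s)) (Ioo 0 1) := by
      rw [intervalIntegral.integrableOn_Ioo_rpow_iff one_pos]; linarith
    refine this.congr_fun (fun y hy => ?_) measurableSet_Ioo
    simp [Real.rpow_add hy.1]
  have := h.lintegral_lt_top
  rw [lintegral_congr_ae (g := fun x : Space => ENNReal.ofReal (‖x‖ ^ s))
    (ae_restrict_of_ae (ae_ne_zero.mono fun x hx => enorm_rpow_eq_ofReal hx s))]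
  exact this.ne

theorem lintegral_compl_unitBall_enorm_rpow_ne_top {s : ℝ} (hs : s < -3) :
    ∫⁻ x in (ball (0 : Space) 1)ᶜ, ‖x‖ₑ ^ s ≠ ∞ := by
  have h : Integrable (fun x : Space => (1 + ‖x‖) ^ s) := by
    have := integrable_one_add_norm (E := Space) (μ := volume) (r := -s) (by simp; linarith)
    simpa using this
  have h2 : Integrable (fun x : Space => (2 : ℝ) ^ (-s) * (1 + ‖x‖) ^ s) := h.const_mul _
  -- For |x| ≥ 1 one has 1 + |x| ≤ 2|x|, and the negative power s turns this into |x|^s ≤ 2^(-s) (1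
  -- + |x|)^s.
  refine ne_top_of_le_ne_top h2.lintegral_lt_top.ne ?_
  refine le_trans ?_ (setLIntegral_le_lintegral (ball (0 : Space) 1)ᶜ _)
  refine setLIntegral_mono' measurableSet_ball.compl fun x hx => ?_
  have hx1 : 1 ≤ ‖x‖ := by simpa using hx
  rw [enorm_rpow_eq_ofReal (by rintro rfl; norm_num at hx1)]
  refine ENNReal.ofReal_le_ofReal ?_
  have : ‖x‖ ^ s = 2 ^ (-s) * (2 * ‖x‖) ^ s := by
    rw [Real.mul_rpow (by norm_num) (by positivity), ← mul_assoc, ← Real.rpow_add (by norm_num)]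
    simp
  rw [this]
  gcongr ?_ * ?_
  exact Real.rpow_le_rpow_of_nonpos (by positivity) (by linarith) (by linarith)

/-- The kernel potential of a function truncated at height `t`. -/
theorem exists_lintegral_truncated_le {l : ℝ} (hl0 : 0 < l) (hl : l < 3) :
    ∃ C : ℝ≥0∞, C ≠ ∞ ∧ ∀ g : Space → ℝ≥0, AEMeasurable g →
      ∫⁻ y, (g y : ℝ≥0∞) ^ (6 / (6 - l)) ≤ 1 → ∀ (t : ℝ≥0) (x : Space),
      ∫⁻ y in {y | g y ≤ t}, g y * ‖x - y‖ₑ ^ (-l) ≤ C * (t : ℝ≥0∞) ^ (l / (6 - l)) := by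
  have h6 : 0 < 6 - l := by linarith
  set A := ∫⁻ x in ball (0 : Space) 1, ‖x‖ₑ ^ (-l)
  set B := (∫⁻ x in (ball (0 : Space) 1)ᶜ, ‖x‖ₑ ^ (-6 : ℝ)) ^ (l / 6)
  have hA : A ≠ ∞ := lintegral_unitBall_enorm_rpow_ne_top (by linarith)
  have hB : B ≠ ∞ := ENNReal.rpow_ne_top_of_nonneg (by positivity)
    (lintegral_compl_unitBall_enorm_rpow_ne_top (by norm_num))
  refine ⟨A + B, by simp [hA, hB], fun g hg hg1 t x => ?_⟩
  -- The splitting radius chosen below is a negative power of t, so t = 0 is handled apart.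
  rcases eq_or_ne t 0 with rfl | ht
  · have : ∫⁻ y in {y | g y ≤ 0}, g y * ‖x - y‖ₑ ^ (-l) ≤ ∫⁻ y in {y | g y ≤ 0}, 0 := by
      have hm : NullMeasurableSet {y | g y ≤ 0} := nullMeasurableSet_le hg aemeasurable_const
      refine lintegral_mono_ae ?_
      filter_upwards [ae_restrict_mem₀ hm] with y hy
      have : g y = 0 := by simpa using hy
      simp [this]
    exact (this.trans (by simp)).trans bot_le
  have htpos : (0 : ℝ) < t := by exact_mod_cast pos_iff_ne_zero.2 ht
  -- The part |x - y| < R costs t R^(3-l), and Hölder bounds the rest by R^(-l/2). This R makes both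
  -- equal to t^(l/(6-l)).
  set R : ℝ := (t : ℝ) ^ (-2 / (6 - l)) with hRdef
  have hR : 0 < R := by positivity
  have htR : ∀ a : ℝ, ENNReal.ofReal R ^ a = (t : ℝ≥0∞) ^ (-2 / (6 - l) * a) := by
    intro a
    rw [hRdef, ← ENNReal.ofReal_rpow_of_pos htpos, ENNReal.ofReal_coe_nnreal, ENNReal.rpow_mul]
  have hker : Measurable fun y : Space => ‖x - y‖ₑ ^ (-l) := by fun_prop
  have hsub : ∀ (S : Set Space) (F : Space → ℝ≥0∞), MeasurableSet S →
      ∫⁻ y in (fun y => x - y) ⁻¹' S, F (x - y) = ∫⁻ y in S, F y := by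
    intro S F hS
    rw [← lintegral_indicator hS, ← lintegral_sub_left_eq_self (S.indicator F) x,
      ← lintegral_indicator (hS.preimage (by fun_prop))]
    rfl
  set S := (fun y => x - y) ⁻¹' ball (0 : Space) R with hS
  have hSm : MeasurableSet S := measurableSet_ball.preimage (by fun_prop)
  have hm : NullMeasurableSet {y | g y ≤ t} := nullMeasurableSet_le hg aemeasurable_const
  have near : ∫⁻ y in S, (t : ℝ≥0∞) * ‖x - y‖ₑ ^ (-l) = A * (t : ℝ≥0∞) ^ (l / (6 - l)) := by
    rw [lintegral_const_mul _ hker, hsub _ (fun y => ‖y‖ₑ ^ (-l)) measurableSet_ball,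
      lintegral_ball_enorm_rpow _ hR, htR, ← mul_assoc, mul_comm _ A]
    congr 1
    nth_rewrite 1 [← ENNReal.rpow_one (t : ℝ≥0∞)]
    rw [← ENNReal.rpow_add _ _ (by simpa using ht) (by simp)]
    congr 1
    field_simp
    ring
  -- Hölder with exponents 6/(6-l) and 6/l: the kernel becomes |z|⁻⁶, which is integrable at
  -- infinity, and the factor with g is at most 1.
  have far : ∫⁻ y in Sᶜ, g y * ‖x - y‖ₑ ^ (-l) ≤ B * (t : ℝ≥0∞) ^ (l / (6 - l)) := by
    have hpq : (6 / (6 - l)).HolderConjugate (6 / l) := by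
      rw [Real.holderConjugate_iff]
      refine ⟨by rw [lt_div_iff₀ h6]; linarith, ?_⟩
      field_simp
      ring
    calc ∫⁻ y in Sᶜ, g y * ‖x - y‖ₑ ^ (-l)
        ≤ (∫⁻ y in Sᶜ, (g y : ℝ≥0∞) ^ (6 / (6 - l))) ^ (1 / (6 / (6 - l))) *
          (∫⁻ y in Sᶜ, (‖x - y‖ₑ ^ (-l)) ^ (6 / l)) ^ (1 / (6 / l)) :=
          ENNReal.lintegral_mul_le_Lp_mul_Lq _ hpq hg.coe_nnreal_ennreal.restrict
            hker.aemeasurable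
      _ ≤ 1 * (∫⁻ y in Sᶜ, (‖x - y‖ₑ ^ (-l)) ^ (6 / l)) ^ (1 / (6 / l)) := by
          gcongr
          refine ENNReal.rpow_le_one ((setLIntegral_le_lintegral _ _).trans hg1) ?_
          positivity
      _ = B * (t : ℝ≥0∞) ^ (l / (6 - l)) := by
          have h1 : ∀ y, (‖x - y‖ₑ ^ (-l)) ^ (6 / l) = ‖x - y‖ₑ ^ (-6 : ℝ) := by
            intro y
            rw [← ENNReal.rpow_mul]
            congr 1
            field_simp
          simp_rw [h1]
          rw [one_mul, hS, ← preimage_compl, hsub _ (fun y => ‖y‖ₑ ^ (-6 : ℝ)) measurableSet_ball.compl,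
            lintegral_compl_ball_enorm_rpow _ hR, htR, ENNReal.mul_rpow_of_nonneg _ _ (by positivity),
            ← ENNReal.rpow_mul, mul_comm, one_div_div]
          congr 2
          field_simp
          ring
  calc ∫⁻ y in {y | g y ≤ t}, g y * ‖x - y‖ₑ ^ (-l)
      ≤ (∫⁻ y in S ∩ {y | g y ≤ t}, g y * ‖x - y‖ₑ ^ (-l))
        + ∫⁻ y in Sᶜ, g y * ‖x - y‖ₑ ^ (-l) := by
        refine (lintegral_mono_set (t := (S ∩ {y | g y ≤ t}) ∪ Sᶜ) ?_).trans
          (lintegral_union_le _ _ _)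
        intro y hy
        by_cases h : y ∈ S
        · exact Or.inl ⟨h, hy⟩
        · exact Or.inr h
    _ ≤ A * (t : ℝ≥0∞) ^ (l / (6 - l)) + B * (t : ℝ≥0∞) ^ (l / (6 - l)) := by
        refine add_le_add ?_ far
        rw [← near]
        refine le_trans ?_ (lintegral_mono_set (inter_subset_left (t := {y | g y ≤ t})))
        refine lintegral_mono_ae ?_
        filter_upwards [ae_restrict_mem₀ (hSm.nullMeasurableSet.inter hm)] with y hy
        gcongr
        exact_mod_cast hy.2
    _ = (A + B) * (t : ℝ≥0∞) ^ (l / (6 - l)) := by rw [add_mul]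

/-- The Hardy-Littlewood-Sobolev inequality for normalised functions. -/
theorem exists_hls_normalized {l : ℝ} (hl0 : 0 < l) (hl : l < 3) :
    ∃ C : ℝ≥0∞, C ≠ ∞ ∧ ∀ f g : Space → ℝ≥0, AEMeasurable f → AEMeasurable g →
      ∫⁻ y, (f y : ℝ≥0∞) ^ (6 / (6 - l)) ≤ 1 → ∫⁻ y, (g y : ℝ≥0∞) ^ (6 / (6 - l)) ≤ 1 →
      ∫⁻ x, ∫⁻ y, f x * g y * ‖x - y‖ₑ ^ (-l) ≤ C := by
  have h6 : 0 < 6 - l := by linarith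
  obtain ⟨C, hC, H⟩ := exists_lintegral_truncated_le hl0 hl
  -- On the region g(y) ≤ f(x), truncating g at height t = f(x) leaves ∫ f · f^(l/(6-l)) = ∫
  -- f^(6/(6-l)) ≤ 1. The complementary region is the same with f and g exchanged, because the
  -- kernel is symmetric.
  have half : ∀ f g : Space → ℝ≥0, AEMeasurable f → AEMeasurable g →
      ∫⁻ y, (f y : ℝ≥0∞) ^ (6 / (6 - l)) ≤ 1 → ∫⁻ y, (g y : ℝ≥0∞) ^ (6 / (6 - l)) ≤ 1 →
      ∫⁻ x, f x * ∫⁻ y in {y | g y ≤ f x}, g y * ‖x - y‖ₑ ^ (-l) ≤ C := by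
    intro f g hf hg hf1 hg1
    calc ∫⁻ x, f x * ∫⁻ y in {y | g y ≤ f x}, g y * ‖x - y‖ₑ ^ (-l)
        ≤ ∫⁻ x, C * (f x : ℝ≥0∞) ^ (6 / (6 - l)) := by
          refine lintegral_mono fun x => ?_
          calc (f x : ℝ≥0∞) * ∫⁻ y in {y | g y ≤ f x}, g y * ‖x - y‖ₑ ^ (-l)
              ≤ f x * (C * (f x : ℝ≥0∞) ^ (l / (6 - l))) := by gcongr; exact H g hg hg1 _ _
            _ = C * (f x : ℝ≥0∞) ^ (6 / (6 - l)) := by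
              rw [mul_left_comm]
              congr 1
              nth_rewrite 1 [← ENNReal.rpow_one (f x : ℝ≥0∞)]
              rw [← ENNReal.rpow_add_of_nonneg _ _ (by positivity) (by positivity)]
              congr 1
              field_simp
              ring
      _ = C * ∫⁻ x, (f x : ℝ≥0∞) ^ (6 / (6 - l)) := lintegral_const_mul' _ _ hC
      _ ≤ C * 1 := by gcongr
      _ = C := mul_one _
  refine ⟨C + C, by simp [hC], fun f g hf hg hf1 hg1 => ?_⟩
  have hk : Measurable fun z : Space × Space => ‖z.1 - z.2‖ₑ ^ (-l) := by fun_prop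
  have hmeas : AEMeasurable (fun z : Space × Space =>
      (f z.1 : ℝ≥0∞) * g z.2 * ‖z.1 - z.2‖ₑ ^ (-l)) (volume.prod volume) :=
    ((hf.coe_nnreal_ennreal.comp_fst).mul (hg.coe_nnreal_ennreal.comp_snd)).mul hk.aemeasurable
  set S : Set (Space × Space) := {z | g z.2 ≤ f z.1}
  have hS : NullMeasurableSet S (volume.prod volume) :=
    nullMeasurableSet_le hg.comp_snd hf.comp_fst
  set T : Set (Space × Space) := {z | f z.1 ≤ g z.2}
  have hT : NullMeasurableSet T (volume.prod volume) :=
    nullMeasurableSet_le hf.comp_fst hg.comp_snd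
  set F : Space × Space → ℝ≥0∞ := fun z => (f z.1 : ℝ≥0∞) * g z.2 * ‖z.1 - z.2‖ₑ ^ (-l)
  have hsec : ∀ (f g : Space → ℝ≥0), AEMeasurable g → ∀ x,
      ∫⁻ y, {y | g y ≤ f x}.indicator (fun y => (f x : ℝ≥0∞) * g y * ‖x - y‖ₑ ^ (-l)) y
        = f x * ∫⁻ y in {y | g y ≤ f x}, g y * ‖x - y‖ₑ ^ (-l) := by
    intro f g hg x
    have hm : NullMeasurableSet {y | g y ≤ f x} := nullMeasurableSet_le hg aemeasurable_const
    rw [lintegral_indicator₀ hm, ← lintegral_const_mul' _ _ (by simp)]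
    simp_rw [mul_assoc]
  calc ∫⁻ x, ∫⁻ y, f x * g y * ‖x - y‖ₑ ^ (-l)
      = ∫⁻ z, F z ∂(volume.prod volume) := (lintegral_prod _ hmeas).symm
    _ ≤ ∫⁻ z, (S.indicator F z + T.indicator F z) ∂(volume.prod volume) := by
        refine lintegral_mono fun z => ?_
        rcases le_total (g z.2) (f z.1) with h | h
        · rw [indicator_of_mem (show z ∈ S from h)]; exact le_self_add
        · rw [indicator_of_mem (show z ∈ T from h)]; exact le_add_self
    _ = ∫⁻ z, S.indicator F z ∂(volume.prod volume)
          + ∫⁻ z, T.indicator F z ∂(volume.prod volume) :=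
        lintegral_add_left' (hmeas.indicator₀ hS) _
    _ ≤ C + C := by
        gcongr
        · rw [lintegral_prod _ (hmeas.indicator₀ hS)]
          refine le_trans (le_of_eq ?_) (half f g hf hg hf1 hg1)
          refine lintegral_congr fun x => ?_
          rw [← hsec f g hg x]
          rfl
        · rw [lintegral_prod_symm _ (hmeas.indicator₀ hT)]
          refine le_trans (le_of_eq ?_) (half g f hg hf hg1 hf1)
          refine lintegral_congr fun x => ?_
          rw [← hsec g f hf x]
          refine lintegral_congr fun y => ?_
          simp only [indicator, T, F, mem_ofPred_eq]
          rw [mul_comm (f y : ℝ≥0∞), ← enorm_neg, neg_sub]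

/-- The **Hardy-Littlewood-Sobolev inequality** on `ℝ³` in the conformally invariant case. -/
theorem exists_hls {l : ℝ} (hl0 : 0 < l) (hl : l < 3) :
    ∃ C : ℝ≥0, ∀ f g : Space → ℝ≥0, AEMeasurable f → AEMeasurable g →
      ∫⁻ y, (f y : ℝ≥0∞) ^ (6 / (6 - l)) ≠ ∞ → ∫⁻ y, (g y : ℝ≥0∞) ^ (6 / (6 - l)) ≠ ∞ →
      ∫⁻ x, ∫⁻ y, f x * g y * ‖x - y‖ₑ ^ (-l)
        ≤ C * (∫⁻ y, (f y : ℝ≥0∞) ^ (6 / (6 - l))) ^ ((6 - l) / 6)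
            * (∫⁻ y, (g y : ℝ≥0∞) ^ (6 / (6 - l))) ^ ((6 - l) / 6) := by
  have h6 : 0 < 6 - l := by linarith
  obtain ⟨C, hC, H⟩ := exists_hls_normalized hl0 hl
  lift C to ℝ≥0 using hC
  refine ⟨C, fun f g hf hg hf1 hg1 => ?_⟩
  -- Homogeneity: f is its norm a times a normalised function. If a = 0 then f vanishes almost
  -- everywhere and f' = 0 serves.
  have key : ∀ f : Space → ℝ≥0, AEMeasurable f → ∫⁻ y, (f y : ℝ≥0∞) ^ (6 / (6 - l)) ≠ ∞ →
      ∃ (a : ℝ≥0) (f' : Space → ℝ≥0), AEMeasurable f' ∧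
        (∫⁻ y, (f y : ℝ≥0∞) ^ (6 / (6 - l))) ^ ((6 - l) / 6) = a ∧
        ∫⁻ y, (f' y : ℝ≥0∞) ^ (6 / (6 - l)) ≤ 1 ∧ ∀ᵐ x, f x = a * f' x := by
    intro f hf hf1
    lift (∫⁻ y, (f y : ℝ≥0∞) ^ (6 / (6 - l))) to ℝ≥0 using hf1 with b hb
    rcases eq_or_ne b 0 with rfl | hb0
    · refine ⟨0, 0, aemeasurable_const, ?_, ?_, ?_⟩
      · simp [ENNReal.zero_rpow_of_pos (show 0 < (6 - l) / 6 by positivity)]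
      · simp [ENNReal.zero_rpow_of_pos (show 0 < 6 / (6 - l) by positivity)]
      · have := (lintegral_eq_zero_iff' (hf.coe_nnreal_ennreal.pow_const _)).1 hb.symm
        filter_upwards [this] with x hx
        have h := (ENNReal.rpow_eq_zero_iff_of_pos (by positivity)).1 hx
        simpa using h
    · have ha : b ^ ((6 - l) / 6) ≠ 0 := (NNReal.rpow_pos (pos_iff_ne_zero.2 hb0)).ne'
      refine ⟨b ^ ((6 - l) / 6), fun x => (b ^ ((6 - l) / 6))⁻¹ * f x, hf.const_mul _, ?_, ?_, ?_⟩
      · rw [ENNReal.coe_rpow_of_nonneg _ (by positivity)]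
      · have : ∀ y, ((((b ^ ((6 - l) / 6))⁻¹ * f y : ℝ≥0)) : ℝ≥0∞) ^ (6 / (6 - l))
            = (b : ℝ≥0∞)⁻¹ * (f y : ℝ≥0∞) ^ (6 / (6 - l)) := by
          intro y
          rw [ENNReal.coe_mul, ENNReal.mul_rpow_of_nonneg _ _ (by positivity)]
          congr 1
          rw [ENNReal.coe_inv ha, ENNReal.coe_rpow_of_nonneg _ (by positivity), ENNReal.inv_rpow,
            ← ENNReal.rpow_mul]
          rw [show (6 - l) / 6 * (6 / (6 - l)) = 1 by field_simp, ENNReal.rpow_one]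
        simp_rw [this]
        rw [lintegral_const_mul' _ _ (by simpa using hb0), ← hb,
          ENNReal.inv_mul_cancel (by simpa) (by simp)]
      · refine Filter.Eventually.of_forall fun x => ?_
        rw [mul_inv_cancel_left₀ ha]
  obtain ⟨a, f', hf', ha, hf'1, hff⟩ := key f hf hf1
  obtain ⟨b, g', hg', hb, hg'1, hgg⟩ := key g hg hg1
  rw [ha, hb]
  calc ∫⁻ x, ∫⁻ y, f x * g y * ‖x - y‖ₑ ^ (-l)
      = ∫⁻ x, ∫⁻ y, (a * b : ℝ≥0∞) * (f' x * g' y * ‖x - y‖ₑ ^ (-l)) := by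
        refine lintegral_congr_ae ?_
        filter_upwards [hff] with x hx
        refine lintegral_congr_ae ?_
        filter_upwards [hgg] with y hy
        rw [hx, hy]
        push_cast
        ring
    _ = (a * b : ℝ≥0∞) * ∫⁻ x, ∫⁻ y, f' x * g' y * ‖x - y‖ₑ ^ (-l) := by
        have : (a * b : ℝ≥0∞) ≠ ∞ := ENNReal.mul_ne_top (by simp) (by simp)
        simp_rw [lintegral_const_mul' _ _ this]
    _ ≤ (a * b : ℝ≥0∞) * C := by gcongr; exact H f' g' hf' hg' hf'1 hg'1
    _ = C * a * b := by ring

/-- The exponents keep the shape 6/(6-1) in order to match `exists_hls` at l = 1. -/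
theorem eLpNorm_six_fifths_eq (f : Space → ℂ) :
    eLpNorm f (6 / 5) volume = (∫⁻ y, (‖f y‖₊ : ℝ≥0∞) ^ (6 / (6 - 1) : ℝ)) ^ ((6 - 1) / 6 : ℝ) := by
  have h : (6 / 5 : ℝ≥0∞) = ENNReal.ofReal (6 / 5) := by
    rw [ENNReal.ofReal_div_of_pos (by norm_num)]; norm_num
  rw [eLpNorm_eq_lintegral_rpow_enorm_toReal (by simp) (by rw [h]; simp), h,
    ENNReal.toReal_ofReal (by norm_num)]
  norm_num
  rfl

/-- All larger constants are included because the final one must also dominate the constant for the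
kernel |x - y|⁻², which controls the exchange operator. -/
theorem exists_isHLSConstant : ∃ C : ℝ≥0, ∀ C' : ℝ, C ≤ C' → IsHLSConstant C' := by
  obtain ⟨C, hC⟩ := exists_hls (l := 1) (by norm_num) (by norm_num)
  refine ⟨C, fun C' hC' f g hf hg => ?_⟩
  have fin : ∀ f : Space → ℂ, MemLp f (6 / 5) volume →
      ∫⁻ y, (‖f y‖₊ : ℝ≥0∞) ^ (6 / (6 - 1) : ℝ) ≠ ∞ := by
    intro f hf h
    have := hf.2
    rw [eLpNorm_six_fifths_eq, h] at this
    norm_num at this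
  have := hC (fun x => ‖f x‖₊) (fun x => ‖g x‖₊) hf.1.aemeasurable.nnnorm hg.1.aemeasurable.nnnorm
    (fin f hf) (fin g hg)
  rw [← eLpNorm_six_fifths_eq, ← eLpNorm_six_fifths_eq] at this
  calc ∫⁻ x, ∫⁻ y, ‖f x‖ₑ * ‖g y‖ₑ / ‖x - y‖ₑ
      ≤ C * eLpNorm f (6 / 5) volume * eLpNorm g (6 / 5) volume := by
        refine le_trans (le_of_eq ?_) this
        simp_rw [ENNReal.rpow_neg_one, div_eq_mul_inv]
        rfl
    _ ≤ _ := by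
        gcongr
        rw [← ENNReal.ofReal_coe_nnreal]
        exact ENNReal.ofReal_le_ofReal hC'

/-! ### Bounded multiplication operators and Fourier multipliers on `L²` -/

/-- Multiplication by an `L^∞` function, as a bounded operator on `L²`. -/
def mulOp (m : Lp ℂ ∞ (volume : Measure Space)) : L2 →L[ℂ] L2 :=
  (ContinuousLinearMap.mul ℂ ℂ).holderL volume ∞ 2 2 m

theorem coeFn_mulOp_toLp {m : Space → ℂ} (hm : MemLp m ∞ volume) (f : L2) :
    ⇑(mulOp (hm.toLp m) f) =ᵐ[volume] fun x => m x * f x := by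
  filter_upwards [ContinuousLinearMap.coeFn_holder (B := ContinuousLinearMap.mul ℂ ℂ) (r := 2)
    (hm.toLp m) f, hm.coeFn_toLp] with x hx hx'
  rw [← hx']
  exact hx

theorem inner_mulOp {m : Space → ℂ} (hm : MemLp m ∞ volume) (hr : ∀ᵐ x, (starRingEnd ℂ) (m x) = m x)
    (f g : L2) : inner ℂ (mulOp (hm.toLp m) f) g = inner ℂ f (mulOp (hm.toLp m) g) := by
  rw [L2.inner_def, L2.inner_def]
  refine integral_congr_ae ?_
  filter_upwards [coeFn_mulOp_toLp hm f, coeFn_mulOp_toLp hm g, hr] with x h1 h2 h3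
  rw [h1, h2]
  simp only [RCLike.inner_apply, map_mul, h3]
  ring

/-- Identities in `L2` can thus be verified among tempered distributions, where all Fourier
multipliers of temperate growth act. -/
theorem toTemperedDistribution_injective {f g : L2} (h : (f : 𝓢'(Space, ℂ)) = g) : f = g := by
  have := LinearMap.ker_eq_bot.1
    (MeasureTheory.Lp.ker_toTemperedDistributionCLM_eq_bot (F := ℂ) (μ := (volume : Measure Space)) (p := 2))
  exact this h

/-- The Fourier multiplier with an `L^∞` symbol, as a bounded operator on `L²`. -/
def fourierMulOp {g : Space → ℂ} (hb : MemLp g ∞ volume) : L2 →L[ℂ] L2 :=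
  (FourierTransform.fourierInvCLM ℂ L2) ∘L mulOp (hb.toLp g) ∘L (FourierTransform.fourierCLM ℂ L2)

theorem fourierMulOp_apply {g : Space → ℂ} (hb : MemLp g ∞ volume) (f : L2) :
    fourierMulOp hb f = 𝓕⁻ (mulOp (hb.toLp g) (𝓕 f)) := rfl

theorem coe_fourierMulOp {g : Space → ℂ} (hb : MemLp g ∞ volume) (hg : g.HasTemperateGrowth)
    (f : L2) : (fourierMulOp hb f : 𝓢'(Space, ℂ)) = fourierMultiplierCLM ℂ g f := by
  rw [fourierMulOp_apply, TemperedDistribution.fourierMultiplierCLM_apply,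
    ← Lp.fourierInv_toTemperedDistribution_eq, Lp.fourier_toTemperedDistribution_eq,
    ← Lp.toTemperedDistribution_smul_eq (p := ∞) (q := 2) (r := 2) hg hb]
  rfl

theorem fourierMulOp_toLp {g : Space → ℂ} (hb : MemLp g ∞ volume) (hg : g.HasTemperateGrowth)
    (f : 𝓢(Space, ℂ)) :
    fourierMulOp hb (f.toLp 2) = (SchwartzMap.fourierMultiplierCLM ℂ g f).toLp 2 := by
  apply toTemperedDistribution_injective
  rw [coe_fourierMulOp hb hg, Lp.toTemperedDistribution_toLp_eq, Lp.toTemperedDistribution_toLp_eq,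
    fourierMultiplierCLM_toTemperedDistributionCLM_eq hg]

theorem inner_fourierMulOp {g : Space → ℂ} (hb : MemLp g ∞ volume)
    (hr : ∀ x, (starRingEnd ℂ) (g x) = g x) (f h : L2) :
    inner ℂ (fourierMulOp hb f) h = inner ℂ f (fourierMulOp hb h) := by
  rw [fourierMulOp_apply, fourierMulOp_apply, ← Lp.inner_fourier_eq, ← Lp.inner_fourier_eq f,
    FourierTransform.fourier_fourierInv_eq, FourierTransform.fourier_fourierInv_eq]
  exact inner_mulOp hb (Eventually.of_forall hr) _ _

/-! ### Approximation of Sobolev functions by Schwartz functions -/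

/-- The symbol of the Bessel potential of order `s`. -/
def besselSymbol (s : ℝ) (x : Space) : ℂ := ((1 + ‖x‖ ^ 2) ^ (s / 2) : ℝ)

theorem hasTemperateGrowth_besselSymbol (s : ℝ) : (besselSymbol s).HasTemperateGrowth := by
  unfold besselSymbol
  fun_prop

theorem besselSymbol_mul (s t : ℝ) : besselSymbol s * besselSymbol t = besselSymbol (s + t) := by
  ext x
  simp only [besselSymbol, Pi.mul_apply]
  norm_cast
  rw [← Real.rpow_add (by positivity)]
  congr 1
  ring

theorem besselSymbol_zero : besselSymbol 0 = 1 := by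
  ext x
  simp [besselSymbol]

theorem norm_besselSymbol (s : ℝ) (x : Space) : ‖besselSymbol s x‖ = (1 + ‖x‖ ^ 2) ^ (s / 2) := by
  rw [besselSymbol, Complex.norm_real, Real.norm_of_nonneg (by positivity)]

theorem _root_.Function.HasTemperateGrowth.memLp_top {g : Space → ℂ} (hg : g.HasTemperateGrowth) (C : ℝ)
    (h : ∀ x, ‖g x‖ ≤ C) : MemLp g ∞ volume :=
  MeasureTheory.memLp_top_of_bound (hg.1.continuous.aestronglyMeasurable) C (Eventually.of_forall h)

/-- Lift w to its Bessel potential v ∈ L², approximate v by Schwartz functions ψₙ, and lower these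
back to φₙ. Applying a(D) to φₙ is applying the bounded multiplier a(1 + |ξ|²)^(-s/2) to ψₙ, so
convergence is continuity on L². One sequence serves all multipliers of order at most s, hence w,
its gradient and its Laplacian simultaneously. -/
theorem exists_schwartz_tendsto {s : ℝ} {w : L2} (hw : MemSobolev s 2 (w : 𝓢'(Space, ℂ))) :
    ∃ φ : ℕ → 𝓢(Space, ℂ), ∀ (a : Space → ℂ) (b : L2), a.HasTemperateGrowth →
      MemLp (a * besselSymbol (-s)) ∞ volume →
      fourierMultiplierCLM ℂ a (w : 𝓢'(Space, ℂ)) = b →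
      Tendsto (fun n => ((SchwartzMap.fourierMultiplierCLM ℂ a (φ n)).toLp 2 : L2)) atTop (𝓝 b) := by
  obtain ⟨v, hv⟩ := hw
  have hv : fourierMultiplierCLM ℂ (besselSymbol s) (w : 𝓢'(Space, ℂ)) = v := hv
  have hd : DenseRange (SchwartzMap.toLpCLM ℝ ℂ 2 (volume : Measure Space)) :=
    SchwartzMap.denseRange_toLpCLM ENNReal.ofNat_ne_top
  obtain ⟨y, hy, hyv⟩ := mem_closure_iff_seq_limit.1 (hd v)
  choose ψ hψ using hy
  refine ⟨fun n => SchwartzMap.fourierMultiplierCLM ℂ (besselSymbol (-s)) (ψ n),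
    fun a b ha hb hab => ?_⟩
  have hs := hasTemperateGrowth_besselSymbol
  have h1 : ∀ n, ((SchwartzMap.fourierMultiplierCLM ℂ a
      (SchwartzMap.fourierMultiplierCLM ℂ (besselSymbol (-s)) (ψ n))).toLp 2 : L2)
      = fourierMulOp hb (y n) := by
    intro n
    rw [SchwartzMap.fourierMultiplierCLM_fourierMultiplierCLM_apply ha (hs _), ← hψ]
    exact (fourierMulOp_toLp hb (ha.mul (hs _)) (ψ n)).symm
  have h2 : b = fourierMulOp hb v := by
    apply toTemperedDistribution_injective
    rw [coe_fourierMulOp hb (ha.mul (hs _)), ← hv,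
      fourierMultiplierCLM_fourierMultiplierCLM_apply (hs _) (ha.mul (hs _)), ← hab]
    congr 2
    rw [mul_left_comm, besselSymbol_mul, add_neg_cancel, besselSymbol_zero, mul_one]
  simp_rw [h1, h2]
  exact ((fourierMulOp hb).continuous.tendsto v).comp hyv

section Symbols

variable {E : Type*} [NormedAddCommGroup E] [InnerProductSpace ℝ E]

theorem hasTemperateGrowth_inner_left (m : E) :
    (fun x : E => inner ℝ x m).HasTemperateGrowth := by
  fun_prop

theorem hasTemperateGrowth_norm_sq : (fun x : E => ‖x‖ ^ 2).HasTemperateGrowth := by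
  fun_prop

theorem Function.HasTemperateGrowth.complex_ofReal {f : E → ℝ} (hf : f.HasTemperateGrowth) :
    (fun x : E => (f x : ℂ)).HasTemperateGrowth := by
  fun_prop

end Symbols

theorem memLp_top_mul_besselSymbol {f : Space → ℝ} (hf : f.HasTemperateGrowth) {s : ℝ}
    (h : ∀ x, ‖f x‖ ≤ (1 + ‖x‖ ^ 2) ^ (s / 2)) :
    MemLp ((fun x => (f x : ℂ)) * besselSymbol (-s)) ∞ volume := by
  refine (Function.HasTemperateGrowth.complex_ofReal hf |>.mul
    (hasTemperateGrowth_besselSymbol _)).memLp_top 1 fun x => ?_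
  rw [Pi.mul_apply, norm_mul, norm_besselSymbol, Complex.norm_real]
  calc _ ≤ (1 + ‖x‖ ^ 2) ^ (s / 2) * (1 + ‖x‖ ^ 2) ^ (-s / 2) := by gcongr; exact h x
    _ = 1 := by rw [← Real.rpow_add (by positivity)]; ring_nf; simp

/-- Derivatives and the Laplacian are a nonzero constant times a multiplier with real symbol; this
is the preceding lemma in that shape. -/
theorem exists_schwartz_tendsto_real {s : ℝ} {w : L2} (hw : MemSobolev s 2 (w : 𝓢'(Space, ℂ))) :
    ∃ φ : ℕ → 𝓢(Space, ℂ), ∀ (a : Space → ℝ) (c : ℂ) (b : L2), a.HasTemperateGrowth → c ≠ 0 →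
      (∀ x, ‖a x‖ ≤ (1 + ‖x‖ ^ 2) ^ (s / 2)) →
      c • fourierMultiplierCLM ℂ (fun x => (a x : ℂ)) (w : 𝓢'(Space, ℂ)) = b →
      Tendsto (fun n => ((c • SchwartzMap.fourierMultiplierCLM ℂ a (φ n)).toLp 2 : L2))
        atTop (𝓝 b) := by
  obtain ⟨φ, hφ⟩ := exists_schwartz_tendsto hw
  refine ⟨φ, fun a c b ha hc hb hab => ?_⟩
  have h1 := hφ (fun x => (a x : ℂ)) (c⁻¹ • b)
    (Function.HasTemperateGrowth.complex_ofReal ha) (memLp_top_mul_besselSymbol ha hb) (by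
      have : ((c⁻¹ • b : L2) : 𝓢'(Space, ℂ)) = c⁻¹ • (b : 𝓢'(Space, ℂ)) :=
        map_smul (Lp.toTemperedDistributionCLM ℂ volume 2) _ _
      rw [this, ← hab, inv_smul_smul₀ hc])
  have h2 := h1.const_smul c
  rw [smul_inv_smul₀ hc] at h2
  refine h2.congr fun n => ?_
  have : ((c • SchwartzMap.fourierMultiplierCLM ℂ a (φ n)).toLp 2 : L2)
      = c • (SchwartzMap.fourierMultiplierCLM ℂ a (φ n)).toLp 2 volume :=
    map_smul (SchwartzMap.toLpCLM ℂ ℂ 2 (volume : Measure Space)) _ _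
  rw [this]
  congr 2
  exact SchwartzMap.fourierMultiplierCLM_ofReal ℂ ha _

/-- Density of Schwartz functions in Sobolev spaces, in terms of derivatives. -/
theorem exists_schwartz_tendsto_grad {w : L2} {G : Fin 3 → L2} {s : ℝ} (hs : 1 ≤ s)
    (hw : MemSobolev s 2 (w : 𝓢'(Space, ℂ))) (hG : HasGrad w G) :
    ∃ φ : ℕ → 𝓢(Space, ℂ), Tendsto (fun n => ((φ n).toLp 2 : L2)) atTop (𝓝 w) ∧
      (∀ i, Tendsto (fun n => ((∂_{EuclideanSpace.single i (1 : ℝ)} (φ n)).toLp 2 : L2)) atTop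
        (𝓝 (G i))) ∧
      (2 ≤ s → ∀ h, HasLaplacian w h →
        Tendsto (fun n => ((Δ (φ n)).toLp 2 : L2)) atTop (𝓝 h)) := by
  obtain ⟨φ, hφ⟩ := exists_schwartz_tendsto_real hw
  refine ⟨φ, ?_, fun i => ?_, fun h2 h hh => ?_⟩
  · have := hφ (fun _ => 1) 1 w (Function.HasTemperateGrowth.const _) one_ne_zero
      (fun x => by
        rw [norm_one]
        exact Real.one_le_rpow (by simp) (by linarith)) (by simp)
    simpa using this
  · have hc : (2 * Real.pi * Complex.I : ℂ) ≠ 0 := by simp [Real.pi_ne_zero]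
    have := hφ (fun x => inner ℝ x (EuclideanSpace.single i (1 : ℝ)))
      (2 * Real.pi * Complex.I : ℂ) (G i) (hasTemperateGrowth_inner_left _) hc (fun x => ?_) (by
        rw [← TemperedDistribution.lineDeriv_eq_fourierMultiplierCLM]
        exact hG i)
    · refine this.congr fun n => ?_
      rw [SchwartzMap.lineDeriv_eq_fourierMultiplierCLM]
    · calc ‖inner ℝ x (EuclideanSpace.single i (1 : ℝ))‖
            ≤ ‖x‖ * ‖EuclideanSpace.single i (1 : ℝ)‖ := norm_inner_le_norm _ _
          _ = ‖x‖ := by simp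
          _ ≤ √(1 + ‖x‖ ^ 2) := Real.le_sqrt_of_sq_le (by linarith)
          _ = (1 + ‖x‖ ^ 2) ^ (1 / 2 : ℝ) := Real.sqrt_eq_rpow _
          _ ≤ _ := Real.rpow_le_rpow_of_exponent_le (by simp) (by linarith)
  · have hc : ((-(2 * Real.pi) ^ 2 : ℝ) : ℂ) ≠ 0 := by
      rw [Complex.ofReal_ne_zero]; simp [Real.pi_ne_zero]
    have := hφ (fun x => ‖x‖ ^ 2) ((-(2 * Real.pi) ^ 2 : ℝ) : ℂ) h hasTemperateGrowth_norm_sq hc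
      (fun x => ?_) (by
        rw [Complex.coe_smul, ← TemperedDistribution.laplacian_eq_fourierMultiplierCLM]
        exact hh)
    · refine this.congr fun n => ?_
      rw [SchwartzMap.laplacian_eq_fourierMultiplierCLM, Complex.coe_smul]
    · calc ‖‖x‖ ^ 2‖ = ‖x‖ ^ 2 := by simp
        _ ≤ (1 + ‖x‖ ^ 2) ^ (1 : ℝ) := by simp
        _ ≤ _ := Real.rpow_le_rpow_of_exponent_le (by simp) (by linarith)

/-! ### The resolvent of the Laplacian -/

/-- `(2π)²`. -/
def fourPiSq : ℝ := (2 * Real.pi) ^ 2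

theorem fourPiSq_pos : 0 < fourPiSq := by unfold fourPiSq; positivity

theorem memLp_besselSymbol_neg_two : MemLp (besselSymbol (-2)) ∞ volume := by
  refine (hasTemperateGrowth_besselSymbol _).memLp_top 1 fun x => ?_
  rw [norm_besselSymbol]
  exact Real.rpow_le_one_of_one_le_of_nonpos (by simp) (by norm_num)

/-- The operator `(1 - (2π)⁻² Δ)⁻¹` on `L²`. -/
def resolventOp : L2 →L[ℂ] L2 := fourierMulOp memLp_besselSymbol_neg_two

theorem coe_resolventOp (v : L2) :
    (resolventOp v : 𝓢'(Space, ℂ)) = besselPotential Space ℂ (-2) v :=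
  coe_fourierMulOp _ (hasTemperateGrowth_besselSymbol _) v

theorem inner_resolventOp (f g : L2) :
    inner ℂ (resolventOp f) g = inner ℂ f (resolventOp g) :=
  inner_fourierMulOp _ (fun x => by simp only [besselSymbol, Complex.conj_ofReal]) f g

/-- With the 2π in the exponent of the Fourier transform, the symbol 1 + |ξ|² belongs to 1 -
(2π)⁻²Δ. This operator is invertible on tempered distributions, and `resolventOp` is its inverse on
L². So having an L² Laplacian means exactly being in the range of `resolventOp`. -/
theorem hasLaplacian_iff {w h : L2} :
    HasLaplacian w h ↔ w = resolventOp (w - (fourPiSq : ℂ)⁻¹ • h) := by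
  have hc := fourPiSq_pos.ne'
  have hb : besselPotential Space ℂ 2 (w : 𝓢'(Space, ℂ))
      = w - (fourPiSq⁻¹ : ℝ) • Δ (w : 𝓢'(Space, ℂ)) := by
    have h1 : fourierMultiplierCLM ℂ ((fun _ => 1) + fun x : Space => ((‖x‖ ^ 2 : ℝ) : ℂ)) = fourierMultiplierCLM ℂ (fun _ => 1)
        + fourierMultiplierCLM ℂ (fun x : Space => ((‖x‖ ^ 2 : ℝ) : ℂ)) := by
      ext f u
      simp only [fourierMultiplierCLM_apply]
      rw [smulLeftCLM_add (Function.HasTemperateGrowth.const _)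
        (Function.HasTemperateGrowth.complex_ofReal hasTemperateGrowth_norm_sq)]
      simp
    rw [laplacian_eq_fourierMultiplierCLM, smul_smul]
    have : (fourPiSq⁻¹ * -(2 * Real.pi) ^ 2) = -1 := by
      rw [mul_neg, ← fourPiSq, inv_mul_cancel₀ hc]
    rw [this, neg_one_smul, sub_neg_eq_add]
    trans (fourierMultiplierCLM ℂ ((fun _ => 1) + fun x : Space => ((‖x‖ ^ 2 : ℝ) : ℂ))) (w : 𝓢'(Space, ℂ))
    · rw [besselPotential]
      congr 2
      ext x
      simp
    · rw [h1]; simp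
  have hcoe : ((w - (fourPiSq : ℂ)⁻¹ • h : L2) : 𝓢'(Space, ℂ))
      = w - (fourPiSq⁻¹ : ℝ) • (h : 𝓢'(Space, ℂ)) := by
    rw [← Lp.toTemperedDistributionCLM_apply, ← Lp.toTemperedDistributionCLM_apply,
      ← Lp.toTemperedDistributionCLM_apply, map_sub, map_smul, ← Complex.ofReal_inv,
      Complex.coe_smul]
  constructor
  · intro hh
    apply toTemperedDistribution_injective
    rw [coe_resolventOp, eq_comm, besselPotential_neg_apply_eq_iff, hb, hcoe, hh]
  · intro hw
    have : besselPotential Space ℂ (-2) ((w - (fourPiSq : ℂ)⁻¹ • h : L2) : 𝓢'(Space, ℂ)) = w := by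
      rw [← coe_resolventOp, ← hw]
    rw [besselPotential_neg_apply_eq_iff, hb, hcoe, sub_right_inj] at this
    have := congrArg (fourPiSq • ·) this
    simp only [smul_inv_smul₀ hc] at this
    exact this

theorem memSobolev_two_resolventOp (v : L2) :
    MemSobolev 2 2 (resolventOp v : 𝓢'(Space, ℂ)) :=
  ⟨v, by rw [coe_resolventOp, besselPotential_besselPotential_apply]; simp⟩

/-- Elliptic regularity: a bound state, assumed only in H¹, is in H². -/
theorem HasLaplacian.memSobolev {w h : L2} (hw : HasLaplacian w h) :
    MemSobolev 2 2 (w : 𝓢'(Space, ℂ)) := by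
  rw [hasLaplacian_iff.1 hw]
  exact memSobolev_two_resolventOp _

theorem exists_hasGrad {w : L2} (hw : MemSobolev 1 2 (w : 𝓢'(Space, ℂ))) : ∃ G, HasGrad w G := by
  have : ∀ i : Fin 3, ∃ g : L2,
      ∂_{EuclideanSpace.single i (1 : ℝ)} (w : 𝓢'(Space, ℂ)) = (g : 𝓢'(Space, ℂ)) := by
    intro i
    have h := hw.lineDerivOp (m := EuclideanSpace.single i (1 : ℝ))
    rw [sub_self] at h
    exact memSobolev_zero_iff.1 h
  choose G hG using this
  exact ⟨G, hG⟩

/-! ### The Gagliardo-Nirenberg-Sobolev inequality -/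

/-- The Sobolev inequality for compactly supported C¹ functions applies to χ(x/(n+1))φ.
Differentiating the cutoff costs a term of size ‖φ‖₂/(n+1), which disappears in the limit, and Fatou
handles the left side. -/
theorem exists_eLpNorm_six_le_fderiv : ∃ C : ℝ≥0, ∀ φ : 𝓢(Space, ℂ),
    eLpNorm φ 6 volume ≤ C * eLpNorm (fderiv ℝ φ) 2 volume := by
  set C := SNormLESNormFDerivOfEqConst ℂ (volume : Measure Space) (2 : ℝ≥0)
  refine ⟨C, fun φ => ?_⟩
  let χ : ContDiffBump (0 : Space) := ⟨1, 2, one_pos, one_lt_two⟩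
  have hχ : ContDiff ℝ 1 χ := χ.contDiff
  obtain ⟨M, hM⟩ : ∃ M, ∀ x, ‖fderiv ℝ χ x‖ ≤ M :=
    (χ.hasCompactSupport.fderiv ℝ).exists_bound_of_continuous (hχ.continuous_fderiv one_ne_zero)
  let f : ℕ → Space → ℂ := fun n x => χ ((n + 1 : ℝ)⁻¹ • x) • φ x
  have hφ : ContDiff ℝ 1 φ := φ.smooth 1
  have hfd : ∀ n, ContDiff ℝ 1 (f n) := fun n =>
    (hχ.comp (contDiff_const_smul _)).smul hφ
  have hfs : ∀ n, HasCompactSupport (f n) := fun n => by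
    have : HasCompactSupport fun x => χ ((n + 1 : ℝ)⁻¹ • x) :=
      χ.hasCompactSupport.comp_homeomorph (Homeomorph.smulOfNeZero (n + 1 : ℝ)⁻¹ (by positivity))
    exact this.smul_right
  have hfb : ∀ n x, ‖fderiv ℝ (f n) x‖ ≤ ‖fderiv ℝ φ x‖ + (n + 1 : ℝ)⁻¹ * M * ‖φ x‖ := by
    intro n x
    have h1 : HasFDerivAt (fun x : Space => χ ((n + 1 : ℝ)⁻¹ • x))
        ((fderiv ℝ χ ((n + 1 : ℝ)⁻¹ • x)).comp ((n + 1 : ℝ)⁻¹ • ContinuousLinearMap.id ℝ Space)) x :=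
      ((hχ.differentiable one_ne_zero _).hasFDerivAt).comp x
        (((n + 1 : ℝ)⁻¹ • ContinuousLinearMap.id ℝ Space).hasFDerivAt)
    have h2 := h1.smul ((hφ.differentiable one_ne_zero x).hasFDerivAt)
    rw [show fderiv ℝ (f n) x = _ from h2.fderiv]
    refine (norm_add_le _ _).trans (add_le_add ?_ ?_)
    · rw [norm_smul, Real.norm_of_nonneg χ.nonneg]
      exact mul_le_of_le_one_left (norm_nonneg _) χ.le_one
    · rw [ContinuousLinearMap.norm_smulRight_apply]
      gcongr
      rw [ContinuousLinearMap.comp_smul, ContinuousLinearMap.comp_id, norm_smul,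
        Real.norm_of_nonneg (by positivity)]
      gcongr
      exact hM _
  have hstep : ∀ n, eLpNorm (f n) 6 volume ≤ C * (eLpNorm (fderiv ℝ φ) 2 volume
      + ENNReal.ofReal ((n + 1 : ℝ)⁻¹ * M) * eLpNorm φ 2 volume) := by
    intro n
    have h := eLpNorm_le_eLpNorm_fderiv_of_eq volume (hfd n) (hfs n) (p := 2) (p' := 6)
      (by norm_num) (by simp) (by simp; norm_num)
    refine le_trans h ?_
    gcongr
    have hM0 : 0 ≤ M := (norm_nonneg _).trans (hM 0)
    calc eLpNorm (fderiv ℝ (f n)) 2 volume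
        ≤ eLpNorm (fun x => ‖fderiv ℝ φ x‖ + (n + 1 : ℝ)⁻¹ * M * ‖φ x‖) 2 volume :=
          eLpNorm_mono_real (hfb n)
      _ ≤ eLpNorm (fun x => ‖fderiv ℝ φ x‖) 2 volume
          + eLpNorm (fun x => (n + 1 : ℝ)⁻¹ * M * ‖φ x‖) 2 volume := by
          refine eLpNorm_add_le ?_ ?_ (by norm_num)
          · exact ((hφ.continuous_fderiv one_ne_zero).norm).aestronglyMeasurable
          · exact (continuous_const.mul φ.continuous.norm).aestronglyMeasurable
      _ = _ := by
          have := eLpNorm_const_smul ((n + 1 : ℝ)⁻¹ * M) (fun x => ‖φ x‖) 2 (volume : Measure Space)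
          rw [eLpNorm_norm, Real.enorm_of_nonneg (by positivity)] at this
          rw [eLpNorm_norm, ← this]
          rfl
  have hlim : ∀ᵐ x, Tendsto (fun n => f n x) atTop (𝓝 (φ x)) := by
    refine Eventually.of_forall fun x => ?_
    have h0 : Tendsto (fun n : ℕ => (n + 1 : ℝ)⁻¹ • x) atTop (𝓝 ((0 : ℝ) • x)) := by
      refine Tendsto.smul_const ?_ x
      simpa using tendsto_one_div_add_atTop_nhds_zero_nat (𝕜 := ℝ)
    rw [zero_smul] at h0
    have h1 := ((hχ.continuous.tendsto 0).comp h0).smul_const (φ x)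
    rw [χ.one_of_mem_closedBall (by simp [χ]), one_smul] at h1
    exact h1
  refine (Lp.eLpNorm_lim_le_liminf_eLpNorm
    (fun n => (hfd n).continuous.aestronglyMeasurable) φ hlim).trans ?_
  have hφ2 : eLpNorm φ 2 volume ≠ ∞ := (φ.memLp 2 volume).2.ne
  have hlim2 : Tendsto (fun n : ℕ => (C : ℝ≥0∞) * (eLpNorm (fderiv ℝ φ) 2 volume
      + ENNReal.ofReal ((n + 1 : ℝ)⁻¹ * M) * eLpNorm φ 2 volume)) atTop
      (𝓝 (C * (eLpNorm (fderiv ℝ φ) 2 volume + ENNReal.ofReal (0 * M) * eLpNorm φ 2 volume))) := by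
    refine ENNReal.Tendsto.const_mul (tendsto_const_nhds.add ?_) (Or.inr (by simp))
    refine ENNReal.Tendsto.mul_const (ENNReal.tendsto_ofReal (Tendsto.mul_const M ?_)) (Or.inr hφ2)
    simpa using tendsto_one_div_add_atTop_nhds_zero_nat (𝕜 := ℝ)
  refine (liminf_le_liminf (Eventually.of_forall hstep)).trans ?_
  rw [hlim2.liminf_eq]
  simp

theorem norm_clm_le_sum (T : Space →L[ℝ] ℂ) :
    ‖T‖ ≤ ∑ i, ‖T (EuclideanSpace.single i 1)‖ := by
  refine T.opNorm_le_bound (by positivity) fun x => ?_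
  have hx : x = ∑ i, x i • EuclideanSpace.single i (1 : ℝ) := by
    have := (EuclideanSpace.basisFun (Fin 3) ℝ).sum_repr x
    simpa using this.symm
  conv_lhs => rw [hx]
  rw [map_sum, Finset.sum_mul]
  refine (norm_sum_le _ _).trans (Finset.sum_le_sum fun i _ => ?_)
  rw [map_smul, norm_smul, mul_comm]
  gcongr
  exact PiLp.norm_apply_le x i

theorem exists_eLpNorm_six_le : ∃ C : ℝ≥0, ∀ φ : 𝓢(Space, ℂ),
    eLpNorm φ 6 volume ≤
      C * ∑ i : Fin 3, ‖((∂_{EuclideanSpace.single i (1 : ℝ)} φ).toLp 2 : L2)‖ₑ := by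
  obtain ⟨C, hC⟩ := exists_eLpNorm_six_le_fderiv
  refine ⟨C, fun φ => (hC φ).trans ?_⟩
  gcongr
  have : ∀ i : Fin 3, ‖((∂_{EuclideanSpace.single i (1 : ℝ)} φ).toLp 2 : L2)‖ₑ
      = eLpNorm (fun x => ‖fderiv ℝ φ x (EuclideanSpace.single i 1)‖) 2 volume := by
    intro i
    rw [Lp.enorm_def, eLpNorm_norm]
    exact eLpNorm_congr_ae ((∂_{EuclideanSpace.single i (1 : ℝ)} φ).coeFn_toLp 2 volume)
  simp_rw [this]
  have hd : Continuous (fderiv ℝ φ) := (φ.smooth 1).continuous_fderiv one_ne_zero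
  calc eLpNorm (fderiv ℝ φ) 2 volume
      ≤ eLpNorm (∑ i : Fin 3, fun x => ‖fderiv ℝ φ x (EuclideanSpace.single i 1)‖) 2 volume := by
        refine eLpNorm_mono_real fun x => ?_
        rw [Finset.sum_apply]
        exact norm_clm_le_sum _
    _ ≤ _ := eLpNorm_sum_le (fun i _ => (by fun_prop : Continuous fun x => ‖fderiv ℝ φ x
          (EuclideanSpace.single i 1)‖).aestronglyMeasurable) (by norm_num)

theorem integrable_norm_sq (f : L2) : Integrable fun x => ‖f x‖ ^ 2 :=
  (Lp.memLp f).integrable_norm_pow (by norm_num)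

theorem norm_sq_eq_integral (f : L2) : ‖f‖ ^ 2 = ∫ x, ‖f x‖ ^ 2 := by
  have h := inner_self_eq_norm_sq_to_K (𝕜 := ℂ) f
  rw [L2.inner_def] at h
  simp_rw [inner_self_eq_norm_sq_to_K] at h
  norm_cast at h
  exact h.symm

theorem gradSq_eq_sum (G : Fin 3 → L2) : gradSq G = ∑ i, ‖G i‖ ^ 2 := by
  rw [gradSq, integral_finsetSum _ fun i _ => integrable_norm_sq (G i)]
  simp_rw [norm_sq_eq_integral]

theorem gradSq_nonneg (G : Fin 3 → L2) : 0 ≤ gradSq G := by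
  rw [gradSq_eq_sum]; positivity

theorem norm_le_gradNorm (G : Fin 3 → L2) (i : Fin 3) : ‖G i‖ ≤ gradNorm G := by
  refine Real.le_sqrt_of_sq_le ?_
  rw [gradSq_eq_sum]
  exact Finset.single_le_sum (f := fun i => ‖G i‖ ^ 2) (fun i _ => by positivity) (Finset.mem_univ i)

/-- The **Gagliardo-Nirenberg-Sobolev inequality** on `H¹(ℝ³)`. -/
theorem exists_isGNConstant : ∃ C : ℝ, 0 < C ∧ IsGNConstant C := by
  obtain ⟨C, hC⟩ := exists_eLpNorm_six_le
  -- Three partial derivatives, each of norm at most `gradNorm G`; the 1 only ensures positivity.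
  refine ⟨C * 3 + 1, by positivity, fun f G hf hG => ?_⟩
  obtain ⟨φ, hφ, hφG, -⟩ := exists_schwartz_tendsto_grad le_rfl hf hG
  -- L² convergence yields an almost everywhere convergent subsequence, along which the L⁶ norm is
  -- lower semicontinuous by Fatou.
  have hm := tendstoInMeasure_of_tendsto_Lp hφ
  obtain ⟨ns, hns, hae⟩ := hm.exists_seq_tendsto_ae
  have h1 : eLpNorm f 6 volume ≤ liminf (fun k => eLpNorm ((φ (ns k)).toLp 2 : L2) 6 volume) atTop :=
    Lp.eLpNorm_lim_le_liminf_eLpNorm (fun n => (Lp.aestronglyMeasurable _)) f hae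
  have h2 : ∀ k, eLpNorm ((φ (ns k)).toLp 2 : L2) 6 volume ≤
      C * ∑ i : Fin 3, ‖((∂_{EuclideanSpace.single i (1 : ℝ)} (φ (ns k))).toLp 2 : L2)‖ₑ := by
    intro k
    rw [eLpNorm_congr_ae ((φ (ns k)).coeFn_toLp 2 volume)]
    exact hC _
  have h3 : Tendsto (fun k => (C : ℝ≥0∞) * ∑ i : Fin 3,
      ‖((∂_{EuclideanSpace.single i (1 : ℝ)} (φ (ns k))).toLp 2 : L2)‖ₑ) atTop
      (𝓝 (C * ∑ i : Fin 3, ‖G i‖ₑ)) := by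
    refine ENNReal.Tendsto.const_mul (tendsto_finsetSum _ fun i _ => ?_) (Or.inr (by simp))
    exact ((continuous_enorm.tendsto _).comp (hφG i)).comp hns.tendsto_atTop
  refine h1.trans ((liminf_le_liminf (Eventually.of_forall h2)).trans ?_)
  rw [h3.liminf_eq]
  calc (C : ℝ≥0∞) * ∑ i : Fin 3, ‖G i‖ₑ ≤ C * ∑ i : Fin 3, ENNReal.ofReal (gradNorm G) := by
        gcongr with i
        rw [← ofReal_norm]
        exact ENNReal.ofReal_le_ofReal (norm_le_gradNorm G i)
    _ = ENNReal.ofReal (C * 3 * gradNorm G) := by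
        rw [Finset.sum_const, mul_assoc, ENNReal.ofReal_mul (by positivity), ENNReal.ofReal_mul (by norm_num)]
        simp
    _ ≤ _ := by
        refine ENNReal.ofReal_le_ofReal ?_
        have : 0 ≤ gradNorm G := Real.sqrt_nonneg _
        gcongr
        linarith

/-! ### Invertibility of `JL - z` in terms of bounded operators -/

section Abstract

variable {H : Type*} [NormedAddCommGroup H] [InnerProductSpace ℂ H]

/-- The operator `(JL - z) ∘ (R₀ ⊕ R₀)`, where `R₀⁻¹` is a multiple of `1 - Δ`. -/
def blockOp (R₀ N W : H →L[ℂ] H) (k : ℝ) (z : ℂ) : (H × H) →L[ℂ] (H × H) :=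
  let p₁ := ContinuousLinearMap.fst ℂ H H
  let p₂ := ContinuousLinearMap.snd ℂ H H
  ((k : ℂ) • p₂ + N ∘L R₀ ∘L p₂ - z • (R₀ ∘L p₁)).prod
    (-((k : ℂ) • p₁ + N ∘L R₀ ∘L p₁ - (2 : ℂ) • (W ∘L R₀ ∘L p₁)) - z • (R₀ ∘L p₂))

theorem blockOp_apply (R₀ N W : H →L[ℂ] H) (k : ℝ) (z : ℂ) (v : H × H) :
    blockOp R₀ N W k z v = ((k : ℂ) • v.2 + N (R₀ v.2) - z • R₀ v.1,
      -((k : ℂ) • v.1 + N (R₀ v.1) - (2 : ℂ) • W (R₀ v.1)) - z • R₀ v.2) := rfl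

theorem re_inner_symm {T : H →L[ℂ] H} (hT : ∀ f g, inner ℂ (T f) g = inner ℂ f (T g)) (f g : H) :
    (inner ℂ f (T g)).re = (inner ℂ g (T f)).re := by
  rw [← hT, ← inner_conj_symm]
  exact Complex.conj_re _

theorem re_inner_smul_self (z : ℂ) (p : H) : (inner ℂ p (z • p)).re = z.re * ‖p‖ ^ 2 := by
  have : inner ℂ p p = ((‖p‖ ^ 2 : ℝ) : ℂ) := by
    rw [inner_self_eq_norm_sq_to_K]; push_cast; rfl
  rw [inner_smul_right, this, mul_comm, Complex.re_ofReal_mul, mul_comm]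

/-- The central cancellation. With p = R₀v, the operator L₋ is p ↦ kv + Np, symmetric because R₀ and
N are, so its two off-diagonal terms have opposite real parts. Only Re z and the exchange term
survive. -/
theorem re_inner_block {R₀ N W : H →L[ℂ] H} (k : ℝ) (z : ℂ)
    (hR : ∀ f g, inner ℂ (R₀ f) g = inner ℂ f (R₀ g))
    (hN : ∀ f g, inner ℂ (N f) g = inner ℂ f (N g)) (v : H × H) :
    (inner ℂ (R₀ v.1) (blockOp R₀ N W k z v).1).re + (inner ℂ (R₀ v.2) (blockOp R₀ N W k z v).2).re
      = -z.re * (‖R₀ v.1‖ ^ 2 + ‖R₀ v.2‖ ^ 2) + 2 * (inner ℂ (R₀ v.2) (W (R₀ v.1))).re := by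
  have h1 := re_inner_symm hN (R₀ v.1) (R₀ v.2)
  have h2 : (inner ℂ (R₀ v.1) v.2).re = (inner ℂ (R₀ v.2) v.1).re := by
    rw [hR, hR]; exact re_inner_symm hR _ _
  have h3 := re_inner_smul_self (H := H) z
  have h4 : ∀ (p q : H), (inner ℂ p ((k : ℂ) • q)).re = k * (inner ℂ p q).re := by
    intro p q
    rw [inner_smul_right, Complex.re_ofReal_mul]
  have h5 : ∀ (p q : H), (inner ℂ p ((2 : ℂ) • q)).re = 2 * (inner ℂ p q).re := by
    intro p q
    rw [inner_smul_right]
    simp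
  simp only [blockOp_apply, inner_add_right, inner_sub_right, inner_neg_right, Complex.add_re,
    Complex.sub_re, Complex.neg_re, h3, h4, h5, h1, h2]
  ring

theorem abs_re_inner_le (W : H →L[ℂ] H) (p q : H) :
    2 * |(inner ℂ q (W p)).re| ≤ ‖W‖ * (‖p‖ ^ 2 + ‖q‖ ^ 2) := by
  have h1 : |(inner ℂ q (W p)).re| ≤ ‖q‖ * (‖W‖ * ‖p‖) :=
    (Complex.abs_re_le_norm _).trans ((norm_inner_le_norm _ _).trans
      (by gcongr; exact W.le_opNorm p))
  nlinarith [mul_nonneg (norm_nonneg W) (sq_nonneg (‖p‖ - ‖q‖))]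

/-- With p = R₀v, q the image of v and c = |Re z| - ‖W‖, `re_inner_block` gives c(‖p₁‖² + ‖p₂‖²) ≤
(‖p₁‖ + ‖p₂‖)‖q‖, hence ‖p₁‖ + ‖p₂‖ ≤ (2/c)‖q‖. The two components of the equation then express kv
through q and bounded operators applied to p, which controls v itself. -/
theorem norm_le_blockOp {R₀ N W : H →L[ℂ] H} {k : ℝ} (hk : 0 < k) {z : ℂ}
    (hR : ∀ f g, inner ℂ (R₀ f) g = inner ℂ f (R₀ g))
    (hN : ∀ f g, inner ℂ (N f) g = inner ℂ f (N g)) (hz : ‖W‖ < |z.re|) :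
    ∃ C : ℝ≥0, ∀ v, ‖v‖ ≤ C * ‖blockOp R₀ N W k z v‖ := by
  set c := |z.re| - ‖W‖
  have hc : 0 < c := sub_pos.2 hz
  set M : ℝ := k⁻¹ * (1 + (‖N‖ + 2 * ‖W‖ + ‖z‖) * (2 / c))
  have hM : 0 ≤ M := by positivity
  refine ⟨⟨M, hM⟩, fun v => ?_⟩
  set q := blockOp R₀ N W k z v with hq
  set p₁ := R₀ v.1 with hp₁
  set p₂ := R₀ v.2 with hp₂
  have h1 := re_inner_block (R₀ := R₀) (W := W) k z hR hN v
  rw [← hq, ← hp₁, ← hp₂] at h1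
  have hq1 : ‖q.1‖ ≤ ‖q‖ := norm_fst_le q
  have hq2 : ‖q.2‖ ≤ ‖q‖ := norm_snd_le q
  have h2 := abs_re_inner_le W p₁ p₂
  have h3 : |(inner ℂ p₁ q.1).re| ≤ ‖p₁‖ * ‖q‖ :=
    (Complex.abs_re_le_norm _).trans ((norm_inner_le_norm _ _).trans (by gcongr))
  have h4 : |(inner ℂ p₂ q.2).re| ≤ ‖p₂‖ * ‖q‖ :=
    (Complex.abs_re_le_norm _).trans ((norm_inner_le_norm _ _).trans (by gcongr))
  have h5 : c * (‖p₁‖ ^ 2 + ‖p₂‖ ^ 2) ≤ (‖p₁‖ + ‖p₂‖) * ‖q‖ := by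
    have e : |z.re| * (‖p₁‖ ^ 2 + ‖p₂‖ ^ 2) = |-z.re * (‖p₁‖ ^ 2 + ‖p₂‖ ^ 2)| := by
      rw [abs_mul, abs_neg, abs_of_nonneg (a := ‖p₁‖ ^ 2 + ‖p₂‖ ^ 2) (by positivity)]
    have e2 : -z.re * (‖p₁‖ ^ 2 + ‖p₂‖ ^ 2) = (inner ℂ p₁ q.1).re + (inner ℂ p₂ q.2).re
        - 2 * (inner ℂ p₂ (W p₁)).re := by linarith
    have e3 := abs_sub ((inner ℂ p₁ q.1).re + (inner ℂ p₂ q.2).re) (2 * (inner ℂ p₂ (W p₁)).re)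
    have e4 := abs_add_le (inner ℂ p₁ q.1).re (inner ℂ p₂ q.2).re
    rw [abs_mul, abs_of_pos (show (0 : ℝ) < 2 by norm_num)] at e3
    rw [← e2, ← e] at e3
    simp only [c]
    linarith
  have hs : ‖p₁‖ + ‖p₂‖ ≤ 2 / c * ‖q‖ := by
    by_contra! hlt
    have hpos : 0 < ‖p₁‖ + ‖p₂‖ := lt_of_le_of_lt (by positivity) hlt
    have e1 : c / 2 * (‖p₁‖ + ‖p₂‖) ^ 2 ≤ (‖p₁‖ + ‖p₂‖) * ‖q‖ := by
      nlinarith [mul_nonneg hc.le (sq_nonneg (‖p₁‖ - ‖p₂‖))]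
    have e2 : c / 2 * (‖p₁‖ + ‖p₂‖) ≤ ‖q‖ := by
      by_contra! h
      nlinarith [mul_lt_mul_of_pos_left h hpos]
    have e3 : ‖p₁‖ + ‖p₂‖ ≤ 2 / c * ‖q‖ := by
      rw [div_mul_eq_mul_div, le_div_iff₀ hc]; linarith
    linarith
  have hp1 : ‖p₁‖ ≤ 2 / c * ‖q‖ := by linarith [norm_nonneg p₂]
  have hp2 : ‖p₂‖ ≤ 2 / c * ‖q‖ := by linarith [norm_nonneg p₁]
  have hkv : ∀ x : H, ‖(k : ℂ) • x‖ = k * ‖x‖ := fun x => by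
    rw [norm_smul, Complex.norm_real, Real.norm_of_nonneg hk.le]
  have hfin : ∀ x : H, k * ‖x‖ ≤ ‖q‖ + (‖N‖ + 2 * ‖W‖ + ‖z‖) * (2 / c * ‖q‖) →
      ‖x‖ ≤ M * ‖q‖ := by
    intro x hx
    rw [show M * ‖q‖ = k⁻¹ * (‖q‖ + (‖N‖ + 2 * ‖W‖ + ‖z‖) * (2 / c * ‖q‖)) by simp only [M]; ring,
      ← div_eq_inv_mul, le_div_iff₀' hk]
    exact hx
  have hW0 := norm_nonneg W
  have hqc : 0 ≤ 2 / c * ‖q‖ := by positivity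
  rw [Prod.norm_def]
  refine max_le (hfin _ ?_) (hfin _ ?_)
  · have : (k : ℂ) • v.1 = -q.2 - N p₁ + (2 : ℂ) • W p₁ - z • p₂ := by
      rw [hq, blockOp_apply]; simp only; abel
    rw [← hkv, this]
    calc ‖-q.2 - N p₁ + (2 : ℂ) • W p₁ - z • p₂‖
        ≤ ‖q.2‖ + ‖N p₁‖ + ‖(2 : ℂ) • W p₁‖ + ‖z • p₂‖ := by
          refine (norm_sub_le _ _).trans (add_le_add_left ((norm_add_le _ _).trans
            (add_le_add_left ((norm_sub_le _ _).trans ?_) _)) _)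
          rw [norm_neg]
      _ ≤ ‖q‖ + ‖N‖ * (2 / c * ‖q‖) + 2 * (‖W‖ * (2 / c * ‖q‖)) + ‖z‖ * (2 / c * ‖q‖) := by
          rw [norm_smul, norm_smul]
          gcongr
          · exact (N.le_opNorm _).trans (by gcongr)
          · simp
          · exact (W.le_opNorm _).trans (by gcongr)
      _ = _ := by ring
  · have : (k : ℂ) • v.2 = q.1 - N p₂ + z • p₁ := by
      rw [hq, blockOp_apply]; simp only; abel
    rw [← hkv, this]
    calc ‖q.1 - N p₂ + z • p₁‖ ≤ ‖q.1‖ + ‖N p₂‖ + ‖z • p₁‖ :=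
          (norm_add_le _ _).trans (add_le_add_left (norm_sub_le _ _) _)
      _ ≤ ‖q‖ + ‖N‖ * (2 / c * ‖q‖) + ‖z‖ * (2 / c * ‖q‖) := by
          rw [norm_smul]
          gcongr
          exact (N.le_opNorm _).trans (by gcongr)
      _ ≤ _ := by nlinarith [mul_nonneg hW0 hqc]

/-- Orthogonality to the range is the adjoint eigenvalue equation with z̄. Testing with (0, v) and
(v, 0) shows that kg₁ and kg₂ lie in the range of R₀, that is, g is automatically in the domain. The
cancellation of `re_inner_block` then applies to g and contradicts ‖W‖ < |Re z| unless g = 0. -/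
theorem eq_zero_of_orthogonal_blockOp {R₀ N W : H →L[ℂ] H} {k : ℝ} (hk : 0 < k) {z : ℂ}
    (hR : ∀ f g, inner ℂ (R₀ f) g = inner ℂ f (R₀ g))
    (hN : ∀ f g, inner ℂ (N f) g = inner ℂ f (N g))
    (hW : ∀ f g, inner ℂ (W f) g = inner ℂ f (W g)) (hz : ‖W‖ < |z.re|) {g₁ g₂ : H}
    (hg : ∀ v, inner ℂ (blockOp R₀ N W k z v).1 g₁ + inner ℂ (blockOp R₀ N W k z v).2 g₂ = 0) :
    g₁ = 0 ∧ g₂ = 0 := by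
  set w := (starRingEnd ℂ) z
  have hwz : w.re = z.re := Complex.conj_re z
  have kne : (k : ℂ) ≠ 0 := by exact_mod_cast hk.ne'
  set a₁ : H := w • g₂ - N g₁ with ha₁
  set a₂ : H := -(w • g₁) - N g₂ + (2 : ℂ) • W g₂ with ha₂
  have e1 : (k : ℂ) • g₁ = R₀ a₁ := by
    refine ext_inner_left ℂ fun v => ?_
    have := hg (0, v)
    simp only [blockOp_apply, map_zero, smul_zero, add_zero, sub_zero, neg_zero, zero_sub] at this
    simp only [inner_add_left, inner_neg_left, inner_smul_left, hN, hR, Complex.conj_ofReal] at this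
    rw [inner_smul_right, ha₁, map_sub, map_smul, inner_sub_right, inner_smul_right]
    linear_combination this
  have e2 : (k : ℂ) • g₂ = R₀ a₂ := by
    refine ext_inner_left ℂ fun v => ?_
    have := hg (v, 0)
    simp only [blockOp_apply, map_zero, smul_zero, add_zero, sub_zero, zero_sub] at this
    simp only [inner_add_left, inner_neg_left, inner_sub_left, inner_smul_left, hN, hR, hW,
      Complex.conj_ofReal, map_ofNat] at this
    rw [inner_smul_right, ha₂, map_add, map_sub, map_neg, map_smul, map_smul, inner_add_right,
      inner_sub_right, inner_neg_right, inner_smul_right, inner_smul_right]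
    linear_combination -this
  have h1 : (inner ℂ g₁ a₂).re = (inner ℂ g₂ a₁).re := by
    have : (inner ℂ ((k : ℂ) • g₁) a₂).re = (inner ℂ ((k : ℂ) • g₂) a₁).re := by
      rw [e1, e2, hR, hR]; exact re_inner_symm hR _ _
    rw [inner_smul_left, inner_smul_left, Complex.conj_ofReal, Complex.re_ofReal_mul,
      Complex.re_ofReal_mul] at this
    exact mul_left_cancel₀ hk.ne' this
  have h3 : ∀ p : H, (inner ℂ p (w • p)).re = z.re * ‖p‖ ^ 2 := fun p => by
    rw [re_inner_smul_self, hwz]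
  have h5 : ∀ (p q : H), (inner ℂ p ((2 : ℂ) • q)).re = 2 * (inner ℂ p q).re := by
    intro p q
    rw [inner_smul_right]
    simp
  have h6 := re_inner_symm hN g₁ g₂
  have h7 := abs_re_inner_le W g₂ g₁
  simp only [ha₁, ha₂, inner_add_right, inner_sub_right, inner_neg_right, Complex.add_re,
    Complex.sub_re, Complex.neg_re, h3, h5, h6] at h1
  have h8 : z.re * (‖g₁‖ ^ 2 + ‖g₂‖ ^ 2) = 2 * (inner ℂ g₁ (W g₂)).re := by linarith
  have h9 : |z.re| * (‖g₁‖ ^ 2 + ‖g₂‖ ^ 2) ≤ ‖W‖ * (‖g₁‖ ^ 2 + ‖g₂‖ ^ 2) := by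
    calc |z.re| * (‖g₁‖ ^ 2 + ‖g₂‖ ^ 2) = |z.re * (‖g₁‖ ^ 2 + ‖g₂‖ ^ 2)| := by
          rw [abs_mul, abs_of_nonneg (a := ‖g₁‖ ^ 2 + ‖g₂‖ ^ 2) (by positivity)]
      _ = 2 * |(inner ℂ g₁ (W g₂)).re| := by
          rw [h8, abs_mul, abs_of_pos (show (0 : ℝ) < 2 by norm_num)]
      _ ≤ _ := h7.trans_eq (by ring)
  have h10 : ‖g₁‖ ^ 2 + ‖g₂‖ ^ 2 ≤ 0 := by
    by_contra! h
    exact absurd (le_of_mul_le_mul_right h9 h) (not_le.2 hz)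
  constructor
  · rw [← norm_eq_zero]; nlinarith [sq_nonneg ‖g₁‖, sq_nonneg ‖g₂‖]
  · rw [← norm_eq_zero]; nlinarith [sq_nonneg ‖g₁‖, sq_nonneg ‖g₂‖]

/-- The lower bound gives injectivity and closed range; a trivial orthogonal complement makes the
range everything. -/
theorem bijective_blockOp [CompleteSpace H] {R₀ N W : H →L[ℂ] H} {k : ℝ} (hk : 0 < k) {z : ℂ}
    (hR : ∀ f g, inner ℂ (R₀ f) g = inner ℂ f (R₀ g))
    (hN : ∀ f g, inner ℂ (N f) g = inner ℂ f (N g))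
    (hW : ∀ f g, inner ℂ (W f) g = inner ℂ f (W g)) (hz : ‖W‖ < |z.re|) :
    Function.Bijective (blockOp R₀ N W k z) := by
  set K := blockOp R₀ N W k z with hK
  obtain ⟨C, hC⟩ := norm_le_blockOp (W := W) hk hR hN hz
  have hanti : AntilipschitzWith C K := K.antilipschitz_of_bound hC
  refine ⟨hanti.injective, ?_⟩
  -- The product carries the sup norm and no inner product, so orthogonality is used in the
  -- equivalent Hilbert space `WithLp 2`.
  let e := WithLp.prodContinuousLinearEquiv 2 ℂ H H
  let T : (H × H) →L[ℂ] WithLp 2 (H × H) := (e.symm : (H × H) →L[ℂ] WithLp 2 (H × H)) ∘L K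
  have hcl : IsClosed (T.range : Set (WithLp 2 (H × H))) := by
    have h1 : IsClosed (range K) := hanti.isClosed_range K.uniformContinuous
    have h2 : (T.range : Set (WithLp 2 (H × H))) = e.symm '' range K := by
      ext x; simp [T]
    rw [h2]
    exact e.symm.toHomeomorph.isClosedMap _ h1
  have htop : T.range = ⊤ := by
    have : CompleteSpace T.range := hcl.completeSpace_coe
    rw [← Submodule.orthogonal_eq_bot_iff, Submodule.eq_bot_iff]
    intro g hg
    have := eq_zero_of_orthogonal_blockOp (g₁ := (e g).1) (g₂ := (e g).2) hk hR hN hW hz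
      (fun v => by
        have h := (Submodule.mem_orthogonal _ _).1 hg (T v) ⟨v, rfl⟩
        rw [WithLp.prod_inner_apply] at h
        exact h)
    apply e.injective
    rw [map_zero]
    exact Prod.ext this.1 this.2
  intro q
  have : e.symm q ∈ T.range := htop ▸ Submodule.mem_top
  obtain ⟨v, hv⟩ := this
  exact ⟨v, e.symm.injective hv⟩

/-- The resolvent is (R₀ ⊕ R₀) composed with the inverse of `blockOp`. The equivalence has the form
required by `spectrumJL`, with the domain encoded by p = R₀v. -/
theorem exists_resolvent [CompleteSpace H] {R₀ N W : H →L[ℂ] H} {k : ℝ} (hk : 0 < k) {z : ℂ}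
    (hR : ∀ f g, inner ℂ (R₀ f) g = inner ℂ f (R₀ g))
    (hN : ∀ f g, inner ℂ (N f) g = inner ℂ f (N g))
    (hW : ∀ f g, inner ℂ (W f) g = inner ℂ f (W g)) (hz : ‖W‖ < |z.re|) :
    ∃ R : (H × H) →L[ℂ] (H × H), ∀ p q : H × H,
      R q = p ↔ ∃ v : H × H, p = (R₀ v.1, R₀ v.2) ∧ blockOp R₀ N W k z v = q := by
  obtain ⟨hinj, hsurj⟩ := bijective_blockOp hk hR hN hW hz
  let K := ContinuousLinearEquiv.ofBijective (blockOp R₀ N W k z) (LinearMap.ker_eq_bot.2 hinj)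
    (LinearMap.range_eq_top.2 hsurj)
  refine ⟨(R₀.prodMap R₀) ∘L (K.symm : (H × H) →L[ℂ] (H × H)), fun p q => ⟨?_, ?_⟩⟩
  · rintro rfl
    exact ⟨K.symm q, rfl, K.apply_symm_apply q⟩
  · rintro ⟨v, rfl, rfl⟩
    have : K.symm (blockOp R₀ N W k z v) = v := K.symm_apply_apply v
    simp only [ContinuousLinearMap.comp_apply, ContinuousLinearEquiv.coe_coe, this]
    rfl

end Abstract

/-! ### The Coulomb potential and the exchange operator -/

theorem eLpNorm_nat_pow (f : Space → ℂ) (n : ℕ) (hn : n ≠ 0) :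
    eLpNorm f n volume ^ n = ∫⁻ x, ‖f x‖ₑ ^ n := by
  rw [eLpNorm_eq_lintegral_rpow_enorm_toReal (by exact_mod_cast hn) (by simp), ← ENNReal.rpow_natCast,
    ← ENNReal.rpow_mul]
  simp [hn]

/-- Hölder with exponents 4/3 and 4 for |f|³ = |f|^(3/2) |f|^(3/2), then the power 2/3. -/
theorem eLpNorm_three_sq_le {f : Space → ℂ} (hf : AEStronglyMeasurable f volume) :
    eLpNorm f 3 volume ^ 2 ≤ eLpNorm f 2 volume * eLpNorm f 6 volume := by
  have hm : AEMeasurable (fun x => ‖f x‖ₑ ^ (3 / 2 : ℝ)) := hf.enorm.pow_const _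
  have hpq : (4 / 3 : ℝ).HolderConjugate 4 := by
    rw [Real.holderConjugate_iff]; norm_num
  have h := ENNReal.lintegral_mul_le_Lp_mul_Lq volume hpq hm hm
  have e1 : ∀ x, ((fun x => ‖f x‖ₑ ^ (3 / 2 : ℝ)) * fun x => ‖f x‖ₑ ^ (3 / 2 : ℝ)) x = ‖f x‖ₑ ^ 3 := by
    intro x
    rw [Pi.mul_apply, ← ENNReal.rpow_add_of_nonneg _ _ (by norm_num) (by norm_num)]
    norm_num
  have e2 : ∀ x, (‖f x‖ₑ ^ (3 / 2 : ℝ)) ^ (4 / 3 : ℝ) = ‖f x‖ₑ ^ 2 := by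
    intro x; rw [← ENNReal.rpow_mul]; norm_num
  have e3 : ∀ x, (‖f x‖ₑ ^ (3 / 2 : ℝ)) ^ (4 : ℝ) = ‖f x‖ₑ ^ 6 := by
    intro x; rw [← ENNReal.rpow_mul]; norm_num
  simp_rw [e1, e2, e3] at h
  have n3 := eLpNorm_nat_pow f 3 (by norm_num)
  have n2 := eLpNorm_nat_pow f 2 (by norm_num)
  have n6 := eLpNorm_nat_pow f 6 (by norm_num)
  push_cast at n2 n3 n6
  rw [← n2, ← n3, ← n6] at h
  have h' := ENNReal.rpow_le_rpow h (show (0 : ℝ) ≤ 2 / 3 by norm_num)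
  rw [ENNReal.mul_rpow_of_nonneg _ _ (by norm_num)] at h'
  simp only [← ENNReal.rpow_natCast, ← ENNReal.rpow_mul] at h' ⊢
  norm_num at h' ⊢
  exact h'

/-- The kernel potential `∫ |u(y)|² |x - y|⁻² dy`. -/
def riesz (u : Space → ℂ) (x : Space) : ℝ≥0∞ := ∫⁻ y, ‖u y‖ₑ ^ 2 * ‖x - y‖ₑ ^ (-2 : ℝ)

/-- Hardy-Littlewood-Sobolev with l = 2 for the pair |u|², |u|² ∈ L^(3/2). The constant enters as a
square root because the right side is written as a square, ready for the Hilbert-Schmidt norm. -/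
theorem exists_riesz_le : ∃ C : ℝ≥0, ∀ u : Space → ℂ, MemLp u 3 volume →
    ∫⁻ x, ‖u x‖ₑ ^ 2 * riesz u x ≤ (C * eLpNorm u 3 volume ^ 2) ^ 2 := by
  obtain ⟨C, hC⟩ := exists_hls (l := 2) (by norm_num) (by norm_num)
  refine ⟨NNReal.sqrt C, fun u hu => ?_⟩
  have e : ∀ y, ((‖u y‖₊ ^ 2 : ℝ≥0) : ℝ≥0∞) ^ (6 / (6 - 2) : ℝ) = ‖u y‖ₑ ^ 3 := by
    intro y
    rw [ENNReal.coe_pow, ← ENNReal.rpow_natCast, ← ENNReal.rpow_mul]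
    norm_num
    rfl
  have n3 := eLpNorm_nat_pow u 3 (by norm_num)
  push_cast at n3
  have hfin : ∫⁻ y, ((‖u y‖₊ ^ 2 : ℝ≥0) : ℝ≥0∞) ^ (6 / (6 - 2) : ℝ) ≠ ∞ := by
    simp_rw [e]
    rw [← n3]
    exact ENNReal.pow_ne_top hu.2.ne
  have hm : AEMeasurable fun y => ‖u y‖₊ ^ 2 := hu.1.aemeasurable.nnnorm.pow_const _
  have h := hC _ _ hm hm hfin hfin
  simp_rw [e] at h
  rw [← n3] at h
  calc ∫⁻ x, ‖u x‖ₑ ^ 2 * riesz u x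
      = ∫⁻ x, ∫⁻ y, ((‖u x‖₊ ^ 2 : ℝ≥0) : ℝ≥0∞) * ((‖u y‖₊ ^ 2 : ℝ≥0) : ℝ≥0∞) * ‖x - y‖ₑ ^ (-2 : ℝ) := by
        refine lintegral_congr fun x => ?_
        rw [riesz, ← lintegral_const_mul' _ _ (by simp)]
        refine lintegral_congr fun y => ?_
        rw [mul_assoc]
        push_cast
        rfl
    _ ≤ _ := h
    _ = _ := by
        rw [mul_pow, ← ENNReal.coe_pow, NNReal.sq_sqrt, mul_assoc]
        congr 1
        simp only [← ENNReal.rpow_natCast, ← ENNReal.rpow_mul]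
        rw [← ENNReal.rpow_add_of_nonneg _ _ (by norm_num) (by norm_num)]
        norm_num

theorem measurable_enorm_sub_rpow (s : ℝ) :
    Measurable fun z : Space × Space => ‖z.1 - z.2‖ₑ ^ s := by fun_prop

theorem aemeasurable_riesz {u : Space → ℂ} (hu : AEStronglyMeasurable u volume) :
    AEMeasurable (riesz u) := by
  have : AEMeasurable (fun z : Space × Space => ‖u z.2‖ₑ ^ 2 * ‖z.1 - z.2‖ₑ ^ (-2 : ℝ))
      (volume.prod volume) :=
    ((hu.enorm.comp_snd).pow_const _).mul (measurable_enorm_sub_rpow _).aemeasurable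
  exact this.lintegral_prod_right'

/-- Cauchy-Schwarz with the kernel grouped with u; squaring and integrating against |u|² then
produces the Hilbert-Schmidt norm. -/
theorem lintegral_mul_inv_dist_le {u : Space → ℂ} (hu : AEStronglyMeasurable u volume)
    {w : Space → ℂ} (hw : AEStronglyMeasurable w volume) (x : Space) :
    ∫⁻ y, ‖u y‖ₑ * ‖w y‖ₑ * ‖x - y‖ₑ⁻¹ ≤ riesz u x ^ (1 / 2 : ℝ) * eLpNorm w 2 volume := by
  have hpq : (2 : ℝ).HolderConjugate 2 := by
    rw [Real.holderConjugate_iff]; norm_num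
  have hk : Measurable fun y : Space => ‖x - y‖ₑ⁻¹ := by fun_prop
  have h := ENNReal.lintegral_mul_le_Lp_mul_Lq volume hpq (hu.enorm.mul hk.aemeasurable) hw.enorm
  have n2 := eLpNorm_nat_pow w 2 (by norm_num)
  push_cast at n2
  calc ∫⁻ y, ‖u y‖ₑ * ‖w y‖ₑ * ‖x - y‖ₑ⁻¹
      = ∫⁻ y, (‖u y‖ₑ * ‖x - y‖ₑ⁻¹) * ‖w y‖ₑ := by congr 1; ext y; ring
    _ ≤ _ := h
    _ = _ := by
      have e1 : ∀ y, (‖u y‖ₑ * ‖x - y‖ₑ⁻¹) ^ (2 : ℝ) = ‖u y‖ₑ ^ 2 * ‖x - y‖ₑ ^ (-2 : ℝ) := by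
        intro y
        rw [ENNReal.mul_rpow_of_nonneg _ _ (by norm_num), ENNReal.inv_rpow, ENNReal.rpow_neg]
        norm_num
      have e2 : ∀ y, ‖w y‖ₑ ^ (2 : ℝ) = ‖w y‖ₑ ^ 2 := fun y => by norm_num
      simp only [Pi.mul_apply, e1, e2]
      rw [← n2, ← ENNReal.rpow_natCast, ← ENNReal.rpow_mul]
      norm_num
      rfl

/-- Only an inequality: at z = 0 the complex quotient is 0, whereas the inverse in `ℝ≥0∞` is ∞. -/
theorem enorm_coulomb_integrand (c : ℂ) (z : Space) : ‖c / (‖z‖ : ℂ)‖ₑ ≤ ‖c‖ₑ * ‖z‖ₑ⁻¹ := by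
  rcases eq_or_ne z 0 with rfl | hz
  · simp
  · rw [div_eq_mul_inv, enorm_mul]
    gcongr
    rw [← ofReal_norm, norm_inv, Complex.norm_real, norm_norm, ENNReal.ofReal_inv_of_pos (by simpa),
      ofReal_norm]

theorem aestronglyMeasurable_coulomb_integrand {f : Space → ℂ} (hf : AEStronglyMeasurable f volume) :
    AEStronglyMeasurable (fun z : Space × Space => f z.2 / (‖z.1 - z.2‖ : ℂ))
      (volume.prod volume) := by
  have : Measurable fun z : Space × Space => (‖z.1 - z.2‖ : ℂ) := by fun_prop
  exact (hf.comp_snd.aemeasurable.div this.aemeasurable).aestronglyMeasurable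

theorem aestronglyMeasurable_coulomb_section {f : Space → ℂ} (hf : AEStronglyMeasurable f volume)
    (x : Space) : AEStronglyMeasurable (fun y => f y / (‖x - y‖ : ℂ)) volume := by
  have : Measurable fun y : Space => (‖x - y‖ : ℂ) := by fun_prop
  exact (hf.aemeasurable.div this.aemeasurable).aestronglyMeasurable

theorem aestronglyMeasurable_coulombConv {f : Space → ℂ} (hf : AEStronglyMeasurable f volume) :
    AEStronglyMeasurable (coulombConv f) volume :=
  (aestronglyMeasurable_coulomb_integrand hf).integral_prod_right'

theorem enorm_coulombConv_le (f : Space → ℂ) (x : Space) :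
    ‖coulombConv f x‖ₑ ≤ ∫⁻ y, ‖f y‖ₑ * ‖x - y‖ₑ⁻¹ :=
  (enorm_integral_le_lintegral_enorm _).trans (lintegral_mono fun _ => enorm_coulomb_integrand _ _)

theorem integrable_coulomb {f : Space → ℂ} (hf : AEStronglyMeasurable f volume) {x : Space}
    (hx : ∫⁻ y, ‖f y‖ₑ * ‖x - y‖ₑ⁻¹ ≠ ∞) : Integrable fun y => f y / (‖x - y‖ : ℂ) :=
  ⟨aestronglyMeasurable_coulomb_section hf x,
    lt_of_le_of_lt (lintegral_mono fun _ => enorm_coulomb_integrand _ _) hx.lt_top⟩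

/-- `(|x|⁻¹ * (u w)) u`. -/
def exchangeFun (u w : Space → ℂ) (x : Space) : ℂ := coulombConv (fun y => u y * w y) x * u x

theorem aestronglyMeasurable_exchangeFun {u w : Space → ℂ} (hu : AEStronglyMeasurable u volume)
    (hw : AEStronglyMeasurable w volume) : AEStronglyMeasurable (exchangeFun u w) volume :=
  (aestronglyMeasurable_coulombConv (hu.mul hw)).mul hu

/-- The Hilbert-Schmidt norm of the exchange operator. -/
def exchangeNorm (u : Space → ℂ) : ℝ≥0∞ := (∫⁻ x, ‖u x‖ₑ ^ 2 * riesz u x) ^ (1 / 2 : ℝ)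

theorem eLpNorm_exchangeFun_le {u w : Space → ℂ} (hu : AEStronglyMeasurable u volume)
    (hw : MemLp w 2 volume) :
    eLpNorm (exchangeFun u w) 2 volume ≤ exchangeNorm u * eLpNorm w 2 volume := by
  have hb : ∀ x, ‖exchangeFun u w x‖ₑ ^ 2 ≤ eLpNorm w 2 volume ^ 2 * (‖u x‖ₑ ^ 2 * riesz u x) := by
    intro x
    rw [exchangeFun, enorm_mul, mul_pow]
    have h1 : ‖coulombConv (fun y => u y * w y) x‖ₑ ≤ riesz u x ^ (1 / 2 : ℝ) * eLpNorm w 2 volume := by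
      refine (enorm_coulombConv_le _ x).trans (le_trans (le_of_eq ?_)
        (lintegral_mul_inv_dist_le hu hw.1 x))
      simp_rw [enorm_mul]
    calc _ ≤ (riesz u x ^ (1 / 2 : ℝ) * eLpNorm w 2 volume) ^ 2 * ‖u x‖ₑ ^ 2 := by gcongr
      _ = _ := by
        rw [mul_pow, ← ENNReal.rpow_natCast (riesz u x ^ _), ← ENNReal.rpow_mul]
        norm_num
        ring
  have n2 := eLpNorm_nat_pow (exchangeFun u w) 2 (by norm_num)
  push_cast at n2
  have hsq : eLpNorm (exchangeFun u w) 2 volume ^ 2 ≤ (exchangeNorm u * eLpNorm w 2 volume) ^ 2 := by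
    rw [n2, mul_pow, exchangeNorm, ← ENNReal.rpow_natCast ((∫⁻ x, ‖u x‖ₑ ^ 2 * riesz u x) ^ _),
      ← ENNReal.rpow_mul]
    refine (lintegral_mono hb).trans ?_
    rw [lintegral_const_mul' _ _ (ENNReal.pow_ne_top hw.2.ne), mul_comm]
    norm_num
  exact (ENNReal.pow_le_pow_left_iff (by norm_num)).1 hsq

theorem memLp_exchangeFun {u w : Space → ℂ} (hu : AEStronglyMeasurable u volume)
    (hU : exchangeNorm u ≠ ∞) (hw : MemLp w 2 volume) : MemLp (exchangeFun u w) 2 volume :=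
  ⟨aestronglyMeasurable_exchangeFun hu hw.1,
    lt_of_le_of_lt (eLpNorm_exchangeFun_le hu hw) (ENNReal.mul_lt_top hU.lt_top hw.2)⟩

/-- Needed for additivity of the exchange operator, since a divergent Bochner integral is 0 by
default. A finite Hilbert-Schmidt norm makes `riesz u x` finite for almost every x with u(x) ≠ 0,
and where u(x) = 0 the factor u(x) kills the term. The exceptional null set does not depend on w. -/
theorem ae_integrable_exchange {u : Space → ℂ} (hu : AEStronglyMeasurable u volume)
    (hU : exchangeNorm u ≠ ∞) :
    ∀ᵐ x, ∀ w : Space → ℂ, MemLp w 2 volume →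
      u x = 0 ∨ Integrable fun y => u y * w y / (‖x - y‖ : ℂ) := by
  have h1 : ∫⁻ x, ‖u x‖ₑ ^ 2 * riesz u x ≠ ∞ := by
    intro h
    simp [exchangeNorm, h] at hU
  have hm : AEMeasurable fun x => ‖u x‖ₑ ^ 2 * riesz u x :=
    (hu.enorm.pow_const _).mul (aemeasurable_riesz hu)
  filter_upwards [ae_lt_top' hm h1] with x hx w hw
  by_cases h0 : u x = 0
  · exact Or.inl h0
  · refine Or.inr (integrable_coulomb (f := fun y => u y * w y) (hu.mul hw.1) (ne_top_of_le_ne_top ?_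
      (le_trans (le_of_eq (by simp_rw [enorm_mul])) (lintegral_mul_inv_dist_le hu hw.1 x))))
    refine ENNReal.mul_ne_top (ENNReal.rpow_ne_top_of_nonneg (by norm_num) fun hr => ?_) hw.2.ne
    rw [hr, ENNReal.mul_top (by simpa using h0)] at hx
    exact absurd hx (lt_irrefl _)

theorem coulombConv_add {f g : Space → ℂ} {x : Space}
    (hf : Integrable fun y => f y / (‖x - y‖ : ℂ)) (hg : Integrable fun y => g y / (‖x - y‖ : ℂ)) :
    coulombConv (fun y => f y + g y) x = coulombConv f x + coulombConv g x := by
  simp only [coulombConv, add_div]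
  exact integral_add hf hg

theorem coulombConv_const_mul (c : ℂ) (f : Space → ℂ) (x : Space) :
    coulombConv (fun y => c * f y) x = c * coulombConv f x := by
  simp only [coulombConv, mul_div_assoc]
  exact integral_const_mul c _

theorem coulombConv_congr_ae {f g : Space → ℂ} (h : f =ᵐ[volume] g) : coulombConv f = coulombConv g := by
  ext x
  refine integral_congr_ae ?_
  filter_upwards [h] with y hy
  rw [hy]

/-- The exchange operator `w ↦ (|x|⁻¹ * (u w)) u` on `L²`. -/
def exchangeOp (u : L2) (hU : exchangeNorm u ≠ ∞) : L2 →L[ℂ] L2 :=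
  LinearMap.mkContinuous
    { toFun := fun w => (memLp_exchangeFun (Lp.aestronglyMeasurable u) hU (Lp.memLp w)).toLp _
      map_add' := fun v w => by
        rw [← MemLp.toLp_add]
        refine MemLp.toLp_congr _ _ ?_
        filter_upwards [ae_integrable_exchange (Lp.aestronglyMeasurable u) hU] with x hx
        have e : coulombConv (fun y => u y * (v + w : L2) y)
            = coulombConv (fun y => u y * v y + u y * w y) := by
          refine coulombConv_congr_ae ?_
          filter_upwards [Lp.coeFn_add v w] with y hy
          rw [hy, Pi.add_apply, mul_add]
        simp only [exchangeFun, Pi.add_apply]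
        rw [e]
        rcases hx v (Lp.memLp v) with h0 | h1
        · simp [h0]
        rcases hx w (Lp.memLp w) with h0 | h2
        · simp [h0]
        rw [coulombConv_add h1 h2, add_mul]
      map_smul' := fun c w => by
        rw [RingHom.id_apply, ← MemLp.toLp_const_smul]
        refine MemLp.toLp_congr _ _ (Eventually.of_forall fun x => ?_)
        have e : coulombConv (fun y => u y * (c • w : L2) y)
            = coulombConv (fun y => c * (u y * w y)) := by
          refine coulombConv_congr_ae ?_
          filter_upwards [Lp.coeFn_smul c w] with y hy
          rw [hy, Pi.smul_apply, smul_eq_mul]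
          ring
        simp only [exchangeFun, Pi.smul_apply, smul_eq_mul]
        rw [e, coulombConv_const_mul, mul_assoc] }
    (exchangeNorm u).toReal fun w => by
      rw [LinearMap.coe_mk, AddHom.coe_mk, Lp.norm_toLp, Lp.norm_def, ← ENNReal.toReal_mul]
      exact ENNReal.toReal_mono (ENNReal.mul_ne_top hU (Lp.eLpNorm_ne_top w))
        (eLpNorm_exchangeFun_le (Lp.aestronglyMeasurable u) (Lp.memLp w))

theorem coeFn_exchangeOp (u : L2) (hU : exchangeNorm u ≠ ∞) (w : L2) :
    ⇑(exchangeOp u hU w) =ᵐ[volume] exchangeFun u w :=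
  (memLp_exchangeFun (Lp.aestronglyMeasurable u) hU (Lp.memLp w)).coeFn_toLp

theorem norm_exchangeOp_le (u : L2) (hU : exchangeNorm u ≠ ∞) :
    ‖exchangeOp u hU‖ ≤ (exchangeNorm u).toReal :=
  LinearMap.mkContinuous_norm_le _ ENNReal.toReal_nonneg _

/-- Cauchy-Schwarz in y and then in x gives the absolute convergence behind Fubini in
`inner_exchangeOp`. -/
theorem integrable_exchange_prod (u : L2) (hU : exchangeNorm u ≠ ∞) (f g : L2) :
    Integrable (fun z : Space × Space =>
      (starRingEnd ℂ) (f z.1) * u z.1 * (u z.2 * g z.2) / (‖z.1 - z.2‖ : ℂ))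
      (volume.prod volume) := by
  have hu := Lp.aestronglyMeasurable u
  have hf := Lp.aestronglyMeasurable f
  have hg := Lp.aestronglyMeasurable g
  have hk : Measurable fun z : Space × Space => ‖z.1 - z.2‖ₑ⁻¹ := by fun_prop
  have hk' : Measurable fun z : Space × Space => (‖z.1 - z.2‖ : ℂ) := by fun_prop
  have hmeas : AEStronglyMeasurable (fun z : Space × Space =>
      (starRingEnd ℂ) (f z.1) * u z.1 * (u z.2 * g z.2) / (‖z.1 - z.2‖ : ℂ)) (volume.prod volume) :=
    ((((Complex.continuous_conj.comp_aestronglyMeasurable hf).mul hu).comp_fst.mul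
      (hu.mul hg).comp_snd).aemeasurable.div hk'.aemeasurable).aestronglyMeasurable
  refine ⟨hmeas, ?_⟩
  have hm2 : AEMeasurable (fun z : Space × Space =>
      ‖f z.1‖ₑ * ‖u z.1‖ₑ * (‖u z.2‖ₑ * ‖g z.2‖ₑ * ‖z.1 - z.2‖ₑ⁻¹)) (volume.prod volume) :=
    ((hf.enorm.mul hu.enorm).comp_fst).mul (((hu.enorm.mul hg.enorm).comp_snd).mul hk.aemeasurable)
  calc ∫⁻ z, ‖(starRingEnd ℂ) (f z.1) * u z.1 * (u z.2 * g z.2) / (‖z.1 - z.2‖ : ℂ)‖ₑ ∂(volume.prod volume)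
      ≤ ∫⁻ z, ‖f z.1‖ₑ * ‖u z.1‖ₑ * (‖u z.2‖ₑ * ‖g z.2‖ₑ * ‖z.1 - z.2‖ₑ⁻¹) ∂(volume.prod volume) := by
        refine lintegral_mono fun z => (enorm_coulomb_integrand _ _).trans (le_of_eq ?_)
        rw [enorm_mul, enorm_mul, enorm_mul, RCLike.enorm_conj]
        ring
    _ = ∫⁻ x, ∫⁻ y, ‖f x‖ₑ * ‖u x‖ₑ * (‖u y‖ₑ * ‖g y‖ₑ * ‖x - y‖ₑ⁻¹) := lintegral_prod _ hm2
    _ ≤ ∫⁻ x, ‖f x‖ₑ * (‖u x‖ₑ * (riesz u x ^ (1 / 2 : ℝ) * eLpNorm g 2 volume)) := by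
        refine lintegral_mono fun x => ?_
        dsimp only
        rw [lintegral_const_mul' _ _ (ENNReal.mul_ne_top (by simp) (by simp)), mul_assoc]
        gcongr
        exact lintegral_mul_inv_dist_le hu hg x
    _ ≤ (∫⁻ x, ‖f x‖ₑ ^ (2 : ℝ)) ^ (1 / 2 : ℝ) *
          (∫⁻ x, (‖u x‖ₑ * (riesz u x ^ (1 / 2 : ℝ) * eLpNorm g 2 volume)) ^ (2 : ℝ)) ^ (1 / 2 : ℝ) := by
        have hpq : (2 : ℝ).HolderConjugate 2 := by
          rw [Real.holderConjugate_iff]; norm_num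
        exact ENNReal.lintegral_mul_le_Lp_mul_Lq volume hpq hf.enorm
          (hu.enorm.mul (((aemeasurable_riesz hu).pow_const _).mul_const _))
    _ < ∞ := by
        refine ENNReal.mul_lt_top ?_ ?_
        · refine ENNReal.rpow_lt_top_of_nonneg (by norm_num) ?_
          have n2 := eLpNorm_nat_pow f 2 (by norm_num)
          simp only [ENNReal.rpow_two]
          rw [← n2]
          exact ENNReal.pow_ne_top (by exact_mod_cast Lp.eLpNorm_ne_top f)
        · have e : ∀ x, (‖u x‖ₑ * (riesz u x ^ (1 / 2 : ℝ) * eLpNorm g 2 volume)) ^ (2 : ℝ)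
              = eLpNorm g 2 volume ^ 2 * (‖u x‖ₑ ^ 2 * riesz u x) := by
            intro x
            rw [ENNReal.mul_rpow_of_nonneg _ _ (by norm_num), ENNReal.mul_rpow_of_nonneg _ _ (by norm_num),
              ← ENNReal.rpow_mul]
            norm_num
            ring
          simp_rw [e]
          rw [lintegral_const_mul' _ _ (ENNReal.pow_ne_top (Lp.eLpNorm_ne_top g)),
            ENNReal.mul_rpow_of_nonneg _ _ (by norm_num)]
          exact ENNReal.mul_lt_top (ENNReal.rpow_lt_top_of_nonneg (by norm_num)
            (ENNReal.pow_ne_top (Lp.eLpNorm_ne_top g))) hU.lt_top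

/-- The kernel u(x)u(y)/|x - y| is real and symmetric because u is real; Fubini does the rest. -/
theorem inner_exchangeOp {u : L2} (hr : ∀ᵐ x, (u x).im = 0) (hU : exchangeNorm u ≠ ∞) (f g : L2) :
    inner ℂ (exchangeOp u hU f) g = inner ℂ f (exchangeOp u hU g) := by
  have hc : ∀ᵐ x, (starRingEnd ℂ) (u x) = u x := hr.mono fun x hx => Complex.conj_eq_iff_im.2 hx
  have h1 : inner ℂ f (exchangeOp u hU g) = ∫ x, ∫ y,
      (starRingEnd ℂ) (f x) * u x * (u y * g y) / (‖x - y‖ : ℂ) := by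
    rw [L2.inner_def]
    refine integral_congr_ae ?_
    filter_upwards [coeFn_exchangeOp u hU g] with x hx
    rw [hx, RCLike.inner_apply, exchangeFun, coulombConv, mul_comm, mul_comm _ (u x), ← mul_assoc,
      ← integral_const_mul]
    simp_rw [mul_div_assoc]
  have h2 : inner ℂ (exchangeOp u hU f) g = ∫ y, ∫ x,
      (starRingEnd ℂ) (f x) * u x * (u y * g y) / (‖x - y‖ : ℂ) := by
    rw [L2.inner_def]
    refine integral_congr_ae ?_
    filter_upwards [coeFn_exchangeOp u hU f, hc] with y hy hyc
    rw [hy, RCLike.inner_apply, exchangeFun, coulombConv, map_mul, hyc, ← integral_conj,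
      mul_comm _ (u y), ← mul_assoc, mul_comm (g y), ← integral_const_mul]
    refine integral_congr_ae ?_
    filter_upwards [hc] with x hx
    rw [map_div₀, map_mul, hx, Complex.conj_ofReal, norm_sub_rev]
    ring
  rw [h1, h2]
  exact integral_integral_swap (integrable_exchange_prod u hU f g).swap

/-! ### The Hartree potential -/

/-- The potential `|x|⁻¹ * |u|²` as a real function. -/
def hartree (u : Space → ℂ) (x : Space) : ℝ := ∫ y, ‖u y‖ ^ 2 / ‖x - y‖

theorem coulombConv_norm_sq (u : Space → ℂ) (x : Space) :
    coulombConv (fun y => (‖u y‖ : ℂ) ^ 2) x = hartree u x := by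
  have h : ∫ y, ((‖u y‖ ^ 2 / ‖x - y‖ : ℝ) : ℂ) = hartree u x := integral_ofReal
  rw [coulombConv, ← h]
  push_cast
  rfl

/-- Split at distance 1. Inside, Hölder pairs |u|² ∈ L³ with |z|⁻¹ ∈ L^(3/2) on the unit ball;
outside, the kernel is at most 1 and |u|² is integrable. -/
theorem exists_lintegral_coulomb_le {u : Space → ℂ} (h2 : MemLp u 2 volume) (h6 : MemLp u 6 volume) :
    ∃ C : ℝ≥0, ∀ x, ∫⁻ y, ‖u y‖ₑ ^ 2 * ‖x - y‖ₑ⁻¹ ≤ C := by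
  have n2 := eLpNorm_nat_pow u 2 (by norm_num)
  have n6 := eLpNorm_nat_pow u 6 (by norm_num)
  push_cast at n2 n6
  set A := ∫⁻ x in ball (0 : Space) 1, ‖x‖ₑ ^ (-3 / 2 : ℝ) with hA
  have hA' : A ≠ ∞ := lintegral_unitBall_enorm_rpow_ne_top (by norm_num)
  set B := (∫⁻ x, ‖u x‖ₑ ^ 6) ^ (1 / 3 : ℝ) * A ^ (2 / 3 : ℝ) + ∫⁻ x, ‖u x‖ₑ ^ 2
  have hB : B ≠ ∞ := by
    refine ENNReal.add_ne_top.2 ⟨ENNReal.mul_ne_top ?_ ?_, ?_⟩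
    · exact ENNReal.rpow_ne_top_of_nonneg (by norm_num) (n6 ▸ ENNReal.pow_ne_top h6.2.ne)
    · exact ENNReal.rpow_ne_top_of_nonneg (by norm_num) hA'
    · exact n2 ▸ ENNReal.pow_ne_top h2.2.ne
  refine ⟨B.toNNReal, fun x => ?_⟩
  rw [ENNReal.coe_toNNReal hB]
  set S := (fun y => x - y) ⁻¹' ball (0 : Space) 1
  have hS : MeasurableSet S := measurableSet_ball.preimage (by fun_prop)
  rw [← lintegral_add_compl _ hS]
  refine add_le_add ?_ ?_
  · have hpq : (3 : ℝ).HolderConjugate (3 / 2) := by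
      rw [Real.holderConjugate_iff]; norm_num
    have hk : Measurable fun y : Space => ‖x - y‖ₑ⁻¹ := by fun_prop
    refine (ENNReal.lintegral_mul_le_Lp_mul_Lq (volume.restrict S) hpq
      (h2.1.enorm.pow_const 2).restrict hk.aemeasurable).trans ?_
    refine mul_le_mul' (ENNReal.rpow_le_rpow ?_ (by norm_num)) ?_
    · calc ∫⁻ y in S, (‖u y‖ₑ ^ 2) ^ (3 : ℝ) ≤ ∫⁻ y, (‖u y‖ₑ ^ 2) ^ (3 : ℝ) :=
            setLIntegral_le_lintegral _ _
        _ = ∫⁻ y, ‖u y‖ₑ ^ 6 := by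
            refine lintegral_congr fun y => ?_
            rw [← ENNReal.rpow_natCast, ← ENNReal.rpow_mul]
            norm_num
    · refine le_of_eq ?_
      have e : ∀ y : Space, (‖x - y‖ₑ⁻¹) ^ (3 / 2 : ℝ) = ‖x - y‖ₑ ^ (-3 / 2 : ℝ) := by
        intro y
        rw [ENNReal.inv_rpow, ← ENNReal.rpow_neg]
        norm_num
      simp_rw [e]
      rw [hA, ← lintegral_indicator hS, ← lintegral_indicator measurableSet_ball,
        ← lintegral_sub_left_eq_self ((ball (0 : Space) 1).indicator _) x, one_div_div]
      rfl
  · refine (setLIntegral_mono' hS.compl fun y hy => ?_).trans (setLIntegral_le_lintegral Sᶜ _)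
    have hy : 1 ≤ ‖x - y‖ := by simpa [S] using hy
    refine mul_le_of_le_one_right' (ENNReal.inv_le_one.2 ?_)
    rw [← ofReal_norm]
    exact ENNReal.one_le_ofReal.2 hy

theorem enorm_hartree_integrand (c : ℂ) (z : Space) : ‖‖c‖ ^ 2 / ‖z‖‖ₑ ≤ ‖c‖ₑ ^ 2 * ‖z‖ₑ⁻¹ := by
  have h := enorm_coulomb_integrand ((‖c‖ : ℂ) ^ 2) z
  have e1 : (‖c‖ : ℂ) ^ 2 / (‖z‖ : ℂ) = ((‖c‖ ^ 2 / ‖z‖ : ℝ) : ℂ) := by push_cast; rfl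
  rw [e1, enorm_pow] at h
  simpa [← ofReal_norm] using h

theorem aestronglyMeasurable_hartree {u : Space → ℂ} (hu : AEStronglyMeasurable u volume) :
    AEStronglyMeasurable (hartree u) volume := by
  have hk : Measurable fun z : Space × Space => ‖z.1 - z.2‖ := by fun_prop
  have : AEStronglyMeasurable (fun z : Space × Space => ‖u z.2‖ ^ 2 / ‖z.1 - z.2‖)
      (volume.prod volume) :=
    ((hu.norm.pow 2).comp_snd.aemeasurable.div hk.aemeasurable).aestronglyMeasurable
  exact this.integral_prod_right'

theorem exists_hartree_le {u : Space → ℂ} (h2 : MemLp u 2 volume) (h6 : MemLp u 6 volume) :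
    ∃ C : ℝ, ∀ x, |hartree u x| ≤ C := by
  obtain ⟨C, hC⟩ := exists_lintegral_coulomb_le h2 h6
  refine ⟨C, fun x => ?_⟩
  have h : ‖hartree u x‖ₑ ≤ C :=
    (enorm_integral_le_lintegral_enorm _).trans
      ((lintegral_mono fun y => enorm_hartree_integrand _ _).trans (hC x))
  have := ENNReal.toReal_mono ENNReal.coe_ne_top h
  simpa using this

theorem integrable_hartree {u : Space → ℂ} (h2 : MemLp u 2 volume) (h6 : MemLp u 6 volume)
    (x : Space) : Integrable fun y => ‖u y‖ ^ 2 / ‖x - y‖ := by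
  obtain ⟨C, hC⟩ := exists_lintegral_coulomb_le h2 h6
  have hk : Measurable fun y : Space => ‖x - y‖ := by fun_prop
  exact ⟨((h2.1.norm.pow 2).aemeasurable.div hk.aemeasurable).aestronglyMeasurable,
    lt_of_le_of_lt (lintegral_mono fun y => enorm_hartree_integrand _ _)
      (lt_of_le_of_lt (hC x) ENNReal.coe_lt_top)⟩

theorem memLp_top_hartree {u : Space → ℂ} (h2 : MemLp u 2 volume) (h6 : MemLp u 6 volume) :
    MemLp (hartree u) ∞ volume := by
  obtain ⟨C, hC⟩ := exists_hartree_le h2 h6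
  exact memLp_top_of_bound (aestronglyMeasurable_hartree h2.1) C (Eventually.of_forall hC)

/-! ### The spectrum -/

/-- The bounded part of `L₋`, relative to `(2π)² (1 - (2π)⁻² Δ)`. -/
def shiftedPotential (V : Space → ℝ) (E : ℝ) (u : Space → ℂ) (x : Space) : ℂ :=
  ((E - fourPiSq + V x - hartree u x : ℝ) : ℂ)

theorem memLp_shiftedPotential {V : Space → ℝ} (hV : MemLp V ∞ volume) (E : ℝ) {u : Space → ℂ}
    (h2 : MemLp u 2 volume) (h6 : MemLp u 6 volume) :
    MemLp (shiftedPotential V E u) ∞ volume :=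
  MemLp.ofReal (((memLp_top_const (E - fourPiSq)).add hV).sub (memLp_top_hartree h2 h6))

/-- Parametrises the H² domain by v = (1 - (2π)⁻²Δ)w, in terms of which Δw = (2π)²(w - v). -/
theorem exists_hasLaplacian_iff {w : L2} {P : L2 → Prop} :
    (MemSobolev 2 2 (w : 𝓢'(Space, ℂ)) ∧ ∃ h : L2, HasLaplacian w h ∧ P h) ↔
      ∃ v : L2, w = resolventOp v ∧ P ((fourPiSq : ℂ) • (w - v)) := by
  have hk : (fourPiSq : ℂ) ≠ 0 := by exact_mod_cast fourPiSq_pos.ne'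
  constructor
  · rintro ⟨-, h, hh, hP⟩
    refine ⟨_, hasLaplacian_iff.1 hh, ?_⟩
    rw [sub_sub_cancel, smul_inv_smul₀ hk]
    exact hP
  · rintro ⟨v, hv, hP⟩
    refine ⟨hv ▸ memSobolev_two_resolventOp v, _, hasLaplacian_iff.2 ?_, hP⟩
    rw [inv_smul_smul₀ hk, sub_sub_cancel]
    exact hv

/-- Here -Δw = (2π)²v - (2π)²w, and the last term is absorbed into `shiftedPotential`. -/
theorem isLminus_iff {V : Space → ℝ} {E : ℝ} {u : L2}
    (hP : MemLp (shiftedPotential V E u) ∞ volume) {w f : L2} :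
    IsLminus V E u w f ↔ ∃ v : L2, w = resolventOp v ∧
      f = (fourPiSq : ℂ) • v + mulOp (hP.toLp _) w := by
  rw [IsLminus, exists_hasLaplacian_iff]
  refine exists_congr fun v => and_congr_right fun _ => ?_
  rw [Lp.ext_iff]
  refine eventually_congr ?_
  filter_upwards [coeFn_mulOp_toLp hP w, Lp.coeFn_smul (fourPiSq : ℂ) v,
    Lp.coeFn_smul (fourPiSq : ℂ) (w - v), Lp.coeFn_sub w v,
    Lp.coeFn_add ((fourPiSq : ℂ) • v) (mulOp (hP.toLp _) w)] with x h1 h2 h3 h4 h5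
  rw [h5, Pi.add_apply, h1, h2, h3, Pi.smul_apply, Pi.smul_apply, h4, Pi.sub_apply,
    coulombConv_norm_sq, shiftedPotential]
  push_cast
  simp only [smul_eq_mul]
  rw [← sub_eq_zero, ← sub_eq_zero (a := f x)]
  ring_nf

theorem isLplus_iff {V : Space → ℝ} {E : ℝ} {u : L2}
    (hP : MemLp (shiftedPotential V E u) ∞ volume) (hU : exchangeNorm u ≠ ∞) {w f : L2} :
    IsLplus V E u w f ↔ ∃ v : L2, w = resolventOp v ∧
      f = (fourPiSq : ℂ) • v + mulOp (hP.toLp _) w - (2 : ℂ) • exchangeOp u hU w := by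
  rw [IsLplus, exists_hasLaplacian_iff]
  refine exists_congr fun v => and_congr_right fun _ => ?_
  rw [Lp.ext_iff]
  refine eventually_congr ?_
  filter_upwards [coeFn_mulOp_toLp hP w, Lp.coeFn_smul (fourPiSq : ℂ) v,
    Lp.coeFn_smul (fourPiSq : ℂ) (w - v), Lp.coeFn_sub w v,
    Lp.coeFn_add ((fourPiSq : ℂ) • v) (mulOp (hP.toLp _) w),
    Lp.coeFn_sub ((fourPiSq : ℂ) • v + mulOp (hP.toLp _) w) ((2 : ℂ) • exchangeOp u hU w),
    Lp.coeFn_smul (2 : ℂ) (exchangeOp u hU w), coeFn_exchangeOp u hU w]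
    with x h1 h2 h3 h4 h5 h6 h7 h8
  rw [h6, Pi.sub_apply, h7, Pi.smul_apply, h8, h5, Pi.add_apply, h1, h2, h3, Pi.smul_apply,
    Pi.smul_apply, h4, Pi.sub_apply, coulombConv_norm_sq, shiftedPotential, exchangeFun]
  push_cast
  simp only [smul_eq_mul]
  rw [← sub_eq_zero, ← sub_eq_zero (a := f x)]
  ring_nf

/-- A resolvent would send 0 to the eigenvector, against linearity. -/
theorem eigenvaluesJL_subset_spectrumJL (V : Space → ℝ) (E : ℝ) (u : L2) :
    eigenvaluesJL V E u ⊆ spectrumJL V E u := by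
  rintro z ⟨p, hp, hJ⟩ ⟨R, hR⟩
  have : R 0 = p := (hR p 0).2 (by rwa [zero_add])
  exact hp (by rw [← this, map_zero])

theorem abs_re_le_of_mem_spectrumJL {V : Space → ℝ} (hV : MemLp V ∞ volume) {E : ℝ} {u : L2}
    (hr : ∀ᵐ x, (u x).im = 0) (h6 : MemLp u 6 volume) (hU : exchangeNorm u ≠ ∞) {z : ℂ}
    (hz : z ∈ spectrumJL V E u) : |z.re| ≤ (exchangeNorm u).toReal := by
  by_contra! hlt
  apply hz
  have hP := memLp_shiftedPotential hV E (Lp.memLp u) h6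
  obtain ⟨R, hR⟩ := exists_resolvent (R₀ := resolventOp) (N := mulOp (hP.toLp _))
    (W := exchangeOp u hU) (k := fourPiSq) (z := z) fourPiSq_pos inner_resolventOp
    (inner_mulOp hP (Eventually.of_forall fun x => Complex.conj_ofReal _)) (inner_exchangeOp hr hU)
    ((norm_exchangeOp_le u hU).trans_lt hlt)
  refine ⟨R, fun p q => (hR p q).trans ?_⟩
  rw [IsJL, isLminus_iff hP, isLplus_iff hP hU]
  constructor
  · rintro ⟨v, rfl, rfl⟩
    refine ⟨⟨v.2, rfl, ?_⟩, ⟨v.1, rfl, ?_⟩⟩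
    · simp only [blockOp_apply, Prod.fst_add, Prod.smul_fst]
      abel
    · simp only [blockOp_apply, Prod.snd_add, Prod.smul_snd]
      abel
  · rintro ⟨⟨v₂, h2, h2'⟩, ⟨v₁, h1, h1'⟩⟩
    refine ⟨(v₁, v₂), Prod.ext h1 h2, ?_⟩
    rw [blockOp_apply]
    refine Prod.ext ?_ ?_
    · simp only
      rw [← h1, ← h2, ← h2', Prod.fst_add, Prod.smul_fst, add_sub_cancel_right]
    · simp only
      rw [← h1, ← h2, ← h1', neg_neg, Prod.snd_add, Prod.smul_snd, add_sub_cancel_right]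

/-! ### Integration by parts -/

/-- The standard basis vectors. -/
abbrev e (i : Fin 3) : Space := EuclideanSpace.single i (1 : ℝ)

theorem lineDerivOp_comm (φ : 𝓢(Space, ℂ)) (v w : Space) : ∂_{v} (∂_{w} φ) = ∂_{w} (∂_{v} φ) := by
  have key : ∀ (v w x : Space), ∂_{v} (∂_{w} φ) x = fderiv ℝ (fderiv ℝ φ) x v w := by
    intro v w x
    have h1 : ⇑(∂_{w} φ : 𝓢(Space, ℂ)) = fun y => fderiv ℝ φ y w :=
      funext fun y => SchwartzMap.lineDerivOp_apply_eq_fderiv w φ y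
    have h2 : DifferentiableAt ℝ (fderiv ℝ φ) x :=
      ((φ.smooth 2).fderiv_right (m := 1) (by norm_num)).differentiable one_ne_zero x
    rw [SchwartzMap.lineDerivOp_apply_eq_fderiv, h1,
      fderiv_clm_apply h2 (differentiableAt_const w)]
    simp
  ext x
  rw [key, key]
  exact ((φ.smooth 2).contDiffAt.isSymmSndFDerivAt (by simp)) v w

theorem laplacian_eq_sum_single (φ : 𝓢(Space, ℂ)) : Δ φ = ∑ i : Fin 3, ∂_{e i} (∂_{e i} φ) := by
  rw [SchwartzMap.laplacian_eq_sum (EuclideanSpace.basisFun (Fin 3) ℝ)]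
  simp

section Weighted

variable {F : Space → ℝ} (hF : ContDiff ℝ 1 F) (hFc : HasCompactSupport F)

include hF hFc

theorem integrable_weight_mul {f : Space → ℂ} (hf : Continuous f) :
    Integrable fun x => (F x : ℂ) * f x := by
  refine Continuous.integrable_of_hasCompactSupport ?_ ?_
  · have := hF.continuous
    fun_prop
  · have : HasCompactSupport fun x => (F x : ℂ) := hFc.comp_left (g := fun t : ℝ => (t : ℂ)) (by simp)
    exact this.mul_right

theorem integrable_fderiv_weight_mul (v : Space) {f : Space → ℂ} (hf : Continuous f) :
    Integrable fun x => (fderiv ℝ F x v : ℂ) * f x := by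
  refine Continuous.integrable_of_hasCompactSupport ?_ ?_
  · have := hF.continuous_fderiv one_ne_zero
    fun_prop
  · have : HasCompactSupport fun x => (fderiv ℝ F x v : ℂ) :=
      (hFc.fderiv ℝ).comp_left (g := fun T : Space →L[ℝ] ℝ => (T v : ℂ)) (by simp)
    exact this.mul_right

/-- The pairings here are bilinear, without conjugation; this suffices because they are finally
applied to real-valued functions. -/
theorem integral_weight_lineDeriv (φ ψ : 𝓢(Space, ℂ)) (v : Space) :
    ∫ x, (F x : ℂ) * (∂_{v} φ x * ψ x)
      = -(∫ x, (fderiv ℝ F x v : ℂ) * (φ x * ψ x)) - ∫ x, (F x : ℂ) * (φ x * ∂_{v} ψ x) := by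
  have hφ := (φ.smooth 1).differentiable one_ne_zero
  have hψ := (ψ.smooth 1).differentiable one_ne_zero
  have hFd := hF.differentiable one_ne_zero
  have hder : ∀ x, fderiv ℝ (fun x => (F x : ℂ) * ψ x) x v
      = (fderiv ℝ F x v : ℂ) * ψ x + F x * ∂_{v} ψ x := by
    intro x
    have h1 : HasFDerivAt (fun x => (F x : ℂ)) (Complex.ofRealCLM ∘L fderiv ℝ F x) x :=
      Complex.ofRealCLM.hasFDerivAt.comp x (hFd x).hasFDerivAt
    rw [show fderiv ℝ (fun x => (F x : ℂ) * ψ x) x = _ from (h1.mul (hψ x).hasFDerivAt).fderiv,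
      SchwartzMap.lineDerivOp_apply_eq_fderiv]
    simp
    ring
  have h1 : Integrable fun x => (fderiv ℝ F x v : ℂ) * (φ x * ψ x) :=
    integrable_fderiv_weight_mul hF hFc v (φ.continuous.mul ψ.continuous)
  have h2 : Integrable fun x => (F x : ℂ) * (φ x * ∂_{v} ψ x) :=
    integrable_weight_mul hF hFc (φ.continuous.mul (∂_{v} ψ).continuous)
  have key := integral_mul_fderiv_eq_neg_fderiv_mul_of_integrable (μ := (volume : Measure Space))
    (f := fun x => (F x : ℂ) * ψ x) (g := φ) (v := v) ?_ ?_ ?_ ?_ ?_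
  · calc ∫ x, (F x : ℂ) * (∂_{v} φ x * ψ x)
        = ∫ x, (F x : ℂ) * ψ x * fderiv ℝ φ x v := by
          refine integral_congr_ae (Eventually.of_forall fun x => ?_)
          simp only [SchwartzMap.lineDerivOp_apply_eq_fderiv]
          ring
      _ = _ := key
      _ = -∫ x, ((fderiv ℝ F x v : ℂ) * (φ x * ψ x) + (F x : ℂ) * (φ x * ∂_{v} ψ x)) := by
          congr 1
          refine integral_congr_ae (Eventually.of_forall fun x => ?_)
          simp only [hder]
          ring
      _ = _ := by
          rw [integral_add h1 h2]
          ring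
  · refine (h1.add h2).congr (Eventually.of_forall fun x => ?_)
    simp only [hder, Pi.add_apply]
    ring
  · refine (integrable_weight_mul hF hFc (ψ.continuous.mul (∂_{v} φ).continuous)).congr
      (Eventually.of_forall fun x => ?_)
    simp only [SchwartzMap.lineDerivOp_apply_eq_fderiv, Pi.mul_apply]
    ring
  · refine (integrable_weight_mul hF hFc (ψ.continuous.mul φ.continuous)).congr
      (Eventually.of_forall fun x => ?_)
    simp only [Pi.mul_apply]
    ring
  · intro x _
    exact (Complex.ofRealCLM.differentiable.comp hFd x).mul (hψ x)
  · intro x _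
    exact hφ x

theorem integral_weight_lineDeriv_self (φ : 𝓢(Space, ℂ)) (v : Space) :
    2 * ∫ x, (F x : ℂ) * (φ x * ∂_{v} φ x) = -∫ x, (fderiv ℝ F x v : ℂ) * (φ x * φ x) := by
  have h := integral_weight_lineDeriv hF hFc φ φ v
  have : ∫ x, (F x : ℂ) * (∂_{v} φ x * φ x) = ∫ x, (F x : ℂ) * (φ x * ∂_{v} φ x) := by
    simp_rw [mul_comm (∂_{v} φ _)]
  rw [this] at h
  linear_combination h

/-- The Rellich-Pohozaev computation: integrate ∂ᵢ∂ᵢφ ∂ⱼφ by parts in direction i, then use ∂ᵢφ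
∂ⱼ∂ᵢφ = ½∂ⱼ(∂ᵢφ)² and integrate by parts in direction j. -/
theorem integral_weight_laplacian (φ : 𝓢(Space, ℂ)) (j : Fin 3) :
    ∫ x, (F x : ℂ) * (Δ φ x * ∂_{e j} φ x)
      = -(∑ i, ∫ x, (fderiv ℝ F x (e i) : ℂ) * (∂_{e i} φ x * ∂_{e j} φ x))
        + (1 / 2) * ∑ i, ∫ x, (fderiv ℝ F x (e j) : ℂ) * (∂_{e i} φ x * ∂_{e i} φ x) := by
  have h1 : ∫ x, (F x : ℂ) * (Δ φ x * ∂_{e j} φ x)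
      = ∑ i, ∫ x, (F x : ℂ) * (∂_{e i} (∂_{e i} φ) x * ∂_{e j} φ x) := by
    rw [← integral_finsetSum _ fun i _ => integrable_weight_mul hF hFc
      ((∂_{e i} (∂_{e i} φ)).continuous.mul (∂_{e j} φ).continuous)]
    refine integral_congr_ae (Eventually.of_forall fun x => ?_)
    simp only [laplacian_eq_sum_single, _root_.sum_apply, Finset.mul_sum, Finset.sum_mul]
  have h2 : ∀ i, ∫ x, (F x : ℂ) * (∂_{e i} (∂_{e i} φ) x * ∂_{e j} φ x)
      = -(∫ x, (fderiv ℝ F x (e i) : ℂ) * (∂_{e i} φ x * ∂_{e j} φ x))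
        + (1 / 2) * ∫ x, (fderiv ℝ F x (e j) : ℂ) * (∂_{e i} φ x * ∂_{e i} φ x) := by
    intro i
    have a := integral_weight_lineDeriv hF hFc (∂_{e i} φ) (∂_{e j} φ) (e i)
    have b := integral_weight_lineDeriv_self hF hFc (∂_{e i} φ) (e j)
    rw [lineDerivOp_comm φ (e j) (e i)] at b
    rw [a]
    linear_combination (-1 / 2) * b
  rw [h1]
  simp_rw [h2]
  rw [Finset.sum_add_distrib, Finset.sum_neg_distrib, Finset.mul_sum]

end Weighted

theorem integral_laplacian_self (φ : 𝓢(Space, ℂ)) :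
    ∫ x, Δ φ x * φ x = -∑ i, ∫ x, ∂_{e i} φ x * ∂_{e i} φ x := by
  have hint : ∀ f g : 𝓢(Space, ℂ), Integrable fun x => f x * g x := fun f g =>
    (f.memLp 2 volume).integrable_mul (g.memLp 2 volume)
  have h1 : ∫ x, Δ φ x * φ x = ∑ i, ∫ x, φ x * ∂_{e i} (∂_{e i} φ) x := by
    rw [← integral_finsetSum _ fun i _ => hint _ _]
    refine integral_congr_ae (Eventually.of_forall fun x => ?_)
    simp only [laplacian_eq_sum_single, _root_.sum_apply, Finset.sum_mul]
    exact Finset.sum_congr rfl fun i _ => mul_comm _ _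
  rw [h1, ← Finset.sum_neg_distrib]
  exact Finset.sum_congr rfl fun i _ =>
    SchwartzMap.integral_mul_lineDerivOp_right_eq_neg_left φ (∂_{e i} φ) (e i)

/-- Continuity of the weighted pairing on L² × L²; it carries the Schwartz identities over to H²
functions by density. -/
theorem tendsto_integral_weight {m : Space → ℝ} (hm : MemLp m ∞ volume) {φ ψ : ℕ → 𝓢(Space, ℂ)}
    {a b : L2} (ha : Tendsto (fun n => ((φ n).toLp 2 : L2)) atTop (𝓝 a))
    (hb : Tendsto (fun n => ((ψ n).toLp 2 : L2)) atTop (𝓝 b)) :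
    Tendsto (fun n => ∫ x, (m x : ℂ) * (φ n x * ψ n x)) atTop
      (𝓝 (∫ x, (m x : ℂ) * (a x * b x))) := by
  have hm' : MemLp (fun x => (m x : ℂ)) ∞ volume := hm.ofReal
  let B := (ContinuousLinearMap.mul ℂ ℂ).lpPairing (volume : Measure Space) 2 2
  have hB : ∀ f g : L2, B (mulOp (hm'.toLp _) f) g = ∫ x, (m x : ℂ) * (f x * g x) := by
    intro f g
    rw [ContinuousLinearMap.lpPairing_eq_integral]
    refine integral_congr_ae ?_
    filter_upwards [coeFn_mulOp_toLp hm' f] with x hx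
    rw [hx, ContinuousLinearMap.mul_apply', mul_assoc]
  have hc : Continuous fun p : L2 × L2 => B (mulOp (hm'.toLp _) p.1) p.2 :=
    (B.continuous.comp ((mulOp (hm'.toLp _)).continuous.comp continuous_fst)).clm_apply continuous_snd
  have := (hc.tendsto (a, b)).comp (ha.prodMk_nhds hb)
  simp only [Function.comp_def, hB] at this
  refine this.congr fun n => ?_
  refine integral_congr_ae ?_
  filter_upwards [(φ n).coeFn_toLp 2 volume, (ψ n).coeFn_toLp 2 volume] with x h1 h2
  rw [h1, h2]

theorem memLp_top_weight {F : Space → ℝ} (hF : ContDiff ℝ 1 F) (hFc : HasCompactSupport F) :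
    MemLp F ∞ volume :=
  hF.continuous.memLp_top_of_hasCompactSupport hFc volume

theorem memLp_top_fderiv_weight {F : Space → ℝ} (hF : ContDiff ℝ 1 F) (hFc : HasCompactSupport F)
    (v : Space) : MemLp (fun x => fderiv ℝ F x v) ∞ volume := by
  refine Continuous.memLp_top_of_hasCompactSupport ?_ ?_ volume
  · have := hF.continuous_fderiv one_ne_zero
    fun_prop
  · exact (hFc.fderiv ℝ).comp_left (g := fun T : Space →L[ℝ] ℝ => T v) (by simp)

/-! ### Weak identities for functions in `H²` -/

section Weak

variable {u h : L2} {G : Fin 3 → L2} (hG : HasGrad u G) (hh : HasLaplacian u h)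

include hG hh

theorem weak_mul_grad {F : Space → ℝ} (hF : ContDiff ℝ 1 F) (hFc : HasCompactSupport F) (j : Fin 3) :
    2 * ∫ x, (F x : ℂ) * (u x * G j x) = -∫ x, (fderiv ℝ F x (e j) : ℂ) * (u x * u x) := by
  obtain ⟨φ, h1, h2, -⟩ := exists_schwartz_tendsto_grad one_le_two hh.memSobolev hG
  have l1 := (tendsto_integral_weight (memLp_top_weight hF hFc) h1 (h2 j)).const_mul 2
  have l2 := (tendsto_integral_weight (memLp_top_fderiv_weight hF hFc (e j)) h1 h1).neg
  exact tendsto_nhds_unique l1 (l2.congr fun n =>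
    (integral_weight_lineDeriv_self hF hFc (φ n) (e j)).symm)

theorem weak_laplacian_mul_grad {F : Space → ℝ} (hF : ContDiff ℝ 1 F) (hFc : HasCompactSupport F)
    (j : Fin 3) :
    ∫ x, (F x : ℂ) * (h x * G j x)
      = -(∑ i, ∫ x, (fderiv ℝ F x (e i) : ℂ) * (G i x * G j x))
        + (1 / 2) * ∑ i, ∫ x, (fderiv ℝ F x (e j) : ℂ) * (G i x * G i x) := by
  obtain ⟨φ, h1, h2, h3⟩ := exists_schwartz_tendsto_grad one_le_two hh.memSobolev hG
  have h3 := h3 le_rfl h hh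
  have l1 := tendsto_integral_weight (memLp_top_weight hF hFc) h3 (h2 j)
  have l2 := tendsto_finsetSum Finset.univ fun (i : Fin 3) _ =>
    tendsto_integral_weight (memLp_top_fderiv_weight hF hFc (e i)) (h2 i) (h2 j)
  have l3 := tendsto_finsetSum Finset.univ fun (i : Fin 3) _ =>
    tendsto_integral_weight (memLp_top_fderiv_weight hF hFc (e j)) (h2 i) (h2 i)
  exact tendsto_nhds_unique l1 ((l2.neg.add (l3.const_mul (1 / 2))).congr fun n =>
    (integral_weight_laplacian hF hFc (φ n) j).symm)

theorem weak_laplacian_mul_self : ∫ x, h x * u x = -∑ i, ∫ x, G i x * G i x := by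
  obtain ⟨φ, h1, h2, h3⟩ := exists_schwartz_tendsto_grad one_le_two hh.memSobolev hG
  have h3 := h3 le_rfl h hh
  have hone : MemLp (fun _ : Space => (1 : ℝ)) ∞ volume := memLp_top_const 1
  have l1 := tendsto_integral_weight hone h3 h1
  have l2 := tendsto_finsetSum Finset.univ fun (i : Fin 3) _ =>
    tendsto_integral_weight hone (h2 i) (h2 i)
  simp only [Complex.ofReal_one, one_mul] at l1 l2
  exact tendsto_nhds_unique l1 (l2.neg.congr fun n => (integral_laplacian_self (φ n)).symm)

end Weak

/-- Against real test functions the distributional derivative of a real function is real, and such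
test functions determine Im Gᵢ. -/
theorem HasGrad.ae_im_eq_zero {u : L2} {G : Fin 3 → L2} (hG : HasGrad u G)
    (hr : ∀ᵐ x, (u x).im = 0) (i : Fin 3) : ∀ᵐ x, (G i x).im = 0 := by
  have hloc : LocallyIntegrable (fun x => (G i x).im) volume := by
    have := ((Lp.memLp (G i)).im).locallyIntegrable (by norm_num)
    simpa using this
  refine ae_eq_zero_of_integral_contDiff_smul_eq_zero hloc fun g hg hgc => ?_
  have hg₁ : HasCompactSupport (Complex.ofRealCLM ∘ g) := hgc.comp_left rfl
  have hg₂ : ContDiff ℝ ((⊤ : ℕ∞) : WithTop ℕ∞) (Complex.ofRealCLM ∘ g) :=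
    Complex.ofRealCLM.contDiff.comp hg
  let ψ : 𝓢(Space, ℂ) := hg₁.toSchwartzMap hg₂
  have h1 := DFunLike.congr_fun (hG i) ψ
  rw [TemperedDistribution.lineDerivOp_apply_apply, Lp.toTemperedDistribution_apply,
    Lp.toTemperedDistribution_apply] at h1
  have hint : ∀ (ψ : 𝓢(Space, ℂ)) (f : L2), Integrable fun x => ψ x * f x := fun ψ f =>
    (ψ.memLp 2 volume).integrable_mul (Lp.memLp f)
  have h2 := congrArg Complex.im h1
  have him : ∀ {f : Space → ℂ}, Integrable f → (∫ x, f x).im = ∫ x, (f x).im := fun hf =>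
    (integral_im hf).symm
  simp only [smul_eq_mul] at h2
  rw [him (hint _ _), him (hint _ _)] at h2
  have h3 : ∫ x, ((-∂_{e i} ψ) x * u x).im = 0 := by
    rw [← integral_zero Space ℝ (μ := volume)]
    refine integral_congr_ae ?_
    filter_upwards [hr] with x hx
    have : ((∂_{e i} ψ) x).im = 0 := by
      rw [SchwartzMap.lineDerivOp_apply_eq_fderiv]
      have hd : HasFDerivAt (Complex.ofRealCLM ∘ g) (Complex.ofRealCLM ∘L fderiv ℝ g x) x :=
        Complex.ofRealCLM.hasFDerivAt.comp x ((hg.differentiable (by simp)) x).hasFDerivAt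
      have : fderiv ℝ ψ x = Complex.ofRealCLM ∘L fderiv ℝ g x := hd.fderiv
      rw [this]
      simp
    simp [Complex.mul_im, hx, this]
  have h4 : ∫ x, (ψ x * G i x).im = ∫ x, g x • (G i x).im := by
    refine integral_congr_ae (Eventually.of_forall fun x => ?_)
    simp [ψ]
  rw [← h4, ← h2]
  exact h3

/-! ### Truncated dilation fields -/

/-- A smooth radial function that vanishes on the unit ball and equals `1` where `2 ≤ ‖x‖²`. -/
def outerCutoff (x : Space) : ℝ := Real.smoothTransition (‖x‖ ^ 2 - 1)

/-- The field `x ↦ x`, cut off near the origin. -/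
def outerField (x : Space) : Space := outerCutoff x • x

theorem outerCutoff_eq_zero {x : Space} (hx : ‖x‖ ^ 2 ≤ 1) : outerCutoff x = 0 :=
  Real.smoothTransition.zero_of_nonpos (by linarith)

theorem outerCutoff_eq_one {x : Space} (hx : 2 ≤ ‖x‖ ^ 2) : outerCutoff x = 1 :=
  Real.smoothTransition.one_of_one_le (by linarith)

theorem contDiff_outerCutoff : ContDiff ℝ 1 outerCutoff :=
  Real.smoothTransition.contDiff.comp ((contDiff_norm_sq ℝ).sub contDiff_const)

theorem contDiff_outerField : ContDiff ℝ 1 outerField :=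
  contDiff_outerCutoff.smul contDiff_id

theorem fderiv_outerField_of_lt {x : Space} (hx : ‖x‖ ^ 2 < 1) : fderiv ℝ outerField x = 0 := by
  have : outerField =ᶠ[𝓝 x] fun _ => 0 := by
    have hc : Continuous fun y : Space => ‖y‖ ^ 2 := by fun_prop
    filter_upwards [hc.continuousAt.eventually_lt_const hx] with y hy
    simp [outerField, outerCutoff_eq_zero hy.le]
  rw [this.fderiv_eq]
  simp

theorem fderiv_outerField_of_gt {x : Space} (hx : 2 < ‖x‖ ^ 2) :
    fderiv ℝ outerField x = ContinuousLinearMap.id ℝ Space := by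
  have : outerField =ᶠ[𝓝 x] id := by
    have hc : Continuous fun y : Space => ‖y‖ ^ 2 := by fun_prop
    filter_upwards [hc.continuousAt.eventually_const_lt hx] with y hy
    simp [outerField, outerCutoff_eq_one hy.le]
  rw [this.fderiv_eq]
  exact fderiv_id

theorem exists_norm_fderiv_outerField_le : ∃ C, ∀ x, ‖fderiv ℝ outerField x‖ ≤ C := by
  obtain ⟨C, hC⟩ := (isCompact_closedBall (0 : Space) 2).exists_bound_of_continuousOn
    (contDiff_outerField.continuous_fderiv one_ne_zero).continuousOn
  refine ⟨max C 1, fun x => ?_⟩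
  by_cases hx : ‖x‖ ≤ 2
  · exact (hC x (by simpa using hx)).trans (le_max_left _ _)
  · rw [fderiv_outerField_of_gt (by nlinarith)]
    exact ContinuousLinearMap.norm_id_le.trans (le_max_right _ _)

/-- The cutoff function of `dilField`. -/
def dilCutoff (n : ℕ) (x : Space) : ℝ :=
  outerCutoff (((n : ℝ) + 1) • x) - outerCutoff (((n : ℝ) + 1)⁻¹ • x)

/-- Smooth compactly supported fields, vanishing near the origin, that tend to `x ↦ x`. -/
def dilField (n : ℕ) (x : Space) : Space :=
  ((n : ℝ) + 1)⁻¹ • outerField (((n : ℝ) + 1) • x) - ((n : ℝ) + 1) • outerField (((n : ℝ) + 1)⁻¹ • x)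

theorem dilField_eq (n : ℕ) (x : Space) : dilField n x = dilCutoff n x • x := by
  have : (n : ℝ) + 1 ≠ 0 := by positivity
  simp only [dilField, dilCutoff, outerField, smul_smul, sub_smul]
  congr 2 <;> field_simp

theorem contDiff_dilField (n : ℕ) : ContDiff ℝ 1 (dilField n) := by
  have := contDiff_outerField
  unfold dilField
  fun_prop

theorem continuous_dilCutoff (n : ℕ) : Continuous (dilCutoff n) := by
  have := contDiff_outerCutoff.continuous
  unfold dilCutoff
  fun_prop

theorem abs_dilCutoff_le (n : ℕ) (x : Space) : |dilCutoff n x| ≤ 1 := by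
  have h (y : Space) : 0 ≤ outerCutoff y ∧ outerCutoff y ≤ 1 :=
    ⟨Real.smoothTransition.nonneg _, Real.smoothTransition.le_one _⟩
  have h1 := h (((n : ℝ) + 1) • x)
  have h2 := h (((n : ℝ) + 1)⁻¹ • x)
  rw [dilCutoff, abs_le]
  constructor <;> linarith

/-- The prefactors in `dilField` cancel the chain-rule factors. Both cutoffs rescale one fixed
field, so the derivative bounds are uniform in n. -/
theorem fderiv_dilField (n : ℕ) (x : Space) : fderiv ℝ (dilField n) x =
    fderiv ℝ outerField (((n : ℝ) + 1) • x) - fderiv ℝ outerField (((n : ℝ) + 1)⁻¹ • x) := by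
  have hk : (n : ℝ) + 1 ≠ 0 := by positivity
  have hZ := contDiff_outerField.differentiable one_ne_zero
  have h (k : ℝ) : HasFDerivAt (fun x => outerField (k • x)) (k • fderiv ℝ outerField (k • x)) x := by
    have h1 : HasFDerivAt (fun x : Space => k • x) (k • ContinuousLinearMap.id ℝ Space) x :=
      (hasFDerivAt_id x).const_smul k
    have := (hZ (k • x)).hasFDerivAt.comp x h1
    simpa [Function.comp_def] using this
  have := ((h ((n : ℝ) + 1)).const_smul ((n : ℝ) + 1)⁻¹).sub
    ((h ((n : ℝ) + 1)⁻¹).const_smul ((n : ℝ) + 1))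
  rw [smul_smul, smul_smul, inv_mul_cancel₀ hk, mul_inv_cancel₀ hk, one_smul, one_smul] at this
  exact this.fderiv

theorem exists_norm_fderiv_dilField_le : ∃ C : ℝ≥0, ∀ n x, ‖fderiv ℝ (dilField n) x‖₊ ≤ C := by
  obtain ⟨C, hC⟩ := exists_norm_fderiv_outerField_le
  refine ⟨(C + C).toNNReal, fun n x => ?_⟩
  rw [← NNReal.coe_le_coe, coe_nnnorm, fderiv_dilField]
  exact ((norm_sub_le _ _).trans (add_le_add (hC _) (hC _))).trans (Real.le_coe_toNNReal _)

theorem dilField_eventuallyEq_zero (n : ℕ) : dilField n =ᶠ[𝓝 0] 0 := by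
  have h0 : Continuous fun y : Space => ‖((n : ℝ) + 1) • y‖ ^ 2 := by fun_prop
  have h1 : Continuous fun y : Space => ‖((n : ℝ) + 1)⁻¹ • y‖ ^ 2 := by fun_prop
  filter_upwards [(h0.tendsto' 0 0 (by simp)).eventually_lt_const one_pos,
    (h1.tendsto' 0 0 (by simp)).eventually_lt_const one_pos] with y hy hy'
  simp [dilField_eq, dilCutoff, outerCutoff_eq_zero hy.le, outerCutoff_eq_zero hy'.le]

theorem hasCompactSupport_dilField (n : ℕ) : HasCompactSupport (dilField n) := by
  refine HasCompactSupport.intro (isCompact_closedBall (0 : Space) (2 * ((n : ℝ) + 1))) fun x hx => ?_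
  have hk : 1 ≤ (n : ℝ) + 1 := by simp
  have hx' : 2 * ((n : ℝ) + 1) < ‖x‖ := by simpa using hx
  have h1 : 2 ≤ ‖((n : ℝ) + 1) • x‖ := by
    rw [norm_smul, Real.norm_of_nonneg (by positivity)]
    nlinarith
  have h2 : 2 ≤ ‖((n : ℝ) + 1)⁻¹ • x‖ := by
    rw [norm_smul, Real.norm_of_nonneg (by positivity), inv_mul_eq_div, le_div_iff₀ (by positivity)]
    exact hx'.le
  rw [dilField_eq, dilCutoff, outerCutoff_eq_one (by nlinarith), outerCutoff_eq_one (by nlinarith)]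
  simp

theorem eventually_dil {x : Space} (hx : x ≠ 0) :
    ∀ᶠ n : ℕ in atTop, 2 < ‖((n : ℝ) + 1) • x‖ ^ 2 ∧ ‖((n : ℝ) + 1)⁻¹ • x‖ ^ 2 < 1 := by
  have hx' := norm_pos_iff.2 hx
  have ht : Tendsto (fun n : ℕ => (n : ℝ) + 1) atTop atTop :=
    tendsto_atTop_add_const_right _ _ tendsto_natCast_atTop_atTop
  filter_upwards [ht.eventually_gt_atTop (2 / ‖x‖), ht.eventually_gt_atTop ‖x‖] with n h1 h2
  have hk : 0 < (n : ℝ) + 1 := by positivity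
  rw [norm_smul, norm_smul, Real.norm_of_nonneg hk.le, Real.norm_of_nonneg (inv_nonneg.2 hk.le)]
  rw [div_lt_iff₀ hx'] at h1
  have h3 : ((n : ℝ) + 1)⁻¹ * ‖x‖ < 1 := by rwa [inv_mul_eq_div, div_lt_one hk]
  have h4 : 0 ≤ ((n : ℝ) + 1)⁻¹ * ‖x‖ := by positivity
  constructor <;> nlinarith

theorem tendsto_dilCutoff {x : Space} (hx : x ≠ 0) :
    Tendsto (fun n => dilCutoff n x) atTop (𝓝 1) := by
  refine tendsto_const_nhds.congr' ?_
  filter_upwards [eventually_dil hx] with n ⟨h1, h2⟩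
  simp [dilCutoff, outerCutoff_eq_one h1.le, outerCutoff_eq_zero h2.le]

theorem tendsto_dilField {x : Space} (hx : x ≠ 0) :
    Tendsto (fun n => dilField n x) atTop (𝓝 x) := by
  simp only [dilField_eq]
  simpa using (tendsto_dilCutoff hx).smul_const x

theorem tendsto_fderiv_dilField {x : Space} (hx : x ≠ 0) :
    Tendsto (fun n => fderiv ℝ (dilField n) x) atTop (𝓝 (ContinuousLinearMap.id ℝ Space)) := by
  refine tendsto_const_nhds.congr' ?_
  filter_upwards [eventually_dil hx] with n ⟨h1, h2⟩
  rw [fderiv_dilField, fderiv_outerField_of_gt h1, fderiv_outerField_of_lt h2, sub_zero]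

/-- The uniform Lipschitz bound dominates the quotient ⟨x - y, X(x) - X(y)⟩/|x - y|² in the Hartree
term. -/
theorem norm_dilField_sub_le {C : ℝ≥0} (hC : ∀ n x, ‖fderiv ℝ (dilField n) x‖₊ ≤ C) (n : ℕ)
    (x y : Space) : ‖dilField n x - dilField n y‖ ≤ C * ‖x - y‖ :=
  (lipschitzWith_of_nnnorm_fderiv_le ((contDiff_dilField n).differentiable one_ne_zero)
    (hC n)).norm_sub_le x y

/-! ### Real-valued functions and vector fields -/

/-- The divergence of a vector field. -/
def divergence (X : Space → Space) (x : Space) : ℝ := ∑ j, (fderiv ℝ X x (e j)) j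

/-- The real part of `X · G`. -/
def reDot (X : Space → Space) (G : Fin 3 → L2) (x : Space) : ℝ := ∑ j, X x j * (G j x).re

theorem mul_self_eq_norm_sq {z : ℂ} (hz : z.im = 0) : z * z = ((‖z‖ ^ 2 : ℝ) : ℂ) := by
  rw [← Complex.normSq_eq_norm_sq, Complex.normSq_apply]
  apply Complex.ext <;> simp [hz]

theorem mul_eq_re_mul_re {z w : ℂ} (hz : z.im = 0) (hw : w.im = 0) :
    z * w = ((z.re * w.re : ℝ) : ℂ) := by
  apply Complex.ext <;> simp [hz, hw]

theorem integral_ofReal_mul_mul {m : Space → ℝ} {f g : Space → ℂ} (hf : ∀ᵐ x, (f x).im = 0)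
    (hg : ∀ᵐ x, (g x).im = 0) :
    ∫ x, (m x : ℂ) * (f x * g x) = ((∫ x, m x * ((f x).re * (g x).re) : ℝ) : ℂ) := by
  refine Eq.trans (integral_congr_ae ?_) integral_complex_ofReal
  filter_upwards [hf, hg] with x h1 h2
  rw [mul_eq_re_mul_re h1 h2]
  simp

theorem integral_ofReal_mul_self {m : Space → ℝ} {f : Space → ℂ} (hf : ∀ᵐ x, (f x).im = 0) :
    ∫ x, (m x : ℂ) * (f x * f x) = ((∫ x, m x * ‖f x‖ ^ 2 : ℝ) : ℂ) := by
  refine Eq.trans (integral_congr_ae ?_) integral_complex_ofReal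
  filter_upwards [hf] with x h1
  rw [mul_self_eq_norm_sq h1]
  simp

theorem integrable_bdd_mul {m f : Space → ℝ} (hm : MemLp m ∞ volume) (hf : Integrable f) :
    Integrable fun x => m x * f x :=
  hf.mul_of_top_right hm

theorem integrable_re_mul_re (f g : L2) : Integrable fun x => (f x).re * (g x).re :=
  (Lp.memLp f).re.integrable_mul (Lp.memLp g).re

theorem fderiv_coord {X : Space → Space} (hX : ContDiff ℝ 1 X) (j : Fin 3) (x v : Space) :
    fderiv ℝ (fun y => X y j) x v = (fderiv ℝ X x v) j := by
  have h := (EuclideanSpace.proj (𝕜 := ℝ) j).hasFDerivAt.comp x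
    (hX.differentiable one_ne_zero x).hasFDerivAt
  have : fderiv ℝ (fun y => X y j) x = (EuclideanSpace.proj (𝕜 := ℝ) j) ∘L fderiv ℝ X x := h.fderiv
  rw [this]
  rfl

theorem contDiff_coord {X : Space → Space} (hX : ContDiff ℝ 1 X) (j : Fin 3) :
    ContDiff ℝ 1 fun y => X y j :=
  (EuclideanSpace.proj (𝕜 := ℝ) j).contDiff.comp hX

theorem hasCompactSupport_coord {X : Space → Space} (hX : HasCompactSupport X) (j : Fin 3) :
    HasCompactSupport fun y => X y j :=
  hX.comp_left (g := fun v : Space => v j) rfl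

theorem memLp_top_coord {X : Space → Space} (hX : ContDiff ℝ 1 X) (hXc : HasCompactSupport X)
    (j : Fin 3) : MemLp (fun y => X y j) ∞ volume :=
  memLp_top_weight (contDiff_coord hX j) (hasCompactSupport_coord hXc j)

theorem memLp_top_fderiv_coord {X : Space → Space} (hX : ContDiff ℝ 1 X) (hXc : HasCompactSupport X)
    (i j : Fin 3) : MemLp (fun y => (fderiv ℝ X y (e i)) j) ∞ volume := by
  simpa only [fderiv_coord hX] using
    memLp_top_fderiv_weight (contDiff_coord hX j) (hasCompactSupport_coord hXc j) (e i)

theorem memLp_top_divergence {X : Space → Space} (hX : ContDiff ℝ 1 X) (hXc : HasCompactSupport X) :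
    MemLp (divergence X) ∞ volume :=
  memLp_finsetSum _ fun j _ => memLp_top_fderiv_coord hX hXc j j

theorem divergence_smul {m : Space → ℝ} {X : Space → Space} {x : Space}
    (hm : DifferentiableAt ℝ m x) (hX : DifferentiableAt ℝ X x) :
    divergence (fun y => m y • X y) x = m x * divergence X x + fderiv ℝ m x (X x) := by
  have h1 : fderiv ℝ m x (X x) = ∑ j, X x j * fderiv ℝ m x (e j) := by
    conv_lhs => rw [← (EuclideanSpace.basisFun (Fin 3) ℝ).sum_repr (X x)]
    simp [map_sum]
  rw [divergence, divergence, h1, Finset.mul_sum, ← Finset.sum_add_distrib]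
  refine Finset.sum_congr rfl fun j _ => ?_
  rw [fderiv_fun_smul hm hX]
  simp
  ring

section Weak

variable {u h : L2} {G : Fin 3 → L2}

theorem integrable_bdd_mul_re_mul_reDot {m : Space → ℝ} (hm : MemLp m ∞ volume) (f : L2)
    {X : Space → Space} (hX : ContDiff ℝ 1 X) (hXc : HasCompactSupport X) :
    Integrable fun x => m x * ((f x).re * reDot X G x) := by
  have h1 : Integrable fun x => (f x).re * reDot X G x := by
    simp only [reDot, Finset.mul_sum]
    refine integrable_finsetSum _ fun j _ => ?_
    have := (integrable_re_mul_re f (G j)).mul_of_top_right (memLp_top_coord hX hXc j)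
    refine this.congr (Eventually.of_forall fun x => ?_)
    simp only [Pi.mul_apply]
    ring
  exact h1.mul_of_top_right hm

/-- Integration of X·∇(u²) by parts. It is used for three fields: X itself, V X, and X times the
regularised Coulomb kernel centred at a point y. -/
theorem weak_mul_reDot (hG : HasGrad u G) (hh : HasLaplacian u h) (hr : ∀ᵐ x, (u x).im = 0)
    {X : Space → Space} (hX : ContDiff ℝ 1 X) (hXc : HasCompactSupport X) :
    2 * ∫ x, (u x).re * reDot X G x = -∫ x, divergence X x * ‖u x‖ ^ 2 := by
  have key (j : Fin 3) : 2 * ∫ x, X x j * ((u x).re * (G j x).re)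
      = -∫ x, (fderiv ℝ X x (e j)) j * ‖u x‖ ^ 2 := by
    have := weak_mul_grad hG hh (contDiff_coord hX j) (hasCompactSupport_coord hXc j) j
    rw [integral_ofReal_mul_mul hr (hG.ae_im_eq_zero hr j), integral_ofReal_mul_self hr] at this
    simp only [fderiv_coord hX] at this
    exact_mod_cast this
  have h1 : ∫ x, (u x).re * reDot X G x = ∑ j, ∫ x, X x j * ((u x).re * (G j x).re) := by
    rw [← integral_finsetSum _ fun j _ =>
      integrable_bdd_mul (memLp_top_coord hX hXc j) (integrable_re_mul_re u (G j))]
    refine integral_congr_ae (Eventually.of_forall fun x => ?_)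
    simp only [reDot, Finset.mul_sum]
    exact Finset.sum_congr rfl fun j _ => by ring
  have h2 : ∫ x, divergence X x * ‖u x‖ ^ 2 = ∑ j, ∫ x, (fderiv ℝ X x (e j)) j * ‖u x‖ ^ 2 := by
    rw [← integral_finsetSum _ fun j _ =>
      integrable_bdd_mul (memLp_top_fderiv_coord hX hXc j j) (integrable_norm_sq u)]
    simp only [divergence, Finset.sum_mul]
  rw [h1, h2, Finset.mul_sum, ← Finset.sum_neg_distrib]
  exact Finset.sum_congr rfl fun j _ => key j

theorem weak_laplacian_mul_reDot (hG : HasGrad u G) (hh : HasLaplacian u h)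
    (hr : ∀ᵐ x, (u x).im = 0) (hhr : ∀ᵐ x, (h x).im = 0)
    {X : Space → Space} (hX : ContDiff ℝ 1 X) (hXc : HasCompactSupport X) :
    ∫ x, (h x).re * reDot X G x
      = -(∑ j, ∑ i, ∫ x, (fderiv ℝ X x (e i)) j * ((G i x).re * (G j x).re))
        + (1 / 2) * ∑ i, ∫ x, divergence X x * ‖G i x‖ ^ 2 := by
  have hGr := hG.ae_im_eq_zero hr
  have key (j : Fin 3) : ∫ x, X x j * ((h x).re * (G j x).re)
      = -(∑ i, ∫ x, (fderiv ℝ X x (e i)) j * ((G i x).re * (G j x).re))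
        + (1 / 2) * ∑ i, ∫ x, (fderiv ℝ X x (e j)) j * ‖G i x‖ ^ 2 := by
    have := weak_laplacian_mul_grad hG hh (contDiff_coord hX j) (hasCompactSupport_coord hXc j) j
    simp only [integral_ofReal_mul_mul hhr (hGr j), integral_ofReal_mul_mul (hGr _) (hGr j),
      integral_ofReal_mul_self (hGr _), fderiv_coord hX] at this
    rw [show (1 / 2 : ℂ) = ((1 / 2 : ℝ) : ℂ) by push_cast; rfl] at this
    rw [← Complex.ofReal_inj, this]
    push_cast
    rfl
  have h1 : ∫ x, (h x).re * reDot X G x = ∑ j, ∫ x, X x j * ((h x).re * (G j x).re) := by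
    rw [← integral_finsetSum _ fun j _ =>
      integrable_bdd_mul (memLp_top_coord hX hXc j) (integrable_re_mul_re h (G j))]
    refine integral_congr_ae (Eventually.of_forall fun x => ?_)
    simp only [reDot, Finset.mul_sum]
    exact Finset.sum_congr rfl fun j _ => by ring
  have h2 (i : Fin 3) : ∫ x, divergence X x * ‖G i x‖ ^ 2
      = ∑ j, ∫ x, (fderiv ℝ X x (e j)) j * ‖G i x‖ ^ 2 := by
    rw [← integral_finsetSum _ fun j _ =>
      integrable_bdd_mul (memLp_top_fderiv_coord hX hXc j j) (integrable_norm_sq (G i))]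
    simp only [divergence, Finset.sum_mul]
  rw [h1]
  simp_rw [key, h2]
  rw [Finset.sum_add_distrib, Finset.sum_neg_distrib, ← Finset.mul_sum, Finset.sum_comm (f := fun i j =>
    ∫ x, (fderiv ℝ X x (e i)) i * ‖G j x‖ ^ 2)]

theorem weak_laplacian_mul_re (hG : HasGrad u G) (hh : HasLaplacian u h)
    (hr : ∀ᵐ x, (u x).im = 0) (hhr : ∀ᵐ x, (h x).im = 0) :
    ∫ x, (h x).re * (u x).re = -gradSq G := by
  have hGr := hG.ae_im_eq_zero hr
  have := weak_laplacian_mul_self hG hh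
  have a := integral_ofReal_mul_mul (m := fun _ => 1) hhr hr
  have b (i : Fin 3) := integral_ofReal_mul_self (m := fun _ => 1) (hGr i)
  simp only [Complex.ofReal_one, one_mul] at a b
  rw [a] at this
  simp_rw [b] at this
  rw [gradSq, integral_finsetSum _ fun i _ => integrable_norm_sq (G i)]
  exact_mod_cast this

/-- Integration by parts against a potential that is smooth away from the origin. -/
theorem weak_potential (hG : HasGrad u G) (hh : HasLaplacian u h) (hr : ∀ᵐ x, (u x).im = 0)
    {V : Space → ℝ} (hV : ContDiffOn ℝ 1 V {0}ᶜ) {X : Space → Space} {θ : Space → ℝ}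
    (hX : ContDiff ℝ 1 X) (hXc : HasCompactSupport X) (hX0 : X =ᶠ[𝓝 0] 0)
    (hθ : ∀ x, X x = θ x • x) :
    2 * ∫ x, V x * ((u x).re * reDot X G x)
      = -∫ x, (V x * divergence X x + θ x * xDotGrad V x) * ‖u x‖ ^ 2 := by
  have hVd : ∀ x ≠ 0, ContDiffAt ℝ 1 V x := fun x hx =>
    hV.contDiffAt (isOpen_compl_singleton.mem_nhds hx)
  -- X vanishes near the origin, so the possible singularity of V there is invisible to the product.
  have hY : ContDiff ℝ 1 fun x => V x • X x := by
    rw [contDiff_iff_contDiffAt]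
    intro x
    by_cases hx : x = 0
    · subst hx
      refine (contDiffAt_const (c := (0 : Space))).congr_of_eventuallyEq ?_
      filter_upwards [hX0] with y hy
      simp [hy]
    · exact (hVd x hx).smul hX.contDiffAt
  have hYc : HasCompactSupport fun x => V x • X x := hXc.smul_left (f := V)
  have h1 := weak_mul_reDot hG hh hr hY hYc
  have h2 : ∫ x, V x * ((u x).re * reDot X G x)
      = ∫ x, (u x).re * reDot (fun x => V x • X x) G x := by
    congr 1 with x
    simp only [reDot, Finset.mul_sum, PiLp.smul_apply, smul_eq_mul]
    exact Finset.sum_congr rfl fun j _ => by ring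
  rw [h2, h1]
  congr 1
  refine integral_congr_ae ?_
  filter_upwards [ae_ne_zero] with x hx
  have hd := (hVd x hx).differentiableAt one_ne_zero
  -- X is parallel to x, so only the combination x·∇V, assumed bounded, appears rather than ∇V.
  have h3 : fderiv ℝ V x (X x) = θ x * xDotGrad V x := by
    rw [hθ x, map_smul, xDotGrad, smul_eq_mul, real_inner_comm, gradient,
      InnerProductSpace.toDual_symm_apply]
  rw [divergence_smul hd (hX.differentiable one_ne_zero x), h3]

end Weak

/-! ### The Hartree term -/

theorem tendsto_integral_bdd_mul {α : Type*} [MeasurableSpace α] {μ : Measure α} {f : α → ℝ}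
    (hf : Integrable f μ) {m : ℕ → α → ℝ} {m' : α → ℝ} (hm : ∀ n, AEStronglyMeasurable (m n) μ)
    {C : ℝ} (hb : ∀ n x, |m n x| ≤ C)
    (hl : ∀ᵐ x ∂μ, Tendsto (fun n => m n x) atTop (𝓝 (m' x))) :
    Tendsto (fun n => ∫ x, m n x * f x ∂μ) atTop (𝓝 (∫ x, m' x * f x ∂μ)) := by
  refine tendsto_integral_of_dominated_convergence (fun x => C * ‖f x‖) (fun n => (hm n).mul hf.1)
    (hf.norm.const_mul C) (fun n => Eventually.of_forall fun x => ?_) ?_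
  · rw [norm_mul]
    exact mul_le_mul_of_nonneg_right (hb n x) (norm_nonneg _)
  · filter_upwards [hl] with x hx
    exact hx.mul_const _

/-- A smooth approximation of `‖x‖⁻¹`. -/
def regCoulomb (ε : ℝ) (x : Space) : ℝ := (√(‖x‖ ^ 2 + ε ^ 2))⁻¹

section RegCoulomb

variable {ε : ℝ} (hε : 0 < ε)

include hε

theorem contDiff_regCoulomb : ContDiff ℝ 1 (regCoulomb ε) := by
  have h (x : Space) : ‖x‖ ^ 2 + ε ^ 2 ≠ 0 := by positivity
  exact (((contDiff_norm_sq ℝ).add contDiff_const).sqrt h).inv fun x =>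
    (Real.sqrt_pos.2 (by positivity)).ne'

theorem regCoulomb_nonneg (x : Space) : 0 ≤ regCoulomb ε x := by
  unfold regCoulomb; positivity

theorem regCoulomb_le (x : Space) : regCoulomb ε x ≤ ε⁻¹ :=
  inv_anti₀ hε (Real.le_sqrt_of_sq_le (by nlinarith [sq_nonneg ‖x‖]))

theorem norm_mul_regCoulomb_le (x : Space) : ‖x‖ * regCoulomb ε x ≤ 1 := by
  have hs : 0 < √(‖x‖ ^ 2 + ε ^ 2) := Real.sqrt_pos.2 (by positivity)
  rw [regCoulomb, ← div_eq_mul_inv, div_le_one hs]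
  exact Real.le_sqrt_of_sq_le (by nlinarith)

theorem fderiv_regCoulomb (x v : Space) :
    fderiv ℝ (regCoulomb ε) x v = -(inner ℝ x v * regCoulomb ε x ^ 3) := by
  have hs : 0 < √(‖x‖ ^ 2 + ε ^ 2) := Real.sqrt_pos.2 (by positivity)
  have h1 : HasFDerivAt (fun y : Space => ‖y‖ ^ 2 + ε ^ 2) (2 • innerSL ℝ x) x := by
    simpa using ((hasStrictFDerivAt_norm_sq x).hasFDerivAt).add_const (ε ^ 2)
  have h2 : HasDerivAt (fun t => (√t)⁻¹) (-(1 / (2 * √(‖x‖ ^ 2 + ε ^ 2))) / √(‖x‖ ^ 2 + ε ^ 2) ^ 2)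
      (‖x‖ ^ 2 + ε ^ 2) :=
    (Real.hasDerivAt_sqrt (by positivity)).inv hs.ne'
  have h3 : HasFDerivAt (regCoulomb ε) _ x := HasDerivAt.comp_hasFDerivAt (f := fun y : Space =>
    ‖y‖ ^ 2 + ε ^ 2) x h2 h1
  rw [h3.fderiv, regCoulomb]
  simp only [_root_.smul_apply, smul_eq_mul, innerSL_apply_apply, nsmul_eq_mul,
    Nat.cast_ofNat, inv_pow]
  field_simp

end RegCoulomb

theorem tendsto_norm_mul_regCoulomb {x : Space} (hx : x ≠ 0) :
    Tendsto (fun n : ℕ => ‖x‖ * regCoulomb ((n : ℝ) + 1)⁻¹ x) atTop (𝓝 1) := by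
  have h0 : Tendsto (fun n : ℕ => ((n : ℝ) + 1)⁻¹) atTop (𝓝 0) :=
    (tendsto_atTop_add_const_right _ _ tendsto_natCast_atTop_atTop).inv_tendsto_atTop
  have hx' := norm_pos_iff.2 hx
  have hc : ContinuousAt (fun ε : ℝ => ‖x‖ * (√(‖x‖ ^ 2 + ε ^ 2))⁻¹) 0 := by
    have : √(‖x‖ ^ 2 + (0 : ℝ) ^ 2) ≠ 0 := (Real.sqrt_pos.2 (by positivity)).ne'
    fun_prop (disch := exact this)
  have := hc.tendsto.comp h0
  simpa [Function.comp_def, regCoulomb, Real.sqrt_sq hx'.le, hx'.ne'] using this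

theorem ae_fst_ne_snd :
    ∀ᵐ z : Space × Space ∂((volume : Measure Space).prod volume), z.1 - z.2 ≠ 0 := by
  have hs : MeasurableSet {z : Space × Space | z.1 - z.2 = 0} :=
    measurableSet_eq_fun (by fun_prop) (by fun_prop)
  rw [ae_iff]
  simp only [not_not]
  rw [Measure.measure_prod_null hs]
  refine Eventually.of_forall fun x => ?_
  have : Prod.mk x ⁻¹' {z : Space × Space | z.1 - z.2 = 0} = {x} := by
    ext y
    simp [sub_eq_zero, eq_comm]
  simp [this]

section Coulomb

variable {u : L2}

theorem integrable_coulomb_prod (h6 : MemLp u 6 volume) {f : Space → ℝ} (hf : Integrable f) :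
    Integrable (fun z : Space × Space => f z.1 * (‖u z.2‖ ^ 2 / ‖z.1 - z.2‖))
      (volume.prod volume) := by
  have hk : Measurable fun z : Space × Space => ‖z.1 - z.2‖ := by fun_prop
  have hm : AEStronglyMeasurable (fun z : Space × Space => f z.1 * (‖u z.2‖ ^ 2 / ‖z.1 - z.2‖))
      (volume.prod volume) :=
    hf.1.comp_fst.mul
      ((((Lp.aestronglyMeasurable u).norm.pow 2).comp_snd.aemeasurable.div
        hk.aemeasurable).aestronglyMeasurable)
  refine (integrable_prod_iff hm).2 ⟨Eventually.of_forall fun x =>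
    (integrable_hartree (Lp.memLp u) h6 x).const_mul (f x), ?_⟩
  refine (integrable_bdd_mul (memLp_top_hartree (Lp.memLp u) h6) hf.norm).congr
    (Eventually.of_forall fun x => ?_)
  have h (y : Space) : ‖f x * (‖u y‖ ^ 2 / ‖x - y‖)‖ = ‖f x‖ * (‖u y‖ ^ 2 / ‖x - y‖) := by
    rw [norm_mul, Real.norm_of_nonneg (by positivity : 0 ≤ ‖u y‖ ^ 2 / ‖x - y‖)]
  simp only [h, integral_const_mul]
  rw [mul_comm]
  rfl

theorem integral_coulomb_prod (h6 : MemLp u 6 volume) {f : Space → ℝ} (hf : Integrable f) :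
    ∫ z : Space × Space, f z.1 * (‖u z.2‖ ^ 2 / ‖z.1 - z.2‖) ∂(volume.prod volume)
      = ∫ x, hartree u x * f x := by
  rw [integral_prod _ (integrable_coulomb_prod h6 hf)]
  simp only [integral_const_mul]
  simp_rw [mul_comm (f _)]
  rfl

variable {h : L2} {G : Fin 3 → L2} {X : Space → Space}

theorem integrable_mul_tensor {f : Space → ℝ} (hf : Integrable f) {m : Space × Space → ℝ}
    (hm : Continuous m) {C : ℝ} (hC : ∀ z, |m z| ≤ C) :
    Integrable (fun z : Space × Space => m z * (f z.1 * ‖u z.2‖ ^ 2)) (volume.prod volume) :=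
  (hf.mul_prod (integrable_norm_sq u)).bdd_mul (c := C) hm.aestronglyMeasurable
    (Eventually.of_forall hC)

/-- For each y apply `weak_mul_reDot` to the field X times the kernel centred at y, then integrate
over y against |u(y)|². Differentiating the kernel produces ⟨x - y, X(x)⟩ times its cube; exchanging
x and y replaces X(x) by ½(X(x) - X(y)). -/
theorem weak_regCoulomb {ε : ℝ} (hε : 0 < ε) (hG : HasGrad u G) (hh : HasLaplacian u h)
    (hr : ∀ᵐ x, (u x).im = 0) (hX : ContDiff ℝ 1 X) (hXc : HasCompactSupport X) :
    2 * ∫ z : Space × Space, regCoulomb ε (z.1 - z.2) *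
        (((u z.1).re * reDot X G z.1) * ‖u z.2‖ ^ 2) ∂(volume.prod volume)
      = -(∫ z : Space × Space, regCoulomb ε (z.1 - z.2) *
          ((divergence X z.1 * ‖u z.1‖ ^ 2) * ‖u z.2‖ ^ 2) ∂(volume.prod volume))
        + (1 / 2) * ∫ z : Space × Space, (inner ℝ (z.1 - z.2) (X z.1 - X z.2) *
          regCoulomb ε (z.1 - z.2) ^ 3) * (‖u z.1‖ ^ 2 * ‖u z.2‖ ^ 2) ∂(volume.prod volume) := by
  have hk := contDiff_regCoulomb hε
  have hkc := hk.continuous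
  have hXcont := hX.continuous
  have hkb (x : Space) : |regCoulomb ε x| ≤ ε⁻¹ := by
    rw [abs_of_nonneg (regCoulomb_nonneg hε x)]
    exact regCoulomb_le hε x
  obtain ⟨B, hB⟩ := hXc.exists_bound_of_continuous hXcont
  have hgb (z : Space) (v : Space) (hv : ‖v‖ ≤ B) :
      |inner ℝ z v * regCoulomb ε z ^ 3| ≤ B * (ε⁻¹ * ε⁻¹) := by
    have hB0 : 0 ≤ B := (norm_nonneg _).trans hv
    have hk0 := regCoulomb_nonneg hε z
    rw [abs_mul, abs_of_nonneg (by positivity : 0 ≤ regCoulomb ε z ^ 3)]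
    calc |inner ℝ z v| * regCoulomb ε z ^ 3
        ≤ (‖z‖ * ‖v‖) * regCoulomb ε z ^ 3 := by gcongr; exact abs_real_inner_le_norm _ _
      _ = ‖v‖ * ((‖z‖ * regCoulomb ε z) * (regCoulomb ε z * regCoulomb ε z)) := by ring
      _ ≤ B * (1 * (ε⁻¹ * ε⁻¹)) := by
          gcongr
          · exact norm_mul_regCoulomb_le hε z
          · exact regCoulomb_le hε z
          · exact regCoulomb_le hε z
      _ = _ := by ring
  have i0 : Integrable fun x => (u x).re * reDot X G x := by
    simpa using integrable_bdd_mul_re_mul_reDot (memLp_top_const (1 : ℝ)) u hX hXc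
  have iN := integrable_norm_sq u
  have idiv : Integrable fun x => divergence X x * ‖u x‖ ^ 2 :=
    integrable_bdd_mul (memLp_top_divergence hX hXc) iN
  have I1 := integrable_mul_tensor (u := u) i0 (m := fun z => regCoulomb ε (z.1 - z.2))
    (by fun_prop) fun z => hkb _
  have I2 := integrable_mul_tensor (u := u) idiv (m := fun z => regCoulomb ε (z.1 - z.2))
    (by fun_prop) fun z => hkb _
  have I3 := integrable_mul_tensor (u := u) iN
    (m := fun z => inner ℝ (z.1 - z.2) (X z.1) * regCoulomb ε (z.1 - z.2) ^ 3)
    (by fun_prop) fun z => hgb _ _ (hB _)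
  have I4 := integrable_mul_tensor (u := u) iN
    (m := fun z => inner ℝ (z.1 - z.2) (X z.2) * regCoulomb ε (z.1 - z.2) ^ 3)
    (by fun_prop) fun z => hgb _ _ (hB _)
  have sec (y : Space) : 2 * ∫ x, regCoulomb ε (x - y) * (((u x).re * reDot X G x) * ‖u y‖ ^ 2)
      = -∫ x, (regCoulomb ε (x - y) * ((divergence X x * ‖u x‖ ^ 2) * ‖u y‖ ^ 2)
        - (inner ℝ (x - y) (X x) * regCoulomb ε (x - y) ^ 3) * (‖u x‖ ^ 2 * ‖u y‖ ^ 2)) := by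
    have hY : ContDiff ℝ 1 fun x => regCoulomb ε (x - y) • X x :=
      (hk.comp (contDiff_id.sub contDiff_const)).smul hX
    have hYc : HasCompactSupport fun x => regCoulomb ε (x - y) • X x :=
      hXc.smul_left (f := fun x => regCoulomb ε (x - y))
    have h1 := congrArg (· * ‖u y‖ ^ 2) (weak_mul_reDot hG hh hr hY hYc)
    simp only [mul_assoc, neg_mul, ← integral_mul_const] at h1
    refine Eq.trans ?_ (h1.trans ?_)
    · congr 2 with x
      simp only [reDot, Finset.mul_sum, Finset.sum_mul, PiLp.smul_apply, smul_eq_mul]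
      exact Finset.sum_congr rfl fun j _ => by ring
    · congr 2 with x
      have hd : DifferentiableAt ℝ (fun x => regCoulomb ε (x - y)) x :=
        (hk.comp (contDiff_id.sub contDiff_const)).differentiable one_ne_zero x
      rw [divergence_smul hd (hX.differentiable one_ne_zero x),
        fderiv_comp_sub, fderiv_regCoulomb hε]
      ring
  have swap : ∫ z : Space × Space, (inner ℝ (z.1 - z.2) (X z.2) * regCoulomb ε (z.1 - z.2) ^ 3) *
      (‖u z.1‖ ^ 2 * ‖u z.2‖ ^ 2) ∂(volume.prod volume)
      = -∫ z : Space × Space, (inner ℝ (z.1 - z.2) (X z.1) * regCoulomb ε (z.1 - z.2) ^ 3) *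
      (‖u z.1‖ ^ 2 * ‖u z.2‖ ^ 2) ∂(volume.prod volume) := by
    rw [← integral_prod_swap, ← integral_neg]
    congr 1 with z
    have h1 : z.2 - z.1 = -(z.1 - z.2) := by abel
    simp only [Prod.fst_swap, Prod.snd_swap, h1, inner_neg_left, regCoulomb, norm_neg]
    ring
  have e1 : 2 * ∫ z : Space × Space, regCoulomb ε (z.1 - z.2) *
        (((u z.1).re * reDot X G z.1) * ‖u z.2‖ ^ 2) ∂(volume.prod volume)
      = -((∫ z : Space × Space, regCoulomb ε (z.1 - z.2) *
          ((divergence X z.1 * ‖u z.1‖ ^ 2) * ‖u z.2‖ ^ 2) ∂(volume.prod volume))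
        - ∫ z : Space × Space, (inner ℝ (z.1 - z.2) (X z.1) *
          regCoulomb ε (z.1 - z.2) ^ 3) * (‖u z.1‖ ^ 2 * ‖u z.2‖ ^ 2) ∂(volume.prod volume)) := by
    have I23 := I2.sub I3
    simp only [Pi.sub_def] at I23
    rw [← integral_sub I2 I3, integral_prod_symm _ I1, integral_prod_symm _ I23,
      ← integral_const_mul, ← integral_neg]
    congr 1 with y
    exact sec y
  have e2 : ∫ z : Space × Space, (inner ℝ (z.1 - z.2) (X z.1 - X z.2) *
          regCoulomb ε (z.1 - z.2) ^ 3) * (‖u z.1‖ ^ 2 * ‖u z.2‖ ^ 2) ∂(volume.prod volume)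
      = 2 * ∫ z : Space × Space, (inner ℝ (z.1 - z.2) (X z.1) * regCoulomb ε (z.1 - z.2) ^ 3) *
      (‖u z.1‖ ^ 2 * ‖u z.2‖ ^ 2) ∂(volume.prod volume) := by
    rw [two_mul]
    nth_rewrite 2 [← neg_neg (∫ z : Space × Space, (inner ℝ (z.1 - z.2) (X z.1) *
      regCoulomb ε (z.1 - z.2) ^ 3) * (‖u z.1‖ ^ 2 * ‖u z.2‖ ^ 2) ∂(volume.prod volume))]
    rw [← swap, ← sub_eq_add_neg, ← integral_sub I3 I4]
    congr 1 with z
    rw [inner_sub_right]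
    ring
  rw [e1, e2]
  ring

/-- The limit ε → 0. Because X is Lipschitz, the symmetrised term is no more singular than |x -
y|⁻¹, which is integrable against |u(x)|²|u(y)|², so dominated convergence applies. -/
theorem weak_hartree (h6 : MemLp u 6 volume) (hG : HasGrad u G) (hh : HasLaplacian u h)
    (hr : ∀ᵐ x, (u x).im = 0) (hX : ContDiff ℝ 1 X) (hXc : HasCompactSupport X) {L : ℝ}
    (hL : ∀ x y, ‖X x - X y‖ ≤ L * ‖x - y‖) :
    2 * ∫ x, hartree u x * ((u x).re * reDot X G x)
      = -(∫ x, hartree u x * (divergence X x * ‖u x‖ ^ 2))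
        + (1 / 2) * ∫ z : Space × Space, (inner ℝ (z.1 - z.2) (X z.1 - X z.2) / ‖z.1 - z.2‖ ^ 2) *
          (‖u z.1‖ ^ 2 * (‖u z.2‖ ^ 2 / ‖z.1 - z.2‖)) ∂(volume.prod volume) := by
  have hXcont := hX.continuous
  have hε (n : ℕ) : 0 < ((n : ℝ) + 1)⁻¹ := by positivity
  have hkc (n : ℕ) := (contDiff_regCoulomb (hε n)).continuous
  have i0 : Integrable fun x => (u x).re * reDot X G x := by
    simpa using integrable_bdd_mul_re_mul_reDot (memLp_top_const (1 : ℝ)) u hX hXc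
  have iN := integrable_norm_sq u
  have idiv : Integrable fun x => divergence X x * ‖u x‖ ^ 2 :=
    integrable_bdd_mul (memLp_top_divergence hX hXc) iN
  -- Off the diagonal the regularised kernel equals m/|x - y| with 0 ≤ m ≤ 1 and m → 1; its cube
  -- gives m³/|x - y|³.
  let m : ℕ → Space × Space → ℝ := fun n z =>
    ‖z.1 - z.2‖ * regCoulomb ((n : ℝ) + 1)⁻¹ (z.1 - z.2)
  have hm0 (n : ℕ) (z : Space × Space) : 0 ≤ m n z :=
    mul_nonneg (norm_nonneg _) (regCoulomb_nonneg (hε n) _)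
  have hm1 (n : ℕ) (z : Space × Space) : m n z ≤ 1 := norm_mul_regCoulomb_le (hε n) _
  have hmc (n : ℕ) : Continuous (m n) := by
    have := hkc n
    fun_prop
  have hml : ∀ᵐ z ∂((volume : Measure Space).prod volume), Tendsto (fun n => m n z) atTop (𝓝 1) := by
    filter_upwards [ae_fst_ne_snd] with z hz
    exact tendsto_norm_mul_regCoulomb hz
  have lim {f : Space → ℝ} (hf : Integrable f) :
      Tendsto (fun n : ℕ => ∫ z : Space × Space, regCoulomb ((n : ℝ) + 1)⁻¹ (z.1 - z.2) *
        (f z.1 * ‖u z.2‖ ^ 2) ∂(volume.prod volume)) atTop (𝓝 (∫ x, hartree u x * f x)) := by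
    have := tendsto_integral_bdd_mul (integrable_coulomb_prod h6 hf) (m := m) (m' := fun _ => 1)
      (fun n => (hmc n).aestronglyMeasurable) (C := 1)
      (fun n z => by rw [abs_of_nonneg (hm0 n z)]; exact hm1 n z) hml
    simp only [one_mul] at this
    rw [integral_coulomb_prod h6 hf] at this
    refine this.congr fun n => integral_congr_ae ?_
    filter_upwards [ae_fst_ne_snd] with z hz
    have := norm_ne_zero_iff.2 hz
    simp only [m]
    field_simp
  have lim3 : Tendsto (fun n : ℕ => ∫ z : Space × Space, (inner ℝ (z.1 - z.2) (X z.1 - X z.2) *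
      regCoulomb ((n : ℝ) + 1)⁻¹ (z.1 - z.2) ^ 3) * (‖u z.1‖ ^ 2 * ‖u z.2‖ ^ 2)
        ∂(volume.prod volume)) atTop
      (𝓝 (∫ z : Space × Space, (inner ℝ (z.1 - z.2) (X z.1 - X z.2) / ‖z.1 - z.2‖ ^ 2) *
          (‖u z.1‖ ^ 2 * (‖u z.2‖ ^ 2 / ‖z.1 - z.2‖)) ∂(volume.prod volume))) := by
    have hq (z : Space × Space) :
        |inner ℝ (z.1 - z.2) (X z.1 - X z.2) / ‖z.1 - z.2‖ ^ 2| ≤ |L| := by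
      rw [abs_div, abs_of_nonneg (by positivity : 0 ≤ ‖z.1 - z.2‖ ^ 2)]
      refine div_le_of_le_mul₀ (by positivity) (abs_nonneg _) ?_
      calc |inner ℝ (z.1 - z.2) (X z.1 - X z.2)| ≤ ‖z.1 - z.2‖ * ‖X z.1 - X z.2‖ :=
            abs_real_inner_le_norm _ _
        _ ≤ ‖z.1 - z.2‖ * (|L| * ‖z.1 - z.2‖) := by
            gcongr
            exact (hL _ _).trans (by gcongr; exact le_abs_self L)
        _ = _ := by ring
    have hmeas : Measurable fun z : Space × Space =>
        inner ℝ (z.1 - z.2) (X z.1 - X z.2) / ‖z.1 - z.2‖ ^ 2 := by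
      refine Measurable.div ?_ ?_
      · exact Continuous.measurable (by fun_prop)
      · exact Continuous.measurable (by fun_prop)
    have := tendsto_integral_bdd_mul (integrable_coulomb_prod h6 iN)
      (m := fun n z => inner ℝ (z.1 - z.2) (X z.1 - X z.2) / ‖z.1 - z.2‖ ^ 2 * m n z ^ 3)
      (m' := fun z => inner ℝ (z.1 - z.2) (X z.1 - X z.2) / ‖z.1 - z.2‖ ^ 2)
      (fun n => (hmeas.mul ((hmc n).pow 3).measurable).aestronglyMeasurable) (C := |L|)
      (fun n z => by
        rw [abs_mul, abs_of_nonneg (pow_nonneg (hm0 n z) 3)]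
        exact (mul_le_of_le_one_right (abs_nonneg _)
          (pow_le_one₀ (hm0 n z) (hm1 n z))).trans (hq z)) (by
        filter_upwards [hml] with z hz
        simpa using (hz.pow 3).const_mul (inner ℝ (z.1 - z.2) (X z.1 - X z.2) / ‖z.1 - z.2‖ ^ 2))
    refine this.congr fun n => integral_congr_ae ?_
    filter_upwards [ae_fst_ne_snd] with z hz
    have := norm_ne_zero_iff.2 hz
    simp only [m]
    field_simp
  exact tendsto_nhds_unique ((lim i0).const_mul 2)
    (((lim idiv).neg.add (lim3.const_mul (1 / 2))).congr fun n =>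
      (weak_regCoulomb (hε n) hG hh hr hX hXc).symm)

end Coulomb

/-! ### The virial identities -/

section Limits

variable {f : Space → ℝ}

theorem tendsto_integral_fderiv_dilField (hf : Integrable f) (i j : Fin 3) :
    Tendsto (fun n => ∫ x, (fderiv ℝ (dilField n) x (e i)) j * f x) atTop
      (𝓝 (∫ x, (e i) j * f x)) := by
  obtain ⟨C, hC⟩ := exists_norm_fderiv_dilField_le
  refine tendsto_integral_bdd_mul hf (fun n =>
    (memLp_top_fderiv_coord (contDiff_dilField n) (hasCompactSupport_dilField n) i j).1)
    (C := C) (fun n x => ?_) ?_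
  · have h1 := (PiLp.norm_apply_le (fderiv ℝ (dilField n) x (e i)) j)
    have h2 := (fderiv ℝ (dilField n) x).le_opNorm (e i)
    have h3 : ‖e i‖ = 1 := by simp
    rw [h3, mul_one] at h2
    exact (h1.trans h2).trans (hC n x)
  · filter_upwards [ae_ne_zero] with x hx
    have hc : Continuous fun T : Space →L[ℝ] Space => (T (e i)) j := by fun_prop
    exact (hc.tendsto _).comp (tendsto_fderiv_dilField hx)

theorem tendsto_integral_divergence_dilField (hf : Integrable f) :
    Tendsto (fun n => ∫ x, divergence (dilField n) x * f x) atTop (𝓝 (3 * ∫ x, f x)) := by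
  have h := tendsto_finsetSum Finset.univ fun j (_ : j ∈ Finset.univ) =>
    tendsto_integral_fderiv_dilField hf j j
  have h1 : ∑ j : Fin 3, ∫ x, (e j) j * f x = 3 * ∫ x, f x := by simp
  rw [h1] at h
  refine h.congr fun n => ?_
  rw [← integral_finsetSum _ fun j _ => integrable_bdd_mul
    (memLp_top_fderiv_coord (contDiff_dilField n) (hasCompactSupport_dilField n) j j) hf]
  simp only [divergence, Finset.sum_mul]

theorem tendsto_integral_dilCutoff (hf : Integrable f) :
    Tendsto (fun n => ∫ x, dilCutoff n x * f x) atTop (𝓝 (∫ x, f x)) := by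
  have := tendsto_integral_bdd_mul hf (m' := fun _ => 1)
    (fun n => (continuous_dilCutoff n).aestronglyMeasurable) abs_dilCutoff_le
    (ae_ne_zero.mono fun x hx => tendsto_dilCutoff hx)
  simpa only [one_mul] using this

/-- For the limiting field X(x) = x the quotient is identically 1 off the diagonal. -/
theorem tendsto_integral_inner_dilField {f : Space × Space → ℝ}
    (hf : Integrable f (volume.prod volume)) :
    Tendsto (fun n => ∫ z : Space × Space,
      (inner ℝ (z.1 - z.2) (dilField n z.1 - dilField n z.2) / ‖z.1 - z.2‖ ^ 2) * f z
        ∂(volume.prod volume)) atTop (𝓝 (∫ z, f z ∂(volume.prod volume))) := by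
  obtain ⟨C, hC⟩ := exists_norm_fderiv_dilField_le
  have hmeas (n : ℕ) : Measurable fun z : Space × Space =>
      inner ℝ (z.1 - z.2) (dilField n z.1 - dilField n z.2) / ‖z.1 - z.2‖ ^ 2 := by
    have := (contDiff_dilField n).continuous
    exact Measurable.div (Continuous.measurable (by fun_prop)) (Continuous.measurable (by fun_prop))
  have := tendsto_integral_bdd_mul hf (m' := fun _ => 1)
    (fun n => (hmeas n).aestronglyMeasurable) (C := C) (fun n z => ?_) ?_
  · simpa only [one_mul] using this
  · rw [abs_div, abs_of_nonneg (by positivity : 0 ≤ ‖z.1 - z.2‖ ^ 2)]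
    refine div_le_of_le_mul₀ (by positivity) C.coe_nonneg ?_
    calc |inner ℝ (z.1 - z.2) (dilField n z.1 - dilField n z.2)|
        ≤ ‖z.1 - z.2‖ * ‖dilField n z.1 - dilField n z.2‖ := abs_real_inner_le_norm _ _
      _ ≤ ‖z.1 - z.2‖ * (C * ‖z.1 - z.2‖) := by
          gcongr
          exact norm_dilField_sub_le hC n _ _
      _ = _ := by ring
  · filter_upwards [ae_fst_ne_snd, Measure.quasiMeasurePreserving_fst.ae ae_ne_zero,
      Measure.quasiMeasurePreserving_snd.ae ae_ne_zero] with z hz h1 h2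
    have hc := ((tendsto_const_nhds (x := z.1 - z.2)).inner (𝕜 := ℝ)
      ((tendsto_dilField h1).sub (tendsto_dilField h2))).div_const (‖z.1 - z.2‖ ^ 2)
    rw [real_inner_self_eq_norm_sq, div_self (pow_ne_zero 2 (norm_ne_zero_iff.2 hz))] at hc
    exact hc

end Limits

variable {V : Space → ℝ} {E : ℝ} {u : L2} {G : Fin 3 → L2}

theorem IsBoundState.exists_laplacian (hu : IsBoundState V E u) : ∃ h : L2, HasLaplacian u h ∧
    ∀ᵐ x, h x = ((E + V x - hartree u x : ℝ) : ℂ) * u x := by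
  obtain ⟨h, hh, heq⟩ := hu.equation
  refine ⟨h, hh, ?_⟩
  filter_upwards [heq] with x hx
  rw [coulombConv_norm_sq] at hx
  push_cast
  linear_combination -hx

theorem IsBoundState.energy_identity (hV : IsPotential V) (hu : IsBoundState V E u)
    (h6 : MemLp u 6 volume) (hG : HasGrad u G) :
    gradSq G = -(E * ∫ x, ‖u x‖ ^ 2) - (∫ x, V x * ‖u x‖ ^ 2) + ∫ x, hartree u x * ‖u x‖ ^ 2 := by
  obtain ⟨h, hh, heq⟩ := hu.exists_laplacian
  have hr := hu.real
  have hhr : ∀ᵐ x, (h x).im = 0 := by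
    filter_upwards [heq, hr] with x h1 h2
    rw [h1, Complex.im_ofReal_mul, h2, mul_zero]
  have iN := integrable_norm_sq u
  have iV := integrable_bdd_mul hV.memLp_top iN
  have iH := integrable_bdd_mul (memLp_top_hartree (Lp.memLp u) h6) iN
  have h1 := weak_laplacian_mul_re hG hh hr hhr
  have h2 : ∫ x, (h x).re * (u x).re
      = ∫ x, (E * ‖u x‖ ^ 2 + V x * ‖u x‖ ^ 2 - hartree u x * ‖u x‖ ^ 2) := by
    refine integral_congr_ae ?_
    filter_upwards [heq, hr] with x h1 h2
    have h3 : ‖u x‖ ^ 2 = (u x).re * (u x).re := by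
      rw [← Complex.normSq_eq_norm_sq, Complex.normSq_apply, h2]
      ring
    rw [h1, Complex.re_ofReal_mul, h3]
    ring
  have i1 : Integrable fun x => E * ‖u x‖ ^ 2 + V x * ‖u x‖ ^ 2 := (iN.const_mul E).add iV
  rw [h2, integral_sub i1 iH, integral_add (iN.const_mul E) iV, integral_const_mul] at h1
  linarith

/-- The Pohozaev identity. In the limit the fields have derivative the identity and divergence 3:
the gradient terms give -1 + 3/2 = 1/2, and the Hartree terms give 3/2 - 1/4 = 5/4. -/
theorem IsBoundState.dilation_identity (hV : IsPotential V) (hu : IsBoundState V E u)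
    (h6 : MemLp u 6 volume) (hG : HasGrad u G) :
    (1 / 2) * gradSq G = -(3 / 2) * (E * ∫ x, ‖u x‖ ^ 2) - (3 / 2) * (∫ x, V x * ‖u x‖ ^ 2)
      - (1 / 2) * (∫ x, xDotGrad V x * ‖u x‖ ^ 2)
      + (5 / 4) * ∫ x, hartree u x * ‖u x‖ ^ 2 := by
  obtain ⟨h, hh, heq⟩ := hu.exists_laplacian
  have hr := hu.real
  have hhr : ∀ᵐ x, (h x).im = 0 := by
    filter_upwards [heq, hr] with x h1 h2
    rw [h1, Complex.im_ofReal_mul, h2, mul_zero]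
  have iN := integrable_norm_sq u
  have hφ := memLp_top_hartree (Lp.memLp u) h6
  have iV := integrable_bdd_mul hV.memLp_top iN
  have iQ := integrable_bdd_mul hV.xDotGrad_memLp_top iN
  have iH := integrable_bdd_mul hφ iN
  have iD := integrable_coulomb_prod h6 iN
  obtain ⟨C, hC⟩ := exists_norm_fderiv_dilField_le
  -- The equation tested with the truncated dilation; all boundary and singularity issues are absent
  -- here, and every term has a limit by dominated convergence.
  have fixed (n : ℕ) :
      -(∑ j, ∑ i, ∫ x, (fderiv ℝ (dilField n) x (e i)) j * ((G i x).re * (G j x).re))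
        + (1 / 2) * ∑ i, ∫ x, divergence (dilField n) x * ‖G i x‖ ^ 2
      = -(1 / 2) * (E * ∫ x, divergence (dilField n) x * ‖u x‖ ^ 2)
        - (1 / 2) * (∫ x, divergence (dilField n) x * (V x * ‖u x‖ ^ 2))
        - (1 / 2) * (∫ x, dilCutoff n x * (xDotGrad V x * ‖u x‖ ^ 2))
        + (1 / 2) * (∫ x, divergence (dilField n) x * (hartree u x * ‖u x‖ ^ 2))
        - (1 / 4) * ∫ z : Space × Space,
          (inner ℝ (z.1 - z.2) (dilField n z.1 - dilField n z.2) / ‖z.1 - z.2‖ ^ 2) *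
          (‖u z.1‖ ^ 2 * (‖u z.2‖ ^ 2 / ‖z.1 - z.2‖)) ∂(volume.prod volume) := by
    have hX := contDiff_dilField n
    have hXc := hasCompactSupport_dilField n
    have hdiv := memLp_top_divergence hX hXc
    have i0 : Integrable fun x => (u x).re * reDot (dilField n) G x := by
      simpa using integrable_bdd_mul_re_mul_reDot (memLp_top_const (1 : ℝ)) u hX hXc
    have i1 := integrable_bdd_mul hV.memLp_top i0
    have i2 := integrable_bdd_mul hφ i0
    have a0 := weak_laplacian_mul_reDot hG hh hr hhr hX hXc
    have a1 := weak_mul_reDot hG hh hr hX hXc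
    have a2 := weak_potential hG hh hr hV.contDiffOn hX hXc (dilField_eventuallyEq_zero n)
      (dilField_eq n)
    have a3 := weak_hartree h6 hG hh hr hX hXc (norm_dilField_sub_le hC n)
    have b0 : ∫ x, (h x).re * reDot (dilField n) G x
        = E * (∫ x, (u x).re * reDot (dilField n) G x)
          + (∫ x, V x * ((u x).re * reDot (dilField n) G x))
          - ∫ x, hartree u x * ((u x).re * reDot (dilField n) G x) := by
      have i3 : Integrable fun x => E * ((u x).re * reDot (dilField n) G x)
          + V x * ((u x).re * reDot (dilField n) G x) := (i0.const_mul E).add i1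
      rw [← integral_const_mul, ← integral_add (i0.const_mul E) i1, ← integral_sub i3 i2]
      refine integral_congr_ae ?_
      filter_upwards [heq] with x h1
      rw [h1, Complex.re_ofReal_mul]
      ring
    have b1 : ∫ x, (V x * divergence (dilField n) x + dilCutoff n x * xDotGrad V x) * ‖u x‖ ^ 2
        = (∫ x, divergence (dilField n) x * (V x * ‖u x‖ ^ 2))
          + ∫ x, dilCutoff n x * (xDotGrad V x * ‖u x‖ ^ 2) := by
      have hθ : MemLp (dilCutoff n) ∞ volume := memLp_top_of_bound
        (continuous_dilCutoff n).aestronglyMeasurable 1 (Eventually.of_forall (abs_dilCutoff_le n))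
      rw [← integral_add (integrable_bdd_mul hdiv iV) (integrable_bdd_mul hθ iQ)]
      congr 1 with x
      ring
    have b2 : ∫ x, hartree u x * (divergence (dilField n) x * ‖u x‖ ^ 2)
        = ∫ x, divergence (dilField n) x * (hartree u x * ‖u x‖ ^ 2) := by
      congr 1 with x
      ring
    rw [← a0, b0]
    rw [b1] at a2
    rw [b2] at a3
    linear_combination (E / 2) * a1 + (1 / 2) * a2 - (1 / 2) * a3
  have l1 := tendsto_finsetSum Finset.univ fun j (_ : j ∈ Finset.univ) =>
    tendsto_finsetSum Finset.univ fun i (_ : i ∈ Finset.univ) =>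
      tendsto_integral_fderiv_dilField (integrable_re_mul_re (G i) (G j)) i j
  have l2 := tendsto_finsetSum Finset.univ fun i (_ : i ∈ Finset.univ) =>
    tendsto_integral_divergence_dilField (integrable_norm_sq (G i))
  have key := tendsto_nhds_unique ((l1.neg.add (l2.const_mul (1 / 2))).congr fixed)
    (((((((tendsto_integral_divergence_dilField iN).const_mul E).const_mul (-(1 / 2))).sub
      ((tendsto_integral_divergence_dilField iV).const_mul (1 / 2))).sub
      ((tendsto_integral_dilCutoff iQ).const_mul (1 / 2))).add
      ((tendsto_integral_divergence_dilField iH).const_mul (1 / 2))).sub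
      ((tendsto_integral_inner_dilField iD).const_mul (1 / 4)))
  rw [integral_coulomb_prod h6 iN] at key
  have c1 : ∑ j : Fin 3, ∑ i : Fin 3, ∫ x, (e i) j * ((G i x).re * (G j x).re) = gradSq G := by
    rw [gradSq, integral_finsetSum _ fun i _ => integrable_norm_sq (G i)]
    refine Finset.sum_congr rfl fun j _ => ?_
    rw [Finset.sum_eq_single j]
    · refine integral_congr_ae ?_
      filter_upwards [hG.ae_im_eq_zero hr j] with x hx
      rw [← Complex.normSq_eq_norm_sq, Complex.normSq_apply, hx]
      simp
    · intro i _ hij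
      simp [hij.symm]
    · simp
  have c2 : ∑ i : Fin 3, 3 * ∫ x, ‖G i x‖ ^ 2 = 3 * gradSq G := by
    rw [gradSq, integral_finsetSum _ fun i _ => integrable_norm_sq (G i), Finset.mul_sum]
  rw [c1, c2] at key
  linarith

/-- 3/2 times the energy identity minus the dilation identity: both E and V drop out. This makes the
zero-mass limit uniform in E. -/
theorem IsBoundState.gradSq_eq_hartree (hV : IsPotential V) (hu : IsBoundState V E u)
    (h6 : MemLp u 6 volume) (hG : HasGrad u G) :
    gradSq G = (1 / 4) * (∫ x, hartree u x * ‖u x‖ ^ 2)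
      + (1 / 2) * ∫ x, xDotGrad V x * ‖u x‖ ^ 2 := by
  linarith [hu.energy_identity hV h6 hG, hu.dilation_identity hV h6 hG]

/-- 5/4 times the energy identity minus the dilation identity: the Hartree term drops out. -/
theorem IsBoundState.virial_identity (hV : IsPotential V) (hu : IsBoundState V E u)
    (h6 : MemLp u 6 volume) (hG : HasGrad u G) :
    gradSq G = (1 / 3) * E * (∫ x, ‖u x‖ ^ 2) + (1 / 3) * (∫ x, V x * ‖u x‖ ^ 2)
      + (2 / 3) * (∫ x, xDotGrad V x * ‖u x‖ ^ 2) := by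
  linarith [hu.energy_identity hV h6 hG, hu.dilation_identity hV h6 hG]

/-! ### Bounds on the growth rates -/

theorem exists_exchangeNorm_le : ∃ C : ℝ≥0, ∀ u : L2, MemLp u 3 volume →
    exchangeNorm u ≠ ∞ ∧ (exchangeNorm u).toReal ≤ C * L3norm u ^ 2 := by
  obtain ⟨C, hC⟩ := exists_riesz_le
  refine ⟨C, fun u h3 => ?_⟩
  have h : exchangeNorm u ≤ C * eLpNorm u 3 volume ^ 2 := by
    refine (ENNReal.rpow_le_rpow (hC u h3) (by norm_num : (0 : ℝ) ≤ 1 / 2)).trans_eq ?_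
    rw [← ENNReal.rpow_natCast, ← ENNReal.rpow_mul]
    norm_num
  have hfin : C * eLpNorm u 3 volume ^ 2 ≠ ∞ :=
    ENNReal.mul_ne_top ENNReal.coe_ne_top (ENNReal.pow_ne_top h3.2.ne)
  refine ⟨ne_top_of_le_ne_top hfin h, ?_⟩
  simpa [L3norm] using ENNReal.toReal_mono hfin h

theorem gradNorm_nonneg (G : Fin 3 → L2) : 0 ≤ gradNorm G := Real.sqrt_nonneg _

theorem gradNorm_sq (G : Fin 3 → L2) : gradNorm G ^ 2 = gradSq G := Real.sq_sqrt (gradSq_nonneg G)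

theorem memLp_six {C : ℝ} (hC : IsGNConstant C) {u : L2} {G : Fin 3 → L2}
    (hu : MemSobolev 1 2 (u : 𝓢'(Space, ℂ))) (hG : HasGrad u G) :
    MemLp u 6 volume :=
  ⟨Lp.aestronglyMeasurable u, (hC u G hu hG).trans_lt ENNReal.ofReal_lt_top⟩

section GagliardoNirenberg

variable {C : ℝ} (hC0 : 0 < C) (hC : IsGNConstant C) {u : L2} {G : Fin 3 → L2}

include hC0 hC

theorem eLpNorm_three_sq_le_gradNorm (hu : MemSobolev 1 2 (u : 𝓢'(Space, ℂ))) (hG : HasGrad u G) :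
    eLpNorm u 3 volume ^ 2 ≤ ENNReal.ofReal (C * gradNorm G * ‖u‖) := by
  have h2 : eLpNorm u 2 volume = ENNReal.ofReal ‖u‖ := by
    rw [Lp.norm_def, ENNReal.ofReal_toReal (Lp.eLpNorm_ne_top u)]
  rw [ENNReal.ofReal_mul (mul_nonneg hC0.le (gradNorm_nonneg G)), mul_comm, ← h2]
  exact (eLpNorm_three_sq_le (Lp.aestronglyMeasurable u)).trans (mul_le_mul_right (hC u G hu hG) _)

theorem memLp_three (hu : MemSobolev 1 2 (u : 𝓢'(Space, ℂ))) (hG : HasGrad u G) : MemLp u 3 volume := by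
  refine ⟨Lp.aestronglyMeasurable u, lt_top_iff_ne_top.2 fun h => ?_⟩
  have := eLpNorm_three_sq_le_gradNorm hC0 hC hu hG
  rw [h, ENNReal.top_pow two_ne_zero] at this
  exact ENNReal.ofReal_ne_top (top_le_iff.1 this)

theorem L3norm_sq_le (hu : MemSobolev 1 2 (u : 𝓢'(Space, ℂ))) (hG : HasGrad u G) :
    L3norm u ^ 2 ≤ C * gradNorm G * ‖u‖ := by
  have h := ENNReal.toReal_mono ENNReal.ofReal_ne_top (eLpNorm_three_sq_le_gradNorm hC0 hC hu hG)
  rwa [ENNReal.toReal_pow, ENNReal.toReal_ofReal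
    (mul_nonneg (mul_nonneg hC0.le (gradNorm_nonneg G)) (norm_nonneg u))] at h

end GagliardoNirenberg

theorem integral_mul_norm_sq_le {m : Space → ℝ} (hm : MemLp m ∞ volume) (u : L2) :
    ∫ x, m x * ‖u x‖ ^ 2 ≤ supNorm m * ‖u‖ ^ 2 := by
  rw [norm_sq_eq_integral, ← integral_const_mul]
  refine integral_mono_ae (integrable_bdd_mul hm (integrable_norm_sq u))
    ((integrable_norm_sq u).const_mul _) ?_
  have h := ae_le_eLpNormEssSup (f := m) (μ := volume)
  filter_upwards [h] with x hx
  rw [← eLpNorm_exponent_top] at hx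
  have := ENNReal.toReal_mono hm.2.ne hx
  rw [toReal_enorm] at this
  exact mul_le_mul_of_nonneg_right ((le_abs_self _).trans this) (by positivity)

/-- For real u the Hartree energy is ⟨u, Wu⟩, so the bound on the exchange operator controls it too.
-/
theorem integral_hartree_le {u : L2} (hr : ∀ᵐ x, (u x).im = 0) (hU : exchangeNorm u ≠ ∞) :
    ∫ x, hartree u x * ‖u x‖ ^ 2 ≤ (exchangeNorm u).toReal * ‖u‖ ^ 2 := by
  have h1 : inner ℂ u (exchangeOp u hU u) = ((∫ x, hartree u x * ‖u x‖ ^ 2 : ℝ) : ℂ) := by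
    rw [L2.inner_def]
    refine Eq.trans (integral_congr_ae ?_) integral_complex_ofReal
    have hc : coulombConv (fun y => u y * u y) = coulombConv (fun y => (‖u y‖ : ℂ) ^ 2) :=
      coulombConv_congr_ae (hr.mono fun y hy => by
        exact (mul_self_eq_norm_sq hy).trans (by push_cast; rfl))
    filter_upwards [coeFn_exchangeOp u hU u] with x hx
    rw [hx, RCLike.inner_apply, exchangeFun, hc, coulombConv_norm_sq, mul_assoc, RCLike.mul_conj]
    push_cast
    rfl
  have h2 : ‖inner ℂ u (exchangeOp u hU u)‖ ≤ ‖u‖ * ((exchangeNorm u).toReal * ‖u‖) :=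
    (norm_inner_le_norm _ _).trans (by
      gcongr
      exact ((exchangeOp u hU).le_opNorm u).trans (by gcongr; exact norm_exchangeOp_le u hU))
  rw [h1, Complex.norm_real] at h2
  exact (le_abs_self _).trans (h2.trans_eq (by ring))

/-- A negative S forces M = 0 because k² ≥ 0; the bound is then z ≤ 0, consistent with the
convention that `√` of a negative number is 0. -/
theorem abs_re_le_sqrt {C k M S z : ℝ} (hC : 0 ≤ C) (hM : 0 ≤ M)
    (hz : z ≤ C * k * M) (hS : k ^ 2 ≤ S * M ^ 2) : z ≤ C * M ^ 2 * √S := by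
  rcases hM.eq_or_lt with rfl | hM'
  · simpa using hz
  · have hS0 : 0 ≤ S := by
      by_contra! h
      nlinarith [mul_neg_of_neg_of_pos h (pow_pos hM' 2), sq_nonneg k]
    have h1 : k ≤ √S * M := by
      refine le_of_sq_le_sq ?_ (by positivity)
      rwa [mul_pow, Real.sq_sqrt hS0]
    calc z ≤ C * k * M := hz
      _ ≤ C * (√S * M) * M := by gcongr
      _ = _ := by ring

/-- Applied with k = ‖∇u‖ and M = ‖u‖: the term linear in k is absorbed by completing the square,
and M ≤ 1 turns M⁶ into M². -/
theorem le_of_sq_le_cubic {C k M q : ℝ} (hC : 0 ≤ C) (hq : 0 ≤ q) (hM : 0 ≤ M)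
    (hM1 : M ≤ 1) (h : k ^ 2 ≤ (1 / 4) * (C * k * M * M ^ 2) + (1 / 2) * (q * M ^ 2)) :
    k ≤ (C + q + 1) * M := by
  refine le_of_sq_le_sq ?_ (by positivity)
  have h1 : M ^ 4 ≤ 1 := pow_le_one₀ hM hM1
  have h2 : (C * M ^ 3) ^ 2 ≤ C ^ 2 * M ^ 2 := by
    calc (C * M ^ 3) ^ 2 = C ^ 2 * M ^ 2 * M ^ 4 := by ring
      _ ≤ C ^ 2 * M ^ 2 * 1 := by gcongr
      _ = _ := by ring
  have h3 : k ^ 2 ≤ (C ^ 2 + q) * M ^ 2 := by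
    nlinarith [sq_nonneg (k - (1 / 4) * (C * M ^ 3)), sq_nonneg (C * M), mul_nonneg hq (sq_nonneg M)]
  refine h3.trans ?_
  rw [mul_pow]
  gcongr
  nlinarith [mul_nonneg hC hq, sq_nonneg q]

end SchrodingerPoisson

end

/-! ### Choice of constants and the zero-mass limit -/

open SchrodingerPoisson in
theorem mainTheorem6 :
    ∃ C_HLS C_GN : ℝ, 0 < C_HLS ∧ 0 < C_GN ∧ IsHLSConstant C_HLS ∧ IsGNConstant C_GN ∧
      ∀ V : Space → ℝ, IsPotential V →
        (∀ (E : ℝ) (u : L2) (G : Fin 3 → L2), IsBoundState V E u → HasGrad u G →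
          MemLp u 3 volume ∧
          eigenvaluesJL V E u ⊆ spectrumJL V E u ∧
          (∀ z ∈ spectrumJL V E u, |z.re| ≤ C_HLS * L3norm u ^ 2) ∧
          C_HLS * L3norm u ^ 2 ≤ C_HLS * C_GN * gradNorm G * ‖u‖ ∧
          gradSq G = (1 / 3) * E * (∫ x, ‖u x‖ ^ 2) + (1 / 3) * (∫ x, V x * ‖u x‖ ^ 2)
            + (2 / 3) * (∫ x, xDotGrad V x * ‖u x‖ ^ 2) ∧
          (∀ z ∈ spectrumJL V E u, |z.re| ≤ C_HLS * C_GN * ‖u‖ ^ 2 *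
            √((1 / 3) * E + (1 / 3) * supNorm V + (2 / 3) * supNorm (xDotGrad V)))) ∧
        (∀ ε > 0, ∃ δ > 0, ∀ (E : ℝ) (u : L2), IsBoundState V E u → ‖u‖ < δ →
          ∀ z ∈ spectrumJL V E u, |z.re| < ε) := by
  obtain ⟨C₁, hC₁⟩ := exists_isHLSConstant
  obtain ⟨C₂, hC₂⟩ := exists_exchangeNorm_le
  obtain ⟨K, hK0, hK⟩ := exists_isGNConstant
  -- C₁ belongs to the kernel |x - y|⁻¹ of the stated inequality and C₂ to the exchange operator;
  -- the sum dominates both, and the 1 gives positivity.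
  set C : ℝ := C₁ + C₂ + 1 with hCdef
  have hC0 : 0 < C := by positivity
  have hCC₂ : (C₂ : ℝ) ≤ C := by rw [hCdef]; linarith [C₁.coe_nonneg]
  have hCC₁ : (C₁ : ℝ) ≤ C := by rw [hCdef]; linarith [C₂.coe_nonneg]
  refine ⟨C, K, hC0, hK0, hC₁ C hCC₁, hK, fun V hV => ?_⟩
  have exch {E : ℝ} {u : L2} {G : Fin 3 → L2} (hu : IsBoundState V E u) (hG : HasGrad u G) :
      exchangeNorm u ≠ ∞ ∧ (exchangeNorm u).toReal ≤ C * L3norm u ^ 2 := by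
    obtain ⟨h1, h2⟩ := hC₂ u (memLp_three hK0 hK hu.memH1 hG)
    exact ⟨h1, h2.trans (by gcongr)⟩
  have chain {E : ℝ} {u : L2} {G : Fin 3 → L2} (hu : IsBoundState V E u) (hG : HasGrad u G) :
      C * L3norm u ^ 2 ≤ C * K * gradNorm G * ‖u‖ := by
    have := mul_le_mul_of_nonneg_left (L3norm_sq_le hK0 hK hu.memH1 hG) hC0.le
    linarith
  have bound {E : ℝ} {u : L2} {G : Fin 3 → L2} (hu : IsBoundState V E u) (hG : HasGrad u G) :
      ∀ z ∈ spectrumJL V E u, |z.re| ≤ C * L3norm u ^ 2 := fun z hz =>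
    (abs_re_le_of_mem_spectrumJL hV.memLp_top hu.real (memLp_six hK hu.memH1 hG)
      (exch hu hG).1 hz).trans (exch hu hG).2
  refine ⟨fun E u G hu hG => ?_, fun ε hε => ?_⟩
  · have virial := hu.virial_identity hV (memLp_six hK hu.memH1 hG) hG
    refine ⟨memLp_three hK0 hK hu.memH1 hG, eigenvaluesJL_subset_spectrumJL V E u, bound hu hG,
      chain hu hG, virial, fun z hz => ?_⟩
    refine abs_re_le_sqrt (by positivity) (norm_nonneg u)
      ((bound hu hG z hz).trans (chain hu hG)) ?_
    -- The virial formula with both potential integrals replaced by sup norms bounds ‖∇u‖² by the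
    -- radicand times ‖u‖².
    rw [gradNorm_sq, virial, ← norm_sq_eq_integral]
    have hP := integral_mul_norm_sq_le hV.memLp_top u
    have hQ := integral_mul_norm_sq_le hV.xDotGrad_memLp_top u
    linarith
  · set q : ℝ := supNorm (xDotGrad V)
    have hq : 0 ≤ q := ENNReal.toReal_nonneg
    set A : ℝ := C * K * (C * K + q + 1) with hA
    have hA0 : 0 < A := by positivity
    -- The gradient bound needs ‖u‖ ≤ 1. A multiplies its factor C K + q + 1 by the factor C K of
    -- the growth bound.
    refine ⟨min 1 (ε / A), by positivity, fun E u hu hlt z hz => ?_⟩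
    obtain ⟨G, hG⟩ := exists_hasGrad hu.memH1
    have hM1 : ‖u‖ ≤ 1 := hlt.le.trans (min_le_left _ _)
    have hMA : A * ‖u‖ < ε := by
      rw [mul_comm, ← lt_div_iff₀ hA0]
      exact hlt.trans_le (min_le_right _ _)
    have hD := integral_hartree_le hu.real (exch hu hG).1
    have hQ := integral_mul_norm_sq_le hV.xDotGrad_memLp_top u
    have hD' : (exchangeNorm u).toReal * ‖u‖ ^ 2 ≤ C * K * gradNorm G * ‖u‖ * ‖u‖ ^ 2 := by
      gcongr
      exact (exch hu hG).2.trans (chain hu hG)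
    have hk : gradNorm G ≤ (C * K + q + 1) * ‖u‖ := by
      refine le_of_sq_le_cubic (by positivity) hq (norm_nonneg u) hM1 ?_
      rw [gradNorm_sq, hu.gradSq_eq_hartree hV (memLp_six hK hu.memH1 hG) hG]
      linarith
    calc |z.re| ≤ C * K * gradNorm G * ‖u‖ := (bound hu hG z hz).trans (chain hu hG)
      _ ≤ C * K * gradNorm G * 1 := by
          have := gradNorm_nonneg G
          gcongr
      _ ≤ C * K * ((C * K + q + 1) * ‖u‖) * 1 := by gcongr
      _ = A * ‖u‖ := by rw [hA]; ring
      _ < ε := hMA
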